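/- Write $d((t,x),(t',x'))=\sqrt{|t-t'|}+|x-x'|$ for the parabolic distance on $\mathbb R\times\mathbb R^d$ and, for $a$ on $\mathbb R\times\mathbb R^d$, $[a]_\alpha=\sup_{z\neq z'}\frac{|a(z)-a(z')|}{d(z,z')^\alpha}\in[0,\infty]$. Let $\alpha>0$ and $s\in\mathbb R$. There is a constant $C=C(\alpha,s)\in(0,\infty)$ such that the following holds for every dimension $d\ge1$ with $\alpha<\min\{\frac{s-d}{2},1\}$. Let $\hat K:(2\pi\mathbb Z)^d\to[0,\infty)$ satisfy $\hat K(-k)=\hat K(k)$ and $\hat K(k)\le(1+|k|^2)^{-s/2}$ for all $k$. Let $(\beta_k)_{k\in(2\pi\mathbb Z)^d}$ be complex standard Brownian motions on a probability space (for $k\ne0$ real and imaginary parts are independent Brownian motions of variance $t/2$ at time $t$; $\beta_0$ is a real standard Brownian motion) which are independent up to the constraint $\beta_{-k}=\overline{\beta_k}$. Consider the real-valued random field given by $v(t,x)=0$ for $t\le0$ and $$v(t,x)=\sum_{k\in(2\pi\mathbb Z)^d}\sqrt{\hat K(k)}\,e^{ik\cdot x}\int_0^{\min\{t,1\}}e^{-(t-r)|k|^2}\,d\beta_k(r)\qquad(t>0),$$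 where for each $(t,x)$ the series converges unconditionally in mean square. Then $v$ has a version whose realisations are almost surely continuous on $\mathbb R\times\mathbb R^d$. For every such version, almost surely $v(t,\cdot)$ is differentiable on $\mathbb R^d$ for all $t$, the seminorm $[\nabla v]_\alpha$ of the spatial gradient $\nabla v$ is an (almost everywhere) measurable function of the realisation, and $$\Big\langle\exp\Big(\frac1C[\nabla v]_\alpha^2\Big)\Big\rangle<\infty ,$$ where $\langle\cdot\rangle$ denotes the expectation. -/

import Mathlib

open MeasureTheory ProbabilityTheory Filter Topology
open scoped ENNReal NNReal Gradient

noncomputable section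

/-- The parabolic distance `√|t - t'| + |x - x'|` on space-time `ℝ × ℝ^d`. -/
def parabolicDist {d : ℕ} (z z' : ℝ × EuclideanSpace ℝ (Fin d)) : ℝ :=
  √|z.1 - z'.1| + ‖z.2 - z'.2‖

/-- The parabolic Hölder seminorm
`[a]_α = sup_{z ≠ z'} |a z - a z'| / d(z, z')^α` over the whole space-time, as an extended
nonnegative number (so it is `∞` exactly when the supremum is not finite). -/
def parabolicHolderSeminorm {d : ℕ} {F : Type*} [NormedAddCommGroup F] (α : ℝ)
    (a : ℝ × EuclideanSpace ℝ (Fin d) → F) : ℝ≥0∞ :=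
  ⨆ (z : ℝ × EuclideanSpace ℝ (Fin d)) (z' : ℝ × EuclideanSpace ℝ (Fin d)) (_ : z ≠ z'),
    ENNReal.ofReal (‖a z - a z'‖ / parabolicDist z z' ^ α)

/-- The wave vector `k = 2πn ∈ (2πℤ)^d` with index `n ∈ ℤ^d`. -/
def waveVector {d : ℕ} (n : Fin d → ℤ) : EuclideanSpace ℝ (Fin d) :=
  WithLp.toLp 2 fun i => 2 * Real.pi * (n i : ℝ)

/-- A family `(β_k)`, `k = 2πn` with `n ∈ ℤ^d`, of complex standard Brownian motions
(`⟨|β_k(t)|²⟩ = t`) that is independent up to the constraint `β_{-k} = conj β_k`. For `k ≠ 0` the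
real and the imaginary part are independent Brownian motions of variance `t / 2`; the
constraint makes `β_0` real. -/
structure IsConjSymmBrownianFamily {d : ℕ} {Ω : Type*} [MeasurableSpace Ω] (P : Measure Ω)
    (β : (Fin d → ℤ) → ℝ≥0 → Ω → ℂ) : Prop where
  measurable : ∀ n t, Measurable (β n t)
  conj_symm : ∀ n, ∀ᵐ ω ∂P, ∀ t, β (-n) t ω = starRingEnd ℂ (β n t ω)
  brownian_zero : IsBrownianReal (fun t ω => (β 0 t ω).re) P
  brownian_re : ∀ n, n ≠ 0 → IsBrownianReal (fun t ω => √2 * (β n t ω).re) P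
  brownian_im : ∀ n, n ≠ 0 → IsBrownianReal (fun t ω => √2 * (β n t ω).im) P
  indep_re_im : ∀ n, n ≠ 0 →
    IndepFun (fun ω t => (β n t ω).re) (fun ω t => (β n t ω).im) P
  /-- The processes indexed by a set that contains at most one of `n` and `-n` for each `n ≠ 0`
  are mutually independent. -/
  indep : ∀ S : Set (Fin d → ℤ), (∀ n ∈ S, -n ∈ S → n = 0) →
    iIndepFun (fun (n : S) ω t => β n t ω) P

/-- The integral `∫_0^T f(s) db(s)` of a deterministic function `f` along a path `b`, as the limit
of the Riemann sums over the uniform partitions of `[0, T]`. For a continuously differentiable `f`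
and a continuous path `b` the limit exists; for a Brownian path it is almost surely
the Wiener integral. -/
def pathIntegral (f : ℝ → ℝ) (b : ℝ≥0 → ℂ) (T : ℝ≥0) : ℂ :=
  limUnder atTop fun N : ℕ => ∑ i ∈ Finset.range N,
    (f ((T * i / N : ℝ≥0) : ℝ) : ℂ) * (b (T * (i + 1) / N) - b (T * i / N))

/-- The term with wave vector `k = 2πn` of the Fourier series of the linear stochastic heat
equation: `√(K̂ k) e^{i k·x} ∫_0^{min(t,1)} e^{-(t-s)|k|²} dβ_k(s)`. -/
def heatFourierTerm {d : ℕ} {Ω : Type*} (Khat : (Fin d → ℤ) → ℝ)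
    (β : (Fin d → ℤ) → ℝ≥0 → Ω → ℂ) (t : ℝ) (x : EuclideanSpace ℝ (Fin d))
    (n : Fin d → ℤ) (ω : Ω) : ℂ :=
  (√(Khat n) : ℂ) * Complex.exp (Complex.I * (inner ℝ (waveVector n) x : ℝ)) *
    pathIntegral (fun s => Real.exp (-(t - s) * ‖waveVector n‖ ^ 2)) (fun s => β n s ω)
      (min t 1).toNNReal

/-- `v` is a (real-valued) continuous version of the random field that vanishes for `t ≤ 0` and,
for `t > 0`, is the sum of the Fourier series
`∑_k √(K̂ k) e^{i k·x} ∫_0^{min(t,1)} e^{-(t-s)|k|²} dβ_k(s)`: for each `(t, x)` the series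
converges (unconditionally) to `v t x` in mean square, and almost every realisation of `v` is
continuous on space-time. -/
structure IsLinearHeatField {d : ℕ} {Ω : Type*} [MeasurableSpace Ω] (P : Measure Ω)
    (Khat : (Fin d → ℤ) → ℝ) (β : (Fin d → ℤ) → ℝ≥0 → Ω → ℂ)
    (v : ℝ → EuclideanSpace ℝ (Fin d) → Ω → ℝ) : Prop where
  measurable : ∀ t x, Measurable (v t x)
  continuous_paths : ∀ᵐ ω ∂P, Continuous fun z : ℝ × EuclideanSpace ℝ (Fin d) => v z.1 z.2 ω
  zero_of_nonpos : ∀ᵐ ω ∂P, ∀ t ≤ 0, ∀ x, v t x ω = 0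
  fourier_series : ∀ t > 0, ∀ x,
    Tendsto (fun s : Finset (Fin d → ℤ) =>
      eLpNorm (fun ω => (v t x ω : ℂ) - ∑ n ∈ s, heatFourierTerm Khat β t x n ω) 2 P)
      atTop (𝓝 0)

/-- The spatial gradient `∇v(t, x)` of one realisation, as a function on space-time. -/
def spatialGradient {d : ℕ} {Ω : Type*} (v : ℝ → EuclideanSpace ℝ (Fin d) → Ω → ℝ) (ω : Ω)
    (z : ℝ × EuclideanSpace ℝ (Fin d)) : EuclideanSpace ℝ (Fin d) :=
  ∇ (fun x => v z.1 x ω) z.2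

end

/-!
For a wave vector `k ≠ 0` the stochastic integral of the `k`-th mode is a limit of Riemann sums, and
integration by parts turns the limit into a continuous function of the Brownian path. At the level
of Riemann sums the mode is a sum of independent centred Gaussian increments, so the increments of a
mode are sub-Gaussian with variance proxy of order `|k|^{2θ-2} d(z, z')^{2θ}` for `θ ∈ [0, 1]`.
The modes of a half space are independent, so for any finite sum of the gradient's modes (amplitude
at most `(1 + |k|²)^{-s/4} |k|`) the proxies add up to `W d(z, z')^{2θ}` with
`W ≲ ∑_k (1 + |k|²)^{-s/2} |k|^{2θ}`, which is finite for `θ < (s - d)/2`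
(`IsContinuousVersion.hasSubgaussianMGF_modeSum_sub`).

Such a finite sum is periodic in space, vanishes for negative times, and solves the heat equation
after time `1`, so that its values at late times are Gaussian averages of those at time `1`. A
Hölder bound on `[0, 1]` times a box therefore extends to all of space-time (`holder_of_heatFlow`).
On the box, chaining over dyadic grids in parabolic scaling (`exists_holder_of_grid`) shows that all
increments are controlled, at any exponent `α < θ`, by one random variable `M`: a weighted sum over
pairs of grid points of the exponentials of squared normalised increments. Each of these has a
uniformly bounded expectation (`HasSubgaussianMGF.lintegral_exp_sq_le`), and hence so has `M`, which
bounds `exp (increment² / (C W d(z, z')^{2α}))` for all `z, z'` at once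
(`exists_exp_moment_holder`).

The finite sums are taken along finite sets of wave vectors that exhaust the lattice so fast that
the proxies of successive blocks decay geometrically; then almost surely the block seminorms decay
geometrically too (`IsContinuousVersion.ae_hasBlockDecay`), the series and its gradient converge
locally uniformly, and the sum is differentiable in space with the expected gradient
(`hasGradientAt_heatField`). The limit is a version of the field, and any other version agrees with
it almost surely everywhere, since the two agree almost surely at each point of a countable dense
set (`IsContinuousVersion.exists_isLinearHeatField`, `IsLinearHeatField.ae_eq`). The exponential
moment passes to the limit by Fatou's lemma, and the supremum over `z, z'` in the seminorm costs
nothing because `M` does not depend on them (`exp_parabolicHolderSeminorm_sq_le`). Finally, only the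
finitely many dimensions `d < s` are relevant, so the constant can be chosen independently of `d`.
-/

/-! ### Riemann sums of a smooth function along a continuous path -/

/-- The `i`-th point of the uniform partition of `[a, c]` into `N` intervals. -/
noncomputable def partitionPoint (a c : ℝ≥0) (N i : ℕ) : ℝ≥0 := a + (c - a) * i / N

/-- The Riemann sum for `∫_a^c f db` over the uniform partition of `[a, c]` into `N` intervals, with
`f` evaluated at left end points. -/
noncomputable def riemannSum {F : Type*} [NormedAddCommGroup F] [NormedSpace ℝ F] (f : ℝ → ℝ)
    (b : ℝ≥0 → F) (a c : ℝ≥0) (N : ℕ) : F :=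
  ∑ i ∈ Finset.range N,
    f (partitionPoint a c N i) • (b (partitionPoint a c N (i + 1)) - b (partitionPoint a c N i))

lemma partitionPoint_zero (a c : ℝ≥0) (N : ℕ) : partitionPoint a c N 0 = a := by
  simp [partitionPoint]

lemma partitionPoint_self {a c : ℝ≥0} (h : a ≤ c) {N : ℕ} (hN : N ≠ 0) :
    partitionPoint a c N N = c := by
  have : (N : ℝ≥0) ≠ 0 := by exact_mod_cast hN
  rw [partitionPoint, mul_div_assoc, div_self this, mul_one, add_tsub_cancel_of_le h]

lemma partitionPoint_mono (a c : ℝ≥0) (N : ℕ) : Monotone (partitionPoint a c N) := by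
  intro i j h
  unfold partitionPoint
  gcongr

lemma coe_partitionPoint {a c : ℝ≥0} (h : a ≤ c) (N i : ℕ) :
    (partitionPoint a c N i : ℝ) = a + (c - a) * i / N := by
  simp [partitionPoint, NNReal.coe_sub h]

/-- Integration by parts: Riemann sums of a continuously differentiable function along a continuous
path converge. -/
lemma tendsto_riemannSum {F : Type*} [NormedAddCommGroup F] [NormedSpace ℝ F] [CompleteSpace F]
    {f f' : ℝ → ℝ} (hf : ∀ x, HasDerivAt f (f' x) x) (hf' : Continuous f') {b : ℝ≥0 → F}
    (hb : Continuous b) {a c : ℝ≥0} (hac : a ≤ c) :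
    Tendsto (riemannSum f b a c) atTop
      (𝓝 (f c • b c - f a • b a - ∫ r in (a : ℝ)..c, f' r • b r.toNNReal)) := by
  set B : ℝ → F := fun r => b r.toNNReal with hB
  have hBc : Continuous B := hb.comp continuous_real_toNNReal
  have hac' : (a : ℝ) ≤ c := hac
  obtain ⟨K, hK⟩ := (isCompact_Icc (a := (a : ℝ)) (b := c)).exists_bound_of_continuousOn
    hf'.continuousOn
  have hK0 : 0 ≤ K := (norm_nonneg _).trans (hK a ⟨le_rfl, hac'⟩)
  have hunif := (isCompact_Icc (a := (a : ℝ)) (b := c)).uniformContinuousOn_of_continuous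
    hBc.continuousOn
  rw [Metric.uniformContinuousOn_iff] at hunif
  rw [Metric.tendsto_atTop]
  intro ε hε
  obtain ⟨δ, hδ, hBδ⟩ := hunif (ε / (2 * (K * (c - a) + 1))) (by
    have : 0 ≤ K * ((c : ℝ) - a) := mul_nonneg hK0 (by linarith)
    positivity)
  set η := ε / (2 * (K * ((c : ℝ) - a) + 1)) with hη
  obtain ⟨N₀, hN₀⟩ := exists_nat_gt (((c : ℝ) - a) / δ)
  refine ⟨N₀ + 1, fun N hN => ?_⟩
  have hN0 : N ≠ 0 := by omega
  have hNpos : (0 : ℝ) < N := by exact_mod_cast Nat.pos_of_ne_zero hN0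
  have hmesh : ((c : ℝ) - a) / N < δ := by
    rw [div_lt_iff₀ hNpos]
    rw [div_lt_iff₀ hδ] at hN₀
    have : (N₀ : ℝ) ≤ N := by exact_mod_cast (by omega : N₀ ≤ N)
    nlinarith
  set p : ℕ → ℝ := fun i => partitionPoint a c N i with hp
  have hpm : Monotone p := fun i j h => by exact_mod_cast partitionPoint_mono a c N h
  have hp0 : p 0 = a := by simp [hp, partitionPoint_zero]
  have hpN : p N = c := by simp [hp, partitionPoint_self hac hN0]
  have hstep : ∀ i, p (i + 1) - p i = ((c : ℝ) - a) / N := fun i => by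
    simp only [hp, coe_partitionPoint hac]
    push_cast
    ring
  have hBp : ∀ i, b (partitionPoint a c N i) = B (p i) := fun i => by simp [hB, hp]
  have hint : ∀ x y : ℝ, IntervalIntegrable (fun r => f' r • B r) volume x y := fun x y =>
    (hf'.smul hBc).intervalIntegrable x y
  -- the error is a sum over the partition of integrals of `f'` against the oscillation of the path
  have hdiff : riemannSum f b a c N - (f c • b c - f a • b a - ∫ r in (a : ℝ)..c, f' r • B r)
      = ∑ i ∈ Finset.range N, ∫ r in p i..p (i + 1), f' r • (B r - B (p (i + 1))) := by
    have h1 : f c • b c - f a • b a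
        = ∑ i ∈ Finset.range N, (f (p (i + 1)) • B (p (i + 1)) - f (p i) • B (p i)) := by
      rw [Finset.sum_range_sub (fun i => f (p i) • B (p i)), hpN, hp0]
      simp [hB]
    have h2 : ∫ r in (a : ℝ)..c, f' r • B r
        = ∑ i ∈ Finset.range N, ∫ r in p i..p (i + 1), f' r • B r := by
      rw [intervalIntegral.sum_integral_adjacent_intervals (fun k _ => hint _ _), hp0, hpN]
    rw [h1, h2, riemannSum, ← Finset.sum_sub_distrib, ← Finset.sum_sub_distrib]
    refine Finset.sum_congr rfl fun i _ => ?_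
    have h3 : ∫ r in p i..p (i + 1), f' r • (B r - B (p (i + 1)))
        = (∫ r in p i..p (i + 1), f' r • B r) - (f (p (i + 1)) - f (p i)) • B (p (i + 1)) := by
      simp_rw [smul_sub]
      rw [intervalIntegral.integral_sub (hint _ _)
        (by exact (hf'.smul continuous_const).intervalIntegrable _ _ :
          IntervalIntegrable (fun r => f' r • B (p (i + 1))) volume _ _),
        intervalIntegral.integral_smul_const,
        intervalIntegral.integral_eq_sub_of_hasDerivAt (fun x _ => hf x)
          (hf'.intervalIntegrable _ _)]
    rw [h3, hBp, hBp]
    simp only [hp, smul_sub, sub_smul]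
    abel
  rw [dist_eq_norm]
  have hmem : ∀ i ≤ N, p i ∈ Set.Icc (a : ℝ) c := fun i hi =>
    ⟨hp0 ▸ hpm (Nat.zero_le i), hpN ▸ hpm hi⟩
  have hbound : ∀ i ∈ Finset.range N, ‖∫ r in p i..p (i + 1), f' r • (B r - B (p (i + 1)))‖
      ≤ K * η * (p (i + 1) - p i) := by
    intro i hi
    rw [Finset.mem_range] at hi
    have hle := hpm (Nat.le_succ i)
    have := intervalIntegral.norm_integral_le_of_norm_le_const (a := p i) (b := p (i + 1))
      (f := fun r => f' r • (B r - B (p (i + 1)))) (C := K * η) (fun r hr => by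
        rw [Set.uIoc_of_le hle] at hr
        have hrm : r ∈ Set.Icc (a : ℝ) c :=
          ⟨(hmem i hi.le).1.trans hr.1.le, hr.2.trans (hmem (i + 1) hi).2⟩
        rw [norm_smul]
        refine mul_le_mul (hK r hrm) ?_ (norm_nonneg _) hK0
        rw [← dist_eq_norm]
        refine (hBδ r hrm _ (hmem (i + 1) hi) ?_).le
        rw [Real.dist_eq, abs_sub_lt_iff]
        have := hstep i
        constructor <;> linarith [hr.1, hr.2])
    rwa [abs_of_nonneg (by simpa using hle)] at this
  have hfinal : ‖riemannSum f b a c N -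
      (f c • b c - f a • b a - ∫ r in (a : ℝ)..c, f' r • B r)‖ ≤ K * η * (c - a) := by
    rw [hdiff]
    refine (norm_sum_le_of_le _ hbound).trans_eq ?_
    rw [← Finset.mul_sum, Finset.sum_range_sub p, hpN, hp0]
  refine hfinal.trans_lt ?_
  have h0 : 0 ≤ K * ((c : ℝ) - a) := mul_nonneg hK0 (by linarith)
  have : K * η * (c - a) = ε * ((K * (c - a)) / (2 * (K * ((c : ℝ) - a) + 1))) := by
    rw [hη]; ring
  rw [this]
  have : (K * ((c : ℝ) - a)) / (2 * (K * ((c : ℝ) - a) + 1)) < 1 := by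
    rw [div_lt_one (by positivity)]; linarith
  nlinarith

/-- The Riemann sums in `pathIntegral` are those of `riemannSum` on `[0, T]`. -/
lemma pathIntegral_eq_of_tendsto {f : ℝ → ℝ} {b : ℝ≥0 → ℂ} {T : ℝ≥0} {y : ℂ}
    (h : Tendsto (riemannSum f b 0 T) atTop (𝓝 y)) : pathIntegral f b T = y := by
  have : (fun N : ℕ => ∑ i ∈ Finset.range N, (f ((T * i / N : ℝ≥0) : ℝ) : ℂ)
      * (b (T * (i + 1) / N) - b (T * i / N))) = riemannSum f b 0 T := by
    ext N
    simp [riemannSum, partitionPoint]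
  rw [pathIntegral, this]
  exact h.limUnder_eq

/-- The value of `∫_a^c e^{κ r} db(r)` after integration by parts. -/
noncomputable def expIntegral (κ : ℝ) (b : ℝ≥0 → ℂ) (a c : ℝ≥0) : ℂ :=
  Real.exp (κ * c) • b c - Real.exp (κ * a) • b a
    - ∫ r in (a : ℝ)..c, (κ * Real.exp (κ * r)) • b r.toNNReal

lemma tendsto_riemannSum_exp (κ : ℝ) {b : ℝ≥0 → ℂ} (hb : Continuous b) {a c : ℝ≥0} (hac : a ≤ c) :
    Tendsto (riemannSum (fun r => Real.exp (κ * r)) b a c) atTop (𝓝 (expIntegral κ b a c)) := by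
  refine tendsto_riemannSum (f' := fun r => κ * Real.exp (κ * r)) (fun x => ?_) (by fun_prop) hb hac
  have := ((hasDerivAt_id x).const_mul κ).exp
  simpa [mul_comm] using this

lemma expIntegral_add (κ : ℝ) {b : ℝ≥0 → ℂ} (hb : Continuous b) (a c e : ℝ≥0) :
    expIntegral κ b a c + expIntegral κ b c e = expIntegral κ b a e := by
  have hc : Continuous fun r : ℝ => (κ * Real.exp (κ * r)) • b r.toNNReal :=
    (by fun_prop : Continuous fun r : ℝ => κ * Real.exp (κ * r)).smul
      (hb.comp continuous_real_toNNReal)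
  have := intervalIntegral.integral_add_adjacent_intervals (hc.intervalIntegrable a c)
    (hc.intervalIntegrable c e) (μ := volume)
  simp only [expIntegral]
  rw [← this]
  abel

lemma expIntegral_self (κ : ℝ) (b : ℝ≥0 → ℂ) (a : ℝ≥0) : expIntegral κ b a a = 0 := by
  simp [expIntegral]

lemma continuous_expIntegral (κ : ℝ) {b : ℝ≥0 → ℂ} (hb : Continuous b) (a : ℝ≥0) :
    Continuous fun c => expIntegral κ b a c := by
  have hc : Continuous fun r : ℝ => (κ * Real.exp (κ * r)) • b r.toNNReal :=
    (by fun_prop : Continuous fun r : ℝ => κ * Real.exp (κ * r)).smul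
      (hb.comp continuous_real_toNNReal)
  have h1 : Continuous fun c : ℝ => ∫ r in (a : ℝ)..c, (κ * Real.exp (κ * r)) • b r.toNNReal :=
    intervalIntegral.continuous_primitive (fun x y => hc.intervalIntegrable x y) _
  have h2 := h1.comp NNReal.continuous_coe
  have h3 : Continuous fun c : ℝ≥0 => Real.exp (κ * c) • b c :=
    (by fun_prop : Continuous fun c : ℝ≥0 => Real.exp (κ * c)).smul hb
  exact (h3.sub continuous_const).sub h2

/-- The integral of the heat factor along a continuous path. -/
lemma pathIntegral_heat (κ t : ℝ) {b : ℝ≥0 → ℂ} (hb : Continuous b) (T : ℝ≥0) :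
    pathIntegral (fun s => Real.exp (-(t - s) * κ)) b T
      = Real.exp (-(κ * t)) • expIntegral κ b 0 T := by
  refine pathIntegral_eq_of_tendsto ?_
  have := (tendsto_riemannSum_exp κ hb (zero_le : 0 ≤ T)).const_smul (Real.exp (-(κ * t)))
  refine this.congr fun N => ?_
  simp only [riemannSum, Finset.smul_sum, smul_smul, ← Real.exp_add]
  refine Finset.sum_congr rfl fun i _ => ?_
  congr 2
  ring

/-! ### Sub-Gaussian random variables -/

namespace ProbabilityTheory

variable {Ω : Type*} {mΩ : MeasurableSpace Ω} {P : Measure Ω}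

lemma HasSubgaussianMGF.mono {X : Ω → ℝ} {c c' : ℝ≥0} (h : HasSubgaussianMGF X c P) (hc : c ≤ c') :
    HasSubgaussianMGF X c' P where
  integrable_exp_mul := h.integrable_exp_mul
  mgf_le t := (h.mgf_le t).trans (Real.exp_le_exp.2 (by gcongr))

lemma HasSubgaussianMGF.const_mul_of_le {X : Ω → ℝ} {c c' : ℝ}
    (h : HasSubgaussianMGF X c.toNNReal P) (r : ℝ) (hc : r ^ 2 * c ≤ c') :
    HasSubgaussianMGF (fun ω => r * X ω) c'.toNNReal P := by
  refine HasSubgaussianMGF.mono (h.const_mul r) ?_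
  rw [← NNReal.coe_le_coe]
  change r ^ 2 * (c.toNNReal : ℝ) ≤ c'.toNNReal
  rcases le_total 0 c with h0 | h0
  · rw [Real.coe_toNNReal _ h0]
    exact hc.trans (Real.le_coe_toNNReal _)
  · rw [Real.toNNReal_of_nonpos h0]
    simp

/-- The sum of two sub-Gaussian variables that need not be independent. -/
lemma HasSubgaussianMGF.add_of_le {X Y : Ω → ℝ} {c e u : ℝ} (hX : HasSubgaussianMGF X c.toNNReal P)
    (hY : HasSubgaussianMGF Y e.toNNReal P) (hc : 0 ≤ c) (he : 0 ≤ e) (h : 2 * c + 2 * e ≤ u) :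
    HasSubgaussianMGF (fun ω => X ω + Y ω) u.toNNReal P := by
  refine HasSubgaussianMGF.mono (hX.add hY) ?_
  rw [← NNReal.coe_le_coe]
  push_cast
  rw [Real.coe_toNNReal _ hc, Real.coe_toNNReal _ he]
  refine le_trans ?_ (h.trans (Real.le_coe_toNNReal _))
  nlinarith [sq_nonneg (√c - √e), Real.sq_sqrt hc, Real.sq_sqrt he]

lemma HasSubgaussianMGF.sum_of_iIndepFun_of_le {ι : Type*} {X : ι → Ω → ℝ} (hX : iIndepFun X P)
    {c : ι → ℝ} {s : Finset ι} (h0 : ∀ i ∈ s, 0 ≤ c i)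
    (h : ∀ i ∈ s, HasSubgaussianMGF (X i) (c i).toNNReal P) {u : ℝ} (hu : ∑ i ∈ s, c i ≤ u) :
    HasSubgaussianMGF (fun ω => ∑ i ∈ s, X i ω) u.toNNReal P := by
  refine HasSubgaussianMGF.mono (HasSubgaussianMGF.sum_of_iIndepFun hX h) ?_
  rw [← Real.toNNReal_sum_of_nonneg h0]
  exact Real.toNNReal_le_toNNReal hu

/-- Sub-Gaussian bounds pass to almost sure limits, by Fatou's lemma. -/
lemma HasSubgaussianMGF.of_tendsto [IsProbabilityMeasure P] {X : ℕ → Ω → ℝ} {Y : Ω → ℝ} {c : ℝ≥0}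
    (h : ∀ N, HasSubgaussianMGF (X N) c P)
    (hY : ∀ᵐ ω ∂P, Tendsto (fun N => X N ω) atTop (𝓝 (Y ω))) : HasSubgaussianMGF Y c P := by
  have hYm : AEMeasurable Y P := aemeasurable_of_tendsto_metrizable_ae atTop
    (fun N => (h N).aemeasurable) hY
  have key : ∀ t : ℝ, ∫⁻ ω, ENNReal.ofReal (Real.exp (t * Y ω)) ∂P
      ≤ ENNReal.ofReal (Real.exp (c * t ^ 2 / 2)) := by
    intro t
    have h1 : ∀ N, ∫⁻ ω, ENNReal.ofReal (Real.exp (t * X N ω)) ∂P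
        ≤ ENNReal.ofReal (Real.exp (c * t ^ 2 / 2)) := fun N => by
      rw [← ofReal_integral_eq_lintegral_ofReal ((h N).integrable_exp_mul t)
        (ae_of_all _ fun _ => (Real.exp_pos _).le)]
      exact ENNReal.ofReal_le_ofReal ((h N).mgf_le t)
    calc ∫⁻ ω, ENNReal.ofReal (Real.exp (t * Y ω)) ∂P
        = ∫⁻ ω, liminf (fun N => ENNReal.ofReal (Real.exp (t * X N ω))) atTop ∂P := by
          refine lintegral_congr_ae ?_
          filter_upwards [hY] with ω hω
          refine (Tendsto.liminf_eq ?_).symm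
          exact ENNReal.tendsto_ofReal ((Real.continuous_exp.tendsto _).comp (hω.const_mul t))
      _ ≤ liminf (fun N => ∫⁻ ω, ENNReal.ofReal (Real.exp (t * X N ω)) ∂P) atTop :=
          lintegral_liminf_le' fun N => by
            have := (h N).aemeasurable
            fun_prop
      _ ≤ ENNReal.ofReal (Real.exp (c * t ^ 2 / 2)) :=
          liminf_le_of_le (by isBoundedDefault) fun b hb =>
            let ⟨N, hN⟩ := hb.exists
            hN.trans (h1 N)
  have hint : ∀ t : ℝ, Integrable (fun ω => Real.exp (t * Y ω)) P := fun t => by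
    refine ⟨(by fun_prop : AEMeasurable _ P).aestronglyMeasurable, ?_⟩
    rw [hasFiniteIntegral_iff_ofReal (ae_of_all _ fun _ => (Real.exp_pos _).le)]
    exact (key t).trans_lt ENNReal.ofReal_lt_top
  refine ⟨hint, fun t => ?_⟩
  have := key t
  rw [← ofReal_integral_eq_lintegral_ofReal (hint t) (ae_of_all _ fun _ => (Real.exp_pos _).le)]
    at this
  exact (ENNReal.ofReal_le_ofReal_iff (Real.exp_pos _).le).1 this

/-- The exponential square moment of a sub-Gaussian variable, by averaging its moment generating
function over an independent Gaussian variable. -/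
lemma HasSubgaussianMGF.lintegral_exp_sq_le [IsProbabilityMeasure P] {X : Ω → ℝ} {c : ℝ}
    (hc : 0 ≤ c) (h : HasSubgaussianMGF X c.toNNReal P) :
    ∫⁻ ω, ENNReal.ofReal (Real.exp (X ω ^ 2 / (4 * c))) ∂P ≤ 2 := by
  rcases hc.eq_or_lt with rfl | hc
  -- for `c = 0` the quotient is `0` by convention
  · simp
  set l : ℝ := 1 / √(2 * c) with hl
  have hl2 : l ^ 2 = 1 / (2 * c) := by
    rw [hl, div_pow, Real.sq_sqrt (by positivity)]; simp
  have hXm : AEMeasurable X P := h.aemeasurable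
  set γ : Measure ℝ := gaussianReal 0 1
  have h1 : ∀ ω, ENNReal.ofReal (Real.exp (X ω ^ 2 / (4 * c)))
      = ∫⁻ ξ, ENNReal.ofReal (Real.exp (l * X ω * ξ)) ∂γ := fun ω => by
    rw [← ofReal_integral_eq_lintegral_ofReal (integrable_exp_mul_gaussianReal _)
        (ae_of_all _ fun _ => (Real.exp_pos _).le)]
    have := congr_fun (mgf_id_gaussianReal (μ := 0) (v := 1)) (l * X ω)
    simp only [mgf, id] at this
    rw [this]
    congr 2
    rw [mul_pow, hl2]
    push_cast
    field_simp
    ring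
  simp_rw [h1]
  rw [lintegral_lintegral_swap (by
    have : AEMeasurable (fun p : Ω × ℝ => X p.1) (P.prod γ) := hXm.comp_fst
    show AEMeasurable (fun p : Ω × ℝ => ENNReal.ofReal (Real.exp (l * X p.1 * p.2))) (P.prod γ)
    fun_prop)]
  have h2 : ∀ ξ, ∫⁻ ω, ENNReal.ofReal (Real.exp (l * X ω * ξ)) ∂P
      ≤ ENNReal.ofReal (Real.exp (ξ ^ 2 / 4)) := fun ξ => by
    have e : ∀ ω, l * X ω * ξ = (l * ξ) * X ω := fun ω => by ring
    simp_rw [e]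
    rw [← ofReal_integral_eq_lintegral_ofReal (h.integrable_exp_mul _)
        (ae_of_all _ fun _ => (Real.exp_pos _).le)]
    refine ENNReal.ofReal_le_ofReal ((h.mgf_le (l * ξ)).trans (Real.exp_le_exp.2 ?_))
    rw [Real.coe_toNNReal _ hc.le, mul_pow, hl2]
    apply le_of_eq
    field_simp
    ring
  refine (lintegral_mono h2).trans ?_
  rw [show γ = _ from gaussianReal_of_var_ne_zero _ one_ne_zero,
    lintegral_withDensity_eq_lintegral_mul _ (measurable_gaussianPDF 0 1) (by fun_prop)]
  have h3 : ∀ ξ : ℝ, (gaussianPDF 0 1 * fun ξ => ENNReal.ofReal (Real.exp (ξ ^ 2 / 4))) ξ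
      = ENNReal.ofReal ((√(2 * Real.pi))⁻¹ * Real.exp (-(1 / 4) * ξ ^ 2)) := fun ξ => by
    rw [Pi.mul_apply, gaussianPDF, ← ENNReal.ofReal_mul (gaussianPDFReal_nonneg _ _ _),
      gaussianPDFReal, mul_assoc, ← Real.exp_add]
    congr 2
    · simp
    · congr 1
      push_cast
      ring
  simp_rw [h3]
  rw [← ofReal_integral_eq_lintegral_ofReal
      ((integrable_exp_neg_mul_sq (by norm_num)).const_mul _) (ae_of_all _ fun _ => by positivity),
    integral_const_mul, integral_gaussian, ← Real.sqrt_inv, ← Real.sqrt_mul (by positivity)]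
  have h4 : (2 * Real.pi)⁻¹ * (Real.pi / (1 / 4)) = 2 := by
    field_simp
    norm_num
  rw [h4, ENNReal.ofReal_le_ofNat]
  exact Real.sqrt_le_iff.2 ⟨by norm_num, by norm_num⟩

lemma HasSubgaussianMGF.lintegral_sq_le [IsProbabilityMeasure P] {X : Ω → ℝ} {c : ℝ} (hc : 0 ≤ c)
    (h : HasSubgaussianMGF X c.toNNReal P) :
    ∫⁻ ω, ENNReal.ofReal (X ω ^ 2) ∂P ≤ ENNReal.ofReal (8 * c) := by
  rcases hc.eq_or_lt with rfl | hc
  · rw [Real.toNNReal_zero] at h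
    have h0 := h.ae_eq_zero_of_hasSubgaussianMGF_zero
    rw [lintegral_congr_ae (g := fun _ => 0) (by filter_upwards [h0] with ω hω; simp [hω])]
    simp
  have h1 : ∀ ω, ENNReal.ofReal (X ω ^ 2)
      ≤ ENNReal.ofReal (4 * c) * ENNReal.ofReal (Real.exp (X ω ^ 2 / (4 * c))) := fun ω => by
    rw [← ENNReal.ofReal_mul (by positivity)]
    refine ENNReal.ofReal_le_ofReal ?_
    have := Real.add_one_le_exp (X ω ^ 2 / (4 * c))
    calc X ω ^ 2 = 4 * c * (X ω ^ 2 / (4 * c)) := by field_simp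
      _ ≤ _ := by gcongr; linarith
  refine (lintegral_mono h1).trans ?_
  rw [lintegral_const_mul' _ _ ENNReal.ofReal_ne_top]
  refine (mul_le_mul_right (h.lintegral_exp_sq_le hc.le) _).trans_eq ?_
  rw [← ENNReal.ofReal_ofNat 2, ← ENNReal.ofReal_mul (by positivity)]
  congr 1
  ring

/-- Riemann sums of `e^{κ r}` along a Brownian path are sub-Gaussian with at most the variance
`∫_a^c e^{2κ r} dr` of the Wiener integral, because `e^{κ r}` is increasing. -/
lemma IsPreBrownianReal.hasSubgaussianMGF_riemannSum_exp {B : ℝ≥0 → Ω → ℝ}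
    (hB : IsPreBrownianReal B P) {κ : ℝ} (hκ : 0 < κ) {a c : ℝ≥0} (hac : a ≤ c) {N : ℕ}
    (hN : N ≠ 0) :
    HasSubgaussianMGF (fun ω => riemannSum (fun r => Real.exp (κ * r)) (fun s => B s ω) a c N)
      ((Real.exp (2 * κ * c) - Real.exp (2 * κ * a)) / (2 * κ)).toNNReal P := by
  set p : ℕ → ℝ≥0 := partitionPoint a c N with hp
  have hpm : Monotone p := partitionPoint_mono a c N
  have hind := hB.hasIndepIncrements N (fun i => p i) (fun i j h => hpm h)
  have hind2 := hind.comp (fun i x => Real.exp (κ * p i) * x) (fun i => by fun_prop)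
  have e : (fun ω => riemannSum (fun r => Real.exp (κ * r)) (fun s => B s ω) a c N)
      = fun ω => ∑ i : Fin N, ((fun x => Real.exp (κ * p i) * x) ∘
        fun ω => B (p i.succ) ω - B (p i.castSucc) ω) ω := by
    ext ω
    rw [riemannSum, Finset.sum_range]
    simp [hp]
  rw [e]
  have hlaw : ∀ i : ℕ, HasSubgaussianMGF (fun ω => B (p (i + 1)) ω - B (p i) ω)
      ((p (i + 1) : ℝ) - p i).toNNReal P := fun i => by
    have h1 := hB.hasLaw_sub (p (i + 1)) (p i)
    have h3 : nndist (p (i + 1)).1 (p i).1 = ((p (i + 1) : ℝ) - p i).toNNReal := by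
      rw [← NNReal.coe_inj, coe_nndist, Real.dist_eq,
        Real.coe_toNNReal _ (by simpa using hpm (Nat.le_succ i)), abs_of_nonneg]
      · rfl
      · simpa using hpm (Nat.le_succ i)
    rw [h3] at h1
    refine ⟨fun t => ?_, fun t => ?_⟩
    · have := integrable_exp_mul_gaussianReal (μ := 0) (v := ((p (i + 1) : ℝ) - p i).toNNReal) t
      rw [← h1.map_eq] at this
      exact (integrable_map_measure (by fun_prop) h1.aemeasurable).1 this
    · have := mgf_gaussianReal h1.map_eq t
      refine le_of_eq ?_
      rw [zero_mul, zero_add] at this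
      exact this
  -- `1 + y ≤ exp y` compares each summand with the integral over its interval
  have hstep : ∀ i : ℕ, Real.exp (κ * p i) ^ 2 * ((p (i + 1) : ℝ) - p i)
      ≤ (Real.exp (2 * κ * p (i + 1)) - Real.exp (2 * κ * p i)) / (2 * κ) := fun i => by
    rw [le_div_iff₀ (by positivity)]
    have h1 := Real.add_one_le_exp (2 * κ * ((p (i + 1) : ℝ) - p i))
    have h2 : Real.exp (2 * κ * p (i + 1))
        = Real.exp (κ * p i) ^ 2 * Real.exp (2 * κ * ((p (i + 1) : ℝ) - p i)) := by
      rw [← Real.exp_nat_mul, ← Real.exp_add]; congr 1; push_cast; ring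
    have h3 : Real.exp (2 * κ * p i) = Real.exp (κ * p i) ^ 2 := by
      rw [← Real.exp_nat_mul]; congr 1; push_cast; ring
    rw [h2, h3]
    have := mul_le_mul_of_nonneg_left h1 (sq_nonneg (Real.exp (κ * p i)))
    linarith
  refine HasSubgaussianMGF.sum_of_iIndepFun_of_le hind2
    (c := fun i : Fin N =>
      (Real.exp (2 * κ * p ((i : ℕ) + 1)) - Real.exp (2 * κ * p i)) / (2 * κ))
    (fun i _ => ?_) (fun i _ => ?_) ?_
  · refine div_nonneg (sub_nonneg.2 (Real.exp_le_exp.2 ?_)) (by positivity)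
    have : (p (i : ℕ) : ℝ) ≤ p ((i : ℕ) + 1) := hpm (Nat.le_succ _)
    gcongr
  · exact HasSubgaussianMGF.const_mul_of_le (hlaw i) _ (hstep i)
  · rw [Fin.sum_univ_eq_sum_range
      (fun i => (Real.exp (2 * κ * p (i + 1)) - Real.exp (2 * κ * p i)) / (2 * κ)),
      ← Finset.sum_div, Finset.sum_range_sub (fun i => Real.exp (2 * κ * p i))]
    simp [hp, partitionPoint_zero, partitionPoint_self hac hN]

end ProbabilityTheory

/-! ### Deterministic chaining in parabolic scaling -/

section ParabolicDist

variable {d : ℕ}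

lemma parabolicDist_nonneg (z z' : ℝ × EuclideanSpace ℝ (Fin d)) : 0 ≤ parabolicDist z z' := by
  unfold parabolicDist; positivity

lemma parabolicDist_comm (z z' : ℝ × EuclideanSpace ℝ (Fin d)) :
    parabolicDist z z' = parabolicDist z' z := by
  rw [parabolicDist, parabolicDist, abs_sub_comm, norm_sub_rev]

lemma sqrt_add_le_add_sqrt {a b : ℝ} (ha : 0 ≤ a) (hb : 0 ≤ b) : √(a + b) ≤ √a + √b := by
  rw [Real.sqrt_le_left (by positivity)]
  nlinarith [Real.sq_sqrt ha, Real.sq_sqrt hb, Real.sqrt_nonneg a, Real.sqrt_nonneg b,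
    mul_nonneg (Real.sqrt_nonneg a) (Real.sqrt_nonneg b)]

lemma parabolicDist_triangle (z w z' : ℝ × EuclideanSpace ℝ (Fin d)) :
    parabolicDist z z' ≤ parabolicDist z w + parabolicDist w z' := by
  unfold parabolicDist
  have h1 : √|z.1 - z'.1| ≤ √|z.1 - w.1| + √|w.1 - z'.1| :=
    (Real.sqrt_le_sqrt (abs_sub_le _ w.1 _)).trans
      (sqrt_add_le_add_sqrt (abs_nonneg _) (abs_nonneg _))
  have h2 : ‖z.2 - z'.2‖ ≤ ‖z.2 - w.2‖ + ‖w.2 - z'.2‖ := norm_sub_le_norm_sub_add_norm_sub _ _ _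
  linarith

lemma parabolicDist_pos {z z' : ℝ × EuclideanSpace ℝ (Fin d)} (h : z ≠ z') :
    0 < parabolicDist z z' := by
  unfold parabolicDist
  by_cases h1 : z.1 = z'.1
  · have h2 : z.2 ≠ z'.2 := fun h2 => h (Prod.ext h1 h2)
    have := norm_pos_iff.2 (sub_ne_zero.2 h2)
    positivity
  · have := Real.sqrt_pos.2 (abs_pos.2 (sub_ne_zero.2 h1))
    positivity

lemma EuclideanSpace.norm_le_of_forall_abs_le {x : EuclideanSpace ℝ (Fin d)} {r : ℝ}
    (h : ∀ l, |x l| ≤ r) : ‖x‖ ≤ d * r := by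
  rcases Nat.eq_zero_or_pos d with rfl | hd
  · simp [Subsingleton.elim x 0]
  have hr : 0 ≤ r := (abs_nonneg _).trans (h ⟨0, hd⟩)
  have hd1 : (1 : ℝ) ≤ d := by exact_mod_cast hd
  rw [EuclideanSpace.norm_eq]
  refine Real.sqrt_le_iff.2 ⟨by positivity, ?_⟩
  calc ∑ i, ‖x i‖ ^ 2 ≤ ∑ _i : Fin d, r ^ 2 := Finset.sum_le_sum fun i _ => by
        rw [Real.norm_eq_abs]; gcongr; exact h i
    _ = d * r ^ 2 := by simp
    _ ≤ (d * r) ^ 2 := by nlinarith [sq_nonneg r]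

/-- The point of the parabolic dyadic grid of level `n` with indices `i` in time and `j` in space:
the mesh is `4⁻ⁿ` in time and `2⁻ⁿ` in space. -/
noncomputable def gridPoint (n : ℕ) (i : ℕ) (j : Fin d → ℤ) : ℝ × EuclideanSpace ℝ (Fin d) :=
  (i / 4 ^ n, WithLp.toLp 2 fun l => (j l : ℝ) / 2 ^ n)

open Classical in
/-- The points of the grid of level `n` in `[0, 1] × [-2, 2]^d`. -/
noncomputable def gridSet (d n : ℕ) : Finset (ℝ × EuclideanSpace ℝ (Fin d)) :=
  (Finset.range (4 ^ n + 1) ×ˢ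
    Fintype.piFinset fun _ : Fin d => Finset.Icc (-(2 * 2 ^ n) : ℤ) (2 * 2 ^ n)).image
      fun p => gridPoint n p.1 p.2

open Classical in
/-- The grid points of two consecutive levels, between which increments are controlled. -/
noncomputable def gridPair (d n : ℕ) : Finset (ℝ × EuclideanSpace ℝ (Fin d)) :=
  gridSet d n ∪ gridSet d (n + 1)

lemma card_gridSet_le (d n : ℕ) : (gridSet d n).card ≤ 2 * 5 ^ d * (2 ^ (d + 2)) ^ n := by
  classical
  refine Finset.card_image_le.trans ?_
  rw [Finset.card_product, Finset.card_range, Fintype.card_piFinset]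
  simp only [Int.card_Icc, Finset.prod_const, Finset.card_univ, Fintype.card_fin]
  have h1 : ((2 * 2 ^ n + 1 - -(2 * 2 ^ n) : ℤ)).toNat ≤ 5 * 2 ^ n := by
    have : (1 : ℤ) ≤ 2 ^ n := one_le_pow₀ (by norm_num)
    rw [Int.toNat_le]
    push_cast
    linarith
  have h2 : 4 ^ n + 1 ≤ 2 * 4 ^ n := by
    have : 1 ≤ 4 ^ n := Nat.one_le_pow _ _ (by norm_num)
    omega
  calc _ ≤ (2 * 4 ^ n) * (5 * 2 ^ n) ^ d := by gcongr
    _ = _ := by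
      rw [mul_pow, ← pow_mul, ← pow_mul, show (4 : ℕ) = 2 ^ 2 by norm_num, ← pow_mul]
      ring

lemma card_gridPair_le (d n : ℕ) :
    (gridPair d n).card ≤ (2 * 5 ^ d * (1 + 2 ^ (d + 2))) * (2 ^ (d + 2)) ^ n := by
  classical
  refine (Finset.card_union_le _ _).trans
    ((add_le_add (card_gridSet_le d n) (card_gridSet_le d (n + 1))).trans_eq ?_)
  ring

/-- Rounding down to the grid of level `n`. -/
noncomputable def gridRound (n : ℕ) (z : ℝ × EuclideanSpace ℝ (Fin d)) :
    ℝ × EuclideanSpace ℝ (Fin d) :=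
  gridPoint n ⌊4 ^ n * z.1⌋₊ fun l => ⌊2 ^ n * z.2 l⌋

/-- The space-time box on which chaining is carried out. -/
def InChainBox (z : ℝ × EuclideanSpace ℝ (Fin d)) : Prop :=
  z.1 ∈ Set.Icc (0 : ℝ) 1 ∧ ∀ l, |z.2 l| ≤ 2

lemma gridRound_mem (n : ℕ) {z : ℝ × EuclideanSpace ℝ (Fin d)} (hz : InChainBox z) :
    gridRound n z ∈ gridSet d n := by
  classical
  refine Finset.mem_image.2 ⟨(⌊4 ^ n * z.1⌋₊, fun l => ⌊2 ^ n * z.2 l⌋), ?_, rfl⟩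
  rw [Finset.mem_product, Finset.mem_range, Fintype.mem_piFinset]
  refine ⟨Nat.lt_succ_of_le (Nat.floor_le_of_le ?_), fun l => Finset.mem_Icc.2 ⟨?_, ?_⟩⟩
  · push_cast
    exact mul_le_of_le_one_right (by positivity) hz.1.2
  · rw [Int.le_floor]
    push_cast
    have := (abs_le.1 (hz.2 l)).1
    nlinarith [pow_pos (zero_lt_two' ℝ) n]
  · refine Int.floor_le_iff.2 ?_
    push_cast
    have := (abs_le.1 (hz.2 l)).2
    nlinarith [pow_pos (zero_lt_two' ℝ) n]

lemma abs_fst_gridRound_sub (n : ℕ) {z : ℝ × EuclideanSpace ℝ (Fin d)} (hz : 0 ≤ z.1) :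
    |(gridRound n z).1 - z.1| ≤ (1 / 4) ^ n := by
  have h4 : (0 : ℝ) < 4 ^ n := by positivity
  have h1 := Nat.floor_le (mul_nonneg h4.le hz)
  have h2 := Nat.lt_floor_add_one (4 ^ n * z.1)
  simp only [gridRound, gridPoint]
  rw [one_div_pow, abs_le, ← sub_nonneg, ← sub_nonneg (b := _ - z.1)]
  constructor
  · have : (⌊4 ^ n * z.1⌋₊ : ℝ) / 4 ^ n - z.1 - -(1 / 4 ^ n)
        = (⌊4 ^ n * z.1⌋₊ + 1 - 4 ^ n * z.1) / 4 ^ n := by field_simp; ring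
    rw [this]
    exact div_nonneg (by linarith) h4.le
  · have : 1 / 4 ^ n - ((⌊4 ^ n * z.1⌋₊ : ℝ) / 4 ^ n - z.1)
        = (1 - ⌊4 ^ n * z.1⌋₊ + 4 ^ n * z.1) / 4 ^ n := by field_simp; ring
    rw [this]
    exact div_nonneg (by linarith) h4.le

lemma abs_snd_gridRound_sub (n : ℕ) (z : ℝ × EuclideanSpace ℝ (Fin d)) (l : Fin d) :
    |((gridRound n z).2 - z.2) l| ≤ (1 / 2) ^ n := by
  have h4 : (0 : ℝ) < 2 ^ n := by positivity
  have h1 := Int.floor_le (2 ^ n * z.2 l)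
  have h2 := Int.lt_floor_add_one (2 ^ n * z.2 l)
  simp only [gridRound, gridPoint, PiLp.sub_apply]
  rw [one_div_pow, abs_le, ← sub_nonneg, ← sub_nonneg (b := _ - z.2 l)]
  constructor
  · have : (⌊2 ^ n * z.2 l⌋ : ℝ) / 2 ^ n - z.2 l - -(1 / 2 ^ n)
        = (⌊2 ^ n * z.2 l⌋ + 1 - 2 ^ n * z.2 l) / 2 ^ n := by field_simp; ring
    rw [this]
    exact div_nonneg (by linarith) h4.le
  · have : 1 / 2 ^ n - ((⌊2 ^ n * z.2 l⌋ : ℝ) / 2 ^ n - z.2 l)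
        = (1 - ⌊2 ^ n * z.2 l⌋ + 2 ^ n * z.2 l) / 2 ^ n := by field_simp; ring
    rw [this]
    exact div_nonneg (by linarith) h4.le

lemma norm_snd_gridRound_sub (n : ℕ) (z : ℝ × EuclideanSpace ℝ (Fin d)) :
    ‖(gridRound n z).2 - z.2‖ ≤ d * (1 / 2) ^ n :=
  EuclideanSpace.norm_le_of_forall_abs_le (abs_snd_gridRound_sub n z)

lemma parabolicDist_gridRound (n : ℕ) {z : ℝ × EuclideanSpace ℝ (Fin d)} (hz : 0 ≤ z.1) :
    parabolicDist (gridRound n z) z ≤ (1 + d) * (1 / 2) ^ n := by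
  have h1 : √|(gridRound n z).1 - z.1| ≤ (1 / 2) ^ n := by
    refine (Real.sqrt_le_sqrt (abs_fst_gridRound_sub n hz)).trans_eq ?_
    rw [show (1 / 4 : ℝ) = (1 / 2) ^ 2 by norm_num, ← pow_mul, mul_comm, pow_mul]
    exact Real.sqrt_sq (by positivity)
  unfold parabolicDist
  linarith [norm_snd_gridRound_sub n z]

lemma tendsto_gridRound {z : ℝ × EuclideanSpace ℝ (Fin d)} (hz : 0 ≤ z.1) :
    Tendsto (fun n => gridRound n z) atTop (𝓝 z) := by
  refine Prod.tendsto_iff _ _ |>.2 ⟨?_, ?_⟩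
  · rw [tendsto_iff_dist_tendsto_zero]
    exact squeeze_zero (fun _ => dist_nonneg)
      (fun n => (Real.dist_eq _ _).trans_le (abs_fst_gridRound_sub n hz))
      (tendsto_pow_atTop_nhds_zero_of_lt_one (by norm_num) (by norm_num))
  · rw [tendsto_iff_dist_tendsto_zero]
    refine squeeze_zero (fun _ => dist_nonneg)
      (fun n => (dist_eq_norm _ _).trans_le (norm_snd_gridRound_sub n z)) ?_
    simpa using (tendsto_pow_atTop_nhds_zero_of_lt_one (r := (1 / 2 : ℝ)) (by norm_num)
      (by norm_num)).const_mul (d : ℝ)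

/-- Chaining: increments between grid points of comparable levels control all increments in the box,
at the price of lowering the Hölder exponent, which absorbs the linear growth in the level. -/
lemma exists_holder_of_grid (d : ℕ) {α θ : ℝ} (hα : 0 < α) (hαθ : α < θ) :
    ∃ C > 0, ∀ (g : ℝ × EuclideanSpace ℝ (Fin d) → ℝ) (L : ℝ), 0 ≤ L → Continuous g →
      (∀ n, ∀ p ∈ gridPair d n, ∀ q ∈ gridPair d n,
        |g p - g q| ≤ L * (n + 1) * parabolicDist p q ^ θ) →
      ∀ z z', InChainBox z → InChainBox z' → |g z - g z'| ≤ C * L * parabolicDist z z' ^ α := by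
  classical
  -- `2^{-θn} = aⁿ bⁿ`: the factor `bⁿ` absorbs `n + 1`, the factor `aⁿ` gives the exponent `α`
  set a : ℝ := (1 / 2) ^ α with ha
  set b : ℝ := (1 / 2) ^ (θ - α) with hb
  have ha0 : 0 < a := by positivity
  have ha1 : a < 1 := Real.rpow_lt_one (by norm_num) (by norm_num) hα
  have hb0 : 0 < b := by positivity
  have hb1 : b < 1 := Real.rpow_lt_one (by norm_num) (by norm_num) (by linarith)
  obtain ⟨K, hK⟩ : ∃ K : ℝ, ∀ n : ℕ, ((n : ℝ) + 1) * b ^ n ≤ K := by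
    have h1 := (tendsto_self_mul_const_pow_of_lt_one hb0.le hb1).add
      (tendsto_pow_atTop_nhds_zero_of_lt_one hb0.le hb1)
    obtain ⟨K, hK⟩ := h1.bddAbove_range
    exact ⟨K, fun n => by have := hK (Set.mem_range_self n); linarith⟩
  have hK1 : 1 ≤ K := by simpa using hK 0
  have hab : ((1 / 2 : ℝ)) ^ θ = a * b := by
    rw [ha, hb, ← Real.rpow_add (by norm_num)]; congr 1; ring
  have hθ : 0 < θ := hα.trans hαθ
  set c : ℝ := 1 + d
  have hc : 0 < c := by positivity
  set D : ℝ := 1 + d * 4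
  have hD1 : 1 ≤ D := by simp only [D]; linarith [Nat.cast_nonneg (α := ℝ) d]
  have hD0 : 0 < D := by linarith
  have hpow : ∀ (A : ℝ), 0 ≤ A → ∀ (n : ℕ),
      ((n : ℝ) + 1) * (A * (1 / 2) ^ n) ^ θ ≤ K * A ^ θ * a ^ n := by
    intro A hA n
    rw [Real.mul_rpow hA (by positivity), ← Real.rpow_natCast, ← Real.rpow_mul (by norm_num),
      mul_comm (n : ℝ) θ, Real.rpow_mul (by norm_num), Real.rpow_natCast, hab, mul_pow]
    have := mul_le_mul_of_nonneg_right (hK n) (by positivity : 0 ≤ A ^ θ * a ^ n)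
    linarith
  set C0 : ℝ := K * (2 * ((2 * c) ^ θ / (1 - a)) + (2 * c + D) ^ θ) with hC0
  have h1a : 0 < 1 - a := by linarith
  have hC0pos : 0 < C0 := by positivity
  refine ⟨C0 * 2 ^ α, by positivity, fun g L hL hg hgrid z z' hz hz' => ?_⟩
  rcases eq_or_ne z z' with rfl | hne
  · simp only [sub_self, abs_zero]
    have := parabolicDist_nonneg z z
    positivity
  set δ := parabolicDist z z' with hδ
  have hδ0 : 0 < δ := parabolicDist_pos hne
  have hδD : δ ≤ D := by
    rw [hδ]
    unfold parabolicDist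
    have h1 : √|z.1 - z'.1| ≤ 1 := by
      rw [Real.sqrt_le_one, abs_le]
      constructor <;> linarith [hz.1.1, hz.1.2, hz'.1.1, hz'.1.2]
    have h2 : ‖z.2 - z'.2‖ ≤ d * 4 := EuclideanSpace.norm_le_of_forall_abs_le fun l => by
      rw [PiLp.sub_apply]
      exact (abs_sub _ _).trans (by linarith [hz.2 l, hz'.2 l])
    simp only [D]
    linarith
  -- chaining starts at the level `m` whose mesh is comparable to the distance of `z` and `z'`
  obtain ⟨m, hm1, hm2⟩ := exists_nat_pow_near_of_lt_one (div_pos hδ0 hD0)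
    ((div_le_one hD0).2 hδD) (y := (1 / 2 : ℝ)) (by norm_num) (by norm_num)
  have hmδ : δ ≤ D * (1 / 2) ^ m := by rwa [div_le_iff₀' hD0] at hm2
  have ham : a ^ m ≤ 2 ^ α * δ ^ α := by
    have h2δ : (1 / 2 : ℝ) ^ m ≤ 2 * δ := by
      have : (1 / 2 : ℝ) ^ m = 2 * (1 / 2) ^ (m + 1) := by rw [pow_succ]; ring
      rw [this]
      have : δ / D ≤ δ := div_le_self hδ0.le hD1
      linarith
    rw [ha, ← Real.mul_rpow (by norm_num) hδ0.le, ← Real.rpow_natCast,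
      ← Real.rpow_mul (by norm_num), mul_comm α, Real.rpow_mul (by norm_num), Real.rpow_natCast]
    exact Real.rpow_le_rpow (by positivity) h2δ hα.le
  have hmem : ∀ w, InChainBox w → ∀ n, gridRound n w ∈ gridPair d n ∧
      gridRound (n + 1) w ∈ gridPair d n := fun w hw n =>
    ⟨Finset.mem_union_left _ (gridRound_mem n hw),
      Finset.mem_union_right _ (gridRound_mem (n + 1) hw)⟩
  have hchain : ∀ w, InChainBox w →
      |g (gridRound m w) - g w| ≤ L * (K * (2 * c) ^ θ) * a ^ m / (1 - a) := by
    intro w hw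
    rw [← Real.dist_eq]
    refine dist_le_of_le_geometric_of_tendsto a (L * (K * (2 * c) ^ θ)) ha1 (fun n => ?_)
      ((hg.tendsto w).comp (tendsto_gridRound hw.1.1)) m
    simp only [Function.comp_apply]
    rw [Real.dist_eq]
    refine (hgrid n _ (hmem w hw n).1 _ (hmem w hw n).2).trans ?_
    have hd : parabolicDist (gridRound n w) (gridRound (n + 1) w) ≤ 2 * c * (1 / 2) ^ n := by
      refine (parabolicDist_triangle _ w _).trans ?_
      rw [parabolicDist_comm w]
      have h1 := parabolicDist_gridRound n (z := w) hw.1.1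
      have h2 := parabolicDist_gridRound (n + 1) (z := w) hw.1.1
      have h3 : (1 / 2 : ℝ) ^ (n + 1) ≤ (1 / 2) ^ n :=
        pow_le_pow_of_le_one (by norm_num) (by norm_num) (Nat.le_succ n)
      have h4 := mul_le_mul_of_nonneg_left h3 hc.le
      simp only [c] at h4 ⊢
      linarith
    have h5 : parabolicDist (gridRound n w) (gridRound (n + 1) w) ^ θ
        ≤ (2 * c * (1 / 2) ^ n) ^ θ :=
      Real.rpow_le_rpow (parabolicDist_nonneg _ _) hd hθ.le
    calc L * (n + 1) * parabolicDist (gridRound n w) (gridRound (n + 1) w) ^ θ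
        ≤ L * (n + 1) * (2 * c * (1 / 2) ^ n) ^ θ := by gcongr
      _ = L * ((n + 1) * (2 * c * (1 / 2) ^ n) ^ θ) := by ring
      _ ≤ L * (K * (2 * c) ^ θ * a ^ n) :=
          mul_le_mul_of_nonneg_left (hpow _ (by positivity) n) hL
      _ = _ := by ring
  have hmid : |g (gridRound m z) - g (gridRound m z')| ≤ L * (K * (2 * c + D) ^ θ) * a ^ m := by
    refine (hgrid m _ (hmem z hz m).1 _ (hmem z' hz' m).1).trans ?_
    have hd : parabolicDist (gridRound m z) (gridRound m z') ≤ (2 * c + D) * (1 / 2) ^ m := by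
      have h1 := parabolicDist_gridRound m (z := z) hz.1.1
      have h2 := parabolicDist_gridRound m (z := z') hz'.1.1
      have h3 := parabolicDist_triangle (gridRound m z) z (gridRound m z')
      have h4 := parabolicDist_triangle z z' (gridRound m z')
      rw [parabolicDist_comm z'] at h4
      simp only [c] at h1 h2 ⊢
      linarith
    have h5 := Real.rpow_le_rpow (parabolicDist_nonneg _ _) hd hθ.le
    calc L * (m + 1) * parabolicDist (gridRound m z) (gridRound m z') ^ θ
        ≤ L * (m + 1) * ((2 * c + D) * (1 / 2) ^ m) ^ θ := by gcongr
      _ = L * ((m + 1) * ((2 * c + D) * (1 / 2) ^ m) ^ θ) := by ring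
      _ ≤ L * (K * (2 * c + D) ^ θ * a ^ m) :=
          mul_le_mul_of_nonneg_left (hpow _ (by positivity) m) hL
      _ = _ := by ring
  have e1 := hchain z hz
  rw [abs_sub_comm] at e1
  have e2 := hchain z' hz'
  have e3 : |g z - g z'| ≤ C0 * L * a ^ m := by
    have t1 := abs_sub_le (g z) (g (gridRound m z)) (g z')
    have t2 := abs_sub_le (g (gridRound m z)) (g (gridRound m z')) (g z')
    have : C0 * L * a ^ m = L * (K * (2 * c) ^ θ) * a ^ m / (1 - a)
        + L * (K * (2 * c) ^ θ) * a ^ m / (1 - a) + L * (K * (2 * c + D) ^ θ) * a ^ m := by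
      rw [hC0]; ring
    linarith
  calc |g z - g z'| ≤ C0 * L * a ^ m := e3
    _ ≤ C0 * L * (2 ^ α * δ ^ α) := by gcongr
    _ = _ := by ring

/-- A continuous function on space-time that is `1`-periodic in space, constant in time on
`(-∞, 0]`, and given by the heat flow of its values at time `1` afterwards. The heat flow is written
as an average over a standard Gaussian vector. -/
structure IsPeriodicHeatFlow (g : ℝ × EuclideanSpace ℝ (Fin d) → ℝ) : Prop where
  continuous : Continuous g
  periodic : ∀ t x (m : Fin d → ℤ), g (t, x + WithLp.toLp 2 fun l => (m l : ℝ)) = g (t, x)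
  integrable : ∀ t x, Integrable
    (fun y => g (max 0 (min t 1), x + √(2 * max 0 (t - 1)) • y)) (stdGaussian _)
  eq_integral : ∀ t x, g (t, x) =
    ∫ y, g (max 0 (min t 1), x + √(2 * max 0 (t - 1)) • y) ∂(stdGaussian _)

/-- Periodicity extends Hölder bounds from the chaining box to all of space. -/
lemma holder_of_periodic {α A : ℝ} (hα : 0 < α) (hA : 0 ≤ A)
    {g : ℝ × EuclideanSpace ℝ (Fin d) → ℝ}
    (hper : ∀ t x (m : Fin d → ℤ), g (t, x + WithLp.toLp 2 fun l => (m l : ℝ)) = g (t, x))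
    (hg : ∀ z z', InChainBox z → InChainBox z' → |g z - g z'| ≤ A * parabolicDist z z' ^ α)
    {z z' : ℝ × EuclideanSpace ℝ (Fin d)} (hz : z.1 ∈ Set.Icc (0 : ℝ) 1)
    (hz' : z'.1 ∈ Set.Icc (0 : ℝ) 1) :
    |g z - g z'| ≤ A * (1 + d) ^ α * parabolicDist z z' ^ α := by
  obtain ⟨t, x⟩ := z
  obtain ⟨t', x'⟩ := z'
  have hsub : ∀ t x (m : Fin d → ℤ), g (t, x - WithLp.toLp 2 fun l => (m l : ℝ)) = g (t, x) :=
    fun t x m => by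
      rw [← hper t (x - WithLp.toLp 2 fun l => (m l : ℝ)) m, sub_add_cancel]
  have hfl : ∀ (u : EuclideanSpace ℝ (Fin d)) l, |(u - WithLp.toLp 2 fun l => (⌊u l⌋ : ℝ)) l| ≤ 1 :=
    fun u l => by
      rw [PiLp.sub_apply, abs_le]
      constructor <;> linarith [Int.floor_le (u l), Int.lt_floor_add_one (u l)]
  have hfl0 : ∀ (u : EuclideanSpace ℝ (Fin d)) l, 0 ≤ (u - WithLp.toLp 2 fun l => (⌊u l⌋ : ℝ)) l :=
    fun u l => by
      rw [PiLp.sub_apply]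
      linarith [Int.floor_le (u l)]
  have h1d : (1 : ℝ) ≤ 1 + d := by linarith [Nat.cast_nonneg (α := ℝ) d]
  have hδ := parabolicDist_nonneg (t, x) (t', x')
  by_cases hx : ‖x - x'‖ ≤ 1
  -- nearby points are moved into the box by the same translation, which preserves their distance
  · set m : Fin d → ℤ := fun l => ⌊x l⌋
    have h1 : InChainBox (t, x - WithLp.toLp 2 fun l => (m l : ℝ)) :=
      ⟨hz, fun l => (hfl x l).trans (by norm_num)⟩
    have h2 : InChainBox (t', x' - WithLp.toLp 2 fun l => (m l : ℝ)) := by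
      refine ⟨hz', fun l => ?_⟩
      have e : (x' - WithLp.toLp 2 fun l => (m l : ℝ)) l
          = (x - WithLp.toLp 2 fun l => (m l : ℝ)) l - (x - x') l := by
        simp only [PiLp.sub_apply]; ring
      have h3 : |(x - x') l| ≤ 1 := (PiLp.norm_apply_le (x - x') l).trans hx
      show |(x' - WithLp.toLp 2 fun l => (m l : ℝ)) l| ≤ 2
      rw [e]
      exact (abs_sub _ _).trans (by linarith [hfl x l])
    have h3 := hg _ _ h1 h2
    rw [hsub, hsub] at h3
    have h4 : parabolicDist (t, x - WithLp.toLp 2 fun l => (m l : ℝ))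
        (t', x' - WithLp.toLp 2 fun l => (m l : ℝ)) = parabolicDist (t, x) (t', x') := by
      simp [parabolicDist]
    rw [h4] at h3
    refine h3.trans ?_
    have : A * 1 ≤ A * (1 + d : ℝ) ^ α := by
      gcongr
      exact Real.one_le_rpow h1d hα.le
    rw [mul_one] at this
    gcongr
  -- points at distance at least `1` may be moved independently
  · push Not at hx
    have h1 : InChainBox (t, x - WithLp.toLp 2 fun l => (⌊x l⌋ : ℝ)) :=
      ⟨hz, fun l => (hfl x l).trans (by norm_num)⟩
    have h2 : InChainBox (t', x' - WithLp.toLp 2 fun l => (⌊x' l⌋ : ℝ)) :=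
      ⟨hz', fun l => (hfl x' l).trans (by norm_num)⟩
    have h3 := hg _ _ h1 h2
    rw [hsub, hsub] at h3
    refine h3.trans ?_
    rw [mul_assoc, ← Real.mul_rpow (by positivity) hδ]
    gcongr
    · exact parabolicDist_nonneg _ _
    have h5 : ‖(x - WithLp.toLp 2 fun l => (⌊x l⌋ : ℝ)) -
        (x' - WithLp.toLp 2 fun l => (⌊x' l⌋ : ℝ))‖
        ≤ d * 1 := EuclideanSpace.norm_le_of_forall_abs_le fun l => by
      rw [PiLp.sub_apply, abs_le]
      have a1 := hfl0 x l
      have a2 := hfl0 x' l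
      have a3 := (abs_le.1 (hfl x l)).2
      have a4 := (abs_le.1 (hfl x' l)).2
      constructor <;> linarith
    unfold parabolicDist
    have h6 := Real.sqrt_nonneg |t - t'|
    have h7 : (0 : ℝ) ≤ d := Nat.cast_nonneg d
    simp only
    nlinarith [mul_nonneg h7 h6, mul_le_mul_of_nonneg_left hx.le h7]

/-- The heat flow preserves parabolic Hölder bounds, since both values are averages over the same
Gaussian vector `y`, at shifts whose parabolic distance is at most `1 + 2|y|` times the original
one. -/
lemma holder_of_heatFlow {α A : ℝ} (hα : 0 < α) (hα1 : α ≤ 1) (hA : 0 ≤ A)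
    {g : ℝ × EuclideanSpace ℝ (Fin d) → ℝ} (hflow : IsPeriodicHeatFlow g)
    (hg : ∀ z z', z.1 ∈ Set.Icc (0 : ℝ) 1 → z'.1 ∈ Set.Icc (0 : ℝ) 1 →
      |g z - g z'| ≤ A * parabolicDist z z' ^ α) (z z' : ℝ × EuclideanSpace ℝ (Fin d)) :
    |g z - g z'| ≤ A * (1 + 2 * ∫ y, ‖y‖ ∂(stdGaussian (EuclideanSpace ℝ (Fin d))))
      * parabolicDist z z' ^ α := by
  set γ := stdGaussian (EuclideanSpace ℝ (Fin d))
  have hnorm : Integrable (fun y : EuclideanSpace ℝ (Fin d) => ‖y‖) γ :=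
    (IsGaussian.integrable_id (μ := γ)).norm
  obtain ⟨t, x⟩ := z
  obtain ⟨t', x'⟩ := z'
  set δ := parabolicDist (t, x) (t', x') with hδ
  have hδ0 : 0 ≤ δ := parabolicDist_nonneg _ _
  rw [hflow.eq_integral t x, hflow.eq_integral t' x',
    ← integral_sub (hflow.integrable t x) (hflow.integrable t' x')]
  have hclamp : ∀ u : ℝ, max 0 (min u 1) ∈ Set.Icc (0 : ℝ) 1 := fun u =>
    ⟨le_max_left _ _, max_le zero_le_one (min_le_right _ _)⟩
  have hpt : ∀ y, ‖g (max 0 (min t 1), x + √(2 * max 0 (t - 1)) • y)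
      - g (max 0 (min t' 1), x' + √(2 * max 0 (t' - 1)) • y)‖ ≤ A * δ ^ α * (1 + 2 * ‖y‖) := by
    intro y
    rw [Real.norm_eq_abs]
    refine (hg _ _ (hclamp t) (hclamp t')).trans ?_
    rw [mul_assoc]
    refine mul_le_mul_of_nonneg_left ?_ hA
    have hd : parabolicDist (max 0 (min t 1), x + √(2 * max 0 (t - 1)) • y)
        (max 0 (min t' 1), x' + √(2 * max 0 (t' - 1)) • y) ≤ δ * (1 + 2 * ‖y‖) := by
      rw [hδ]
      unfold parabolicDist
      simp only
      have h1 : |max 0 (min t 1) - max 0 (min t' 1)| ≤ |t - t'| := by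
        have h8 := abs_max_sub_max_le_max 0 (min t 1) 0 (min t' 1)
        have h9 := abs_min_sub_min_le_max t 1 t' 1
        simp only [sub_self, abs_zero, abs_nonneg, sup_of_le_right, sup_of_le_left] at h8 h9
        exact h8.trans h9
      have h2 : |√(2 * max 0 (t - 1)) - √(2 * max 0 (t' - 1))| ≤ 2 * √|t - t'| := by
        have h3 : |max 0 (t - 1) - max 0 (t' - 1)| ≤ |t - t'| := by
          have := abs_max_sub_max_le_max 0 (t - 1) 0 (t' - 1)
          simpa using this
        have h4 : ∀ p q : ℝ, 0 ≤ p → 0 ≤ q → |p - q| ≤ |t - t'| →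
            √(2 * p) - √(2 * q) ≤ 2 * √|t - t'| := by
          intro p q hp hq hpq
          have h5 : √(2 * p) ≤ √(2 * q) + √(4 * |t - t'|) := by
            refine (Real.sqrt_le_sqrt ?_).trans
              (sqrt_add_le_add_sqrt (by positivity) (by positivity))
            have := (abs_le.1 hpq).2
            linarith [abs_nonneg (t - t')]
          rw [Real.sqrt_mul (by norm_num) |t - t'|, show √(4 : ℝ) = 2 by
            rw [show (4 : ℝ) = 2 ^ 2 by norm_num]; exact Real.sqrt_sq (by norm_num)] at h5
          linarith
        rw [abs_le]
        constructor
        · have := h4 _ _ (le_max_left 0 (t' - 1)) (le_max_left 0 (t - 1)) (by rwa [abs_sub_comm])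
          linarith
        · exact h4 _ _ (le_max_left 0 (t - 1)) (le_max_left 0 (t' - 1)) h3
      have h6 : ‖x + √(2 * max 0 (t - 1)) • y - (x' + √(2 * max 0 (t' - 1)) • y)‖
          ≤ ‖x - x'‖ + 2 * √|t - t'| * ‖y‖ := by
        have e : x + √(2 * max 0 (t - 1)) • y - (x' + √(2 * max 0 (t' - 1)) • y)
            = (x - x') + (√(2 * max 0 (t - 1)) - √(2 * max 0 (t' - 1))) • y := by
          rw [sub_smul]; abel
        rw [e]
        refine (norm_add_le _ _).trans ?_
        rw [norm_smul, Real.norm_eq_abs]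
        gcongr
      have h7 := Real.sqrt_le_sqrt h1
      nlinarith [norm_nonneg y, norm_nonneg (x - x'), Real.sqrt_nonneg |t - t'|,
        mul_nonneg (norm_nonneg (x - x')) (norm_nonneg y)]
    refine (Real.rpow_le_rpow (parabolicDist_nonneg _ _) hd hα.le).trans ?_
    have h1y : (1 : ℝ) ≤ 1 + 2 * ‖y‖ := by linarith [norm_nonneg y]
    rw [Real.mul_rpow hδ0 (by positivity)]
    gcongr
    exact (Real.rpow_le_rpow_of_exponent_le h1y hα1).trans_eq (Real.rpow_one _)
  refine (norm_integral_le_of_norm_le (((integrable_const 1).add (hnorm.const_mul 2)).const_mul _)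
    (ae_of_all _ hpt)).trans_eq ?_
  rw [integral_const_mul]
  have : ∫ y, ((1 : ℝ) + 2 * ‖y‖) ∂γ = 1 + 2 * ∫ y, ‖y‖ ∂γ := by
    rw [integral_add (integrable_const 1) (hnorm.const_mul 2), integral_const_mul]
    simp
  simp only [Pi.add_apply]
  rw [this]
  ring

/-- Grid increments control the global Hölder seminorm of a periodic heat flow. -/
lemma IsPeriodicHeatFlow.exists_holder (d : ℕ) {α θ : ℝ} (hα : 0 < α) (hα1 : α ≤ 1) (hαθ : α < θ) :
    ∃ C > 0, ∀ (g : ℝ × EuclideanSpace ℝ (Fin d) → ℝ) (L : ℝ), 0 ≤ L → IsPeriodicHeatFlow g →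
      (∀ n, ∀ p ∈ gridPair d n, ∀ q ∈ gridPair d n,
        |g p - g q| ≤ L * (n + 1) * parabolicDist p q ^ θ) →
      ∀ z z', |g z - g z'| ≤ C * L * parabolicDist z z' ^ α := by
  obtain ⟨C, hC, H⟩ := exists_holder_of_grid d hα hαθ
  have hI : 0 ≤ ∫ y, ‖y‖ ∂(stdGaussian (EuclideanSpace ℝ (Fin d))) :=
    integral_nonneg fun _ => norm_nonneg _
  refine ⟨C * (1 + d) ^ α * (1 + 2 * ∫ y, ‖y‖ ∂(stdGaussian (EuclideanSpace ℝ (Fin d)))),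
    by positivity, fun g L hL hg hgrid z z' => ?_⟩
  have h1 := H g L hL hg.continuous hgrid
  have h2 := holder_of_heatFlow (A := C * L * (1 + d) ^ α) hα hα1 (by positivity) hg
    (fun w w' hw hw' => holder_of_periodic hα (by positivity) hg.periodic h1 hw hw') z z'
  refine h2.trans_eq ?_
  ring

end ParabolicDist

/-! ### Exponential moments of the Hölder seminorm of a sub-Gaussian field -/

/-- If the increments of a random periodic heat flow are sub-Gaussian with variance
proxy `W d(z, z')^{2θ}`, then all increments are bounded simultaneously, at a Hölder exponent
`α < θ`, in terms of a single variable `M` of bounded expectation. This `M` is a weighted sum of the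
exponentials of the squared normalised increments on the dyadic grids. -/
theorem exists_exp_moment_holder (d : ℕ) {α θ : ℝ} (hα : 0 < α) (hα1 : α ≤ 1) (hαθ : α < θ) :
    ∃ C > 0, ∃ B : ℝ≥0∞, B ≠ ∞ ∧ ∀ (Ω : Type*) [MeasurableSpace Ω] (P : Measure Ω)
      [IsProbabilityMeasure P] (X : Ω → ℝ × EuclideanSpace ℝ (Fin d) → ℝ),
      (∀ z, Measurable fun ω => X ω z) → (∀ ω, IsPeriodicHeatFlow (X ω)) → ∀ W : ℝ, 0 < W →
      (∀ z z', z.1 ∈ Set.Icc (0 : ℝ) 1 → z'.1 ∈ Set.Icc (0 : ℝ) 1 →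
        HasSubgaussianMGF (fun ω => X ω z - X ω z')
          (W * (parabolicDist z z' ^ θ) ^ 2).toNNReal P) →
      ∃ M : Ω → ℝ≥0∞, Measurable M ∧ ∫⁻ ω, M ω ∂P ≤ B ∧ ∀ ω z z',
        ENNReal.ofReal (Real.exp ((X ω z - X ω z') ^ 2
          / (C * W * (parabolicDist z z' ^ α) ^ 2))) ≤ M ω := by
  obtain ⟨C, hC, H⟩ := IsPeriodicHeatFlow.exists_holder d hα hα1 hαθ
  set a : ℝ := 2 * 5 ^ d * (1 + 2 ^ (d + 2)) with ha
  set b : ℝ := 2 ^ (d + 2) with hb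
  have ha1 : 1 ≤ a := by
    have h5 : (1 : ℝ) ≤ 5 ^ d := one_le_pow₀ (by norm_num)
    have h2 : (1 : ℝ) ≤ 1 + 2 ^ (d + 2) := by linarith [pow_pos (zero_lt_two' ℝ) (d + 2)]
    nlinarith
  have hb1 : 1 ≤ b := one_le_pow₀ (by norm_num)
  have hcard : ∀ n, ((gridPair d n).card : ℝ) ≤ a * b ^ n := fun n => by
    have := card_gridPair_le d n
    have h : ((gridPair d n).card : ℝ)
        ≤ ((2 * 5 ^ d * (1 + 2 ^ (d + 2)) * (2 ^ (d + 2)) ^ n : ℕ) : ℝ) := by exact_mod_cast this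
    refine h.trans_eq ?_
    push_cast
    rfl
  -- the weights are summable over all pairs of grid points, and their logarithms grow linearly in
  -- the level
  set wt : ℕ → ℝ := fun n => (1 / 2) ^ n / (a * b ^ n) ^ 2 with hwt
  have hwt0 : ∀ n, 0 < wt n := fun n => by positivity
  set A : ℝ := Real.log 2 + 2 * Real.log a + 2 * Real.log b with hA
  have hlogs : 0 ≤ Real.log 2 ∧ 0 ≤ Real.log a ∧ 0 ≤ Real.log b :=
    ⟨Real.log_nonneg (by norm_num), Real.log_nonneg ha1, Real.log_nonneg hb1⟩
  have hA0 : 0 ≤ A := by linarith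
  have hlogwt : ∀ n, -Real.log (wt n) ≤ A * (n + 1) := fun n => by
    have : Real.log (wt n) = -(n * Real.log 2) - 2 * (Real.log a + n * Real.log b) := by
      rw [hwt]
      simp only
      rw [Real.log_div (by positivity) (by positivity), Real.log_pow, Real.log_pow,
        Real.log_mul (by positivity) (by positivity), Real.log_pow]
      simp
    rw [this]
    have hn : (0 : ℝ) ≤ n := Nat.cast_nonneg n
    nlinarith [mul_nonneg hn hlogs.2.1]
  refine ⟨4 * C ^ 2, by positivity, ENNReal.ofReal (Real.exp A) * 5,
    ENNReal.mul_ne_top ENNReal.ofReal_ne_top (by norm_num), ?_⟩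
  intro Ω _ P _ X hXm hflow W hW hsub
  have hθ : 0 < θ := hα.trans hαθ
  set Y : Ω → (ℝ × EuclideanSpace ℝ (Fin d)) → (ℝ × EuclideanSpace ℝ (Fin d)) → ℝ :=
    fun ω p q => (X ω p - X ω q) ^ 2 / (4 * (W * (parabolicDist p q ^ θ) ^ 2)) with hY
  have hYm : ∀ p q, Measurable fun ω => Y ω p q := fun p q => by
    have := hXm p
    have := hXm q
    fun_prop
  set S : Ω → ℝ≥0∞ := fun ω => ∑' n, ∑ p ∈ gridPair d n, ∑ q ∈ gridPair d n,
    ENNReal.ofReal (wt n * Real.exp (Y ω p q)) with hS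
  have hSm : Measurable S := by
    refine Measurable.tsum fun n => Finset.measurable_sum _ fun p _ =>
      Finset.measurable_sum _ fun q _ => ?_
    have := hYm p q
    fun_prop
  have hmem : ∀ n, ∀ p ∈ gridPair d n, p.1 ∈ Set.Icc (0 : ℝ) 1 := by
    classical
    have h1 : ∀ n, ∀ p ∈ gridSet d n, p.1 ∈ Set.Icc (0 : ℝ) 1 := by
      intro n p hp
      obtain ⟨⟨i, j⟩, hij, rfl⟩ := Finset.mem_image.1 hp
      rw [Finset.mem_product, Finset.mem_range] at hij
      have hi : (i : ℝ) ≤ 4 ^ n := by exact_mod_cast Nat.lt_succ_iff.1 hij.1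
      exact ⟨by simp only [gridPoint]; positivity,
        by simp only [gridPoint]; rw [div_le_one (by positivity)]; exact hi⟩
    intro n p hp
    rcases Finset.mem_union.1 hp with h | h
    exacts [h1 _ _ h, h1 _ _ h]
  have hSint : ∫⁻ ω, S ω ∂P ≤ 4 := by
    rw [hS, lintegral_tsum (fun n => Measurable.aemeasurable <| Finset.measurable_sum _ fun p _ =>
      Finset.measurable_sum _ fun q _ => by have := hYm p q; fun_prop)]
    have h1 : ∀ n, ∫⁻ ω, ∑ p ∈ gridPair d n, ∑ q ∈ gridPair d n,
        ENNReal.ofReal (wt n * Real.exp (Y ω p q)) ∂P ≤ 2 * (2⁻¹ : ℝ≥0∞) ^ n := by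
      intro n
      rw [lintegral_finsetSum _ fun p _ => Finset.measurable_sum _ fun q _ => by
        have := hYm p q; fun_prop]
      have h2 : ∀ p ∈ gridPair d n, ∫⁻ ω, ∑ q ∈ gridPair d n,
          ENNReal.ofReal (wt n * Real.exp (Y ω p q)) ∂P
          ≤ ∑ q ∈ gridPair d n, ENNReal.ofReal (wt n) * 2 := by
        intro p hp
        rw [lintegral_finsetSum _ fun q _ => by have := hYm p q; fun_prop]
        refine Finset.sum_le_sum fun q hq => ?_
        simp_rw [ENNReal.ofReal_mul (hwt0 n).le]
        rw [lintegral_const_mul' _ _ ENNReal.ofReal_ne_top]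
        gcongr
        exact (hsub p q (hmem n p hp) (hmem n q hq)).lintegral_exp_sq_le (by positivity)
      refine (Finset.sum_le_sum h2).trans ?_
      simp only [Finset.sum_const, nsmul_eq_mul]
      have h3 : ((gridPair d n).card : ℝ≥0∞) = ENNReal.ofReal ((gridPair d n).card) := by simp
      have h4 : (2⁻¹ : ℝ≥0∞) = ENNReal.ofReal (1 / 2) := by
        rw [one_div, ENNReal.ofReal_inv_of_pos (by norm_num)]; simp
      rw [h3, h4, ← ENNReal.ofReal_pow (by norm_num), ← mul_assoc, ← mul_assoc, mul_comm _ 2,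
        ← ENNReal.ofReal_mul (by positivity), ← ENNReal.ofReal_mul (by positivity)]
      gcongr
      have h5 : 0 < a * b ^ n := by positivity
      rw [hwt]
      simp only
      rw [← mul_div_assoc, div_le_iff₀ (by positivity)]
      have h6 := mul_self_le_mul_self (Nat.cast_nonneg _) (hcard n)
      have h7 : (0 : ℝ) < (1 / 2) ^ n := by positivity
      nlinarith
    refine (ENNReal.tsum_le_tsum h1).trans_eq ?_
    rw [ENNReal.tsum_mul_left, ENNReal.tsum_geometric, ENNReal.one_sub_inv_two, inv_inv]
    norm_num
  refine ⟨fun ω => ENNReal.ofReal (Real.exp A) * (1 + S ω), by fun_prop, ?_, fun ω z z' => ?_⟩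
  · rw [lintegral_const_mul' _ _ ENNReal.ofReal_ne_top, lintegral_add_left measurable_const]
    gcongr
    simp only [lintegral_const, measure_univ, mul_one]
    calc 1 + ∫⁻ ω, S ω ∂P ≤ 1 + 4 := by gcongr
      _ = 5 := by norm_num
  by_cases hSω : S ω = ∞
  · simp only [hSω]
    simp [ENNReal.mul_top, Real.exp_pos]
  set s : ℝ := 1 + (S ω).toReal with hs
  have hs1 : 1 ≤ s := by linarith [ENNReal.toReal_nonneg (a := S ω)]
  have hM : ENNReal.ofReal (Real.exp A) * (1 + S ω) = ENNReal.ofReal (Real.exp A * s) := by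
    rw [ENNReal.ofReal_mul (Real.exp_pos _).le, hs, ENNReal.ofReal_add zero_le_one
      ENNReal.toReal_nonneg, ENNReal.ofReal_one, ENNReal.ofReal_toReal hSω]
  simp only [hM]
  have hls : 0 ≤ Real.log s := Real.log_nonneg hs1
  have hYle : ∀ n, ∀ p ∈ gridPair d n, ∀ q ∈ gridPair d n,
      Y ω p q ≤ (Real.log s + A) * (n + 1) := by
    intro n p hp q hq
    have h1 : ENNReal.ofReal (wt n * Real.exp (Y ω p q)) ≤ S ω :=
      (Finset.single_le_sum (f := fun q => ENNReal.ofReal (wt n * Real.exp (Y ω p q)))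
        (fun _ _ => zero_le) hq).trans
      ((Finset.single_le_sum (f := fun p => ∑ q ∈ gridPair d n,
        ENNReal.ofReal (wt n * Real.exp (Y ω p q))) (fun _ _ => zero_le) hp).trans
        (ENNReal.le_tsum n))
    have h2 : wt n * Real.exp (Y ω p q) ≤ s :=
      ((ENNReal.ofReal_le_iff_le_toReal hSω).1 h1).trans (by rw [hs]; linarith)
    have h3 := Real.log_le_log (by have := hwt0 n; positivity) h2
    rw [Real.log_mul (hwt0 n).ne' (Real.exp_pos _).ne', Real.log_exp] at h3
    have h4 := hlogwt n
    nlinarith [mul_nonneg hls (Nat.cast_nonneg (α := ℝ) n)]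
  set L : ℝ := √(4 * W * (Real.log s + A)) with hL
  have hL2 : L ^ 2 = 4 * W * (Real.log s + A) := Real.sq_sqrt (by positivity)
  have hgrid : ∀ n, ∀ p ∈ gridPair d n, ∀ q ∈ gridPair d n,
      |X ω p - X ω q| ≤ L * (n + 1) * parabolicDist p q ^ θ := by
    intro n p hp q hq
    rcases eq_or_ne p q with rfl | hne
    · simp only [sub_self, abs_zero]
      have := parabolicDist_nonneg p p
      positivity
    have hδ := parabolicDist_pos hne
    have h1 := hYle n p hp q hq
    refine abs_le_of_sq_le_sq ?_ (by positivity)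
    rw [mul_pow, mul_pow, hL2]
    simp only [hY] at h1
    rw [div_le_iff₀ (by positivity)] at h1
    refine h1.trans ?_
    have hn : (n : ℝ) + 1 ≤ (n + 1) ^ 2 := by
      have : (0 : ℝ) ≤ n := Nat.cast_nonneg n
      nlinarith
    have h0 : 0 ≤ 4 * W * (Real.log s + A) * (parabolicDist p q ^ θ) ^ 2 := by positivity
    nlinarith
  have hfin := H (X ω) L (Real.sqrt_nonneg _) (hflow ω) hgrid z z'
  refine ENNReal.ofReal_le_ofReal ?_
  have h1 : (X ω z - X ω z') ^ 2 / (4 * C ^ 2 * W * (parabolicDist z z' ^ α) ^ 2)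
      ≤ Real.log s + A := by
    refine div_le_of_le_mul₀ (by positivity) (by positivity) ?_
    have h2 := sq_le_sq' (by linarith [neg_abs_le (X ω z - X ω z'), le_abs_self (X ω z - X ω z'),
      (abs_nonneg (X ω z - X ω z')).trans hfin]) ((le_abs_self _).trans hfin)
    rw [mul_pow, mul_pow, hL2] at h2
    linarith
  calc _ ≤ Real.exp (Real.log s + A) := Real.exp_le_exp.2 h1
    _ = _ := by rw [Real.exp_add, Real.exp_log (by linarith), mul_comm]

/-! ### Fourier modes of the heat equation and their finite sums -/

section Modes

variable {d : ℕ}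

/-- The solution `∫_0^{min(t,1)} e^{-κ(t-r)} db(r)` of the mode with decay rate `κ`, driven by the
path `b`, in the form obtained by integration by parts. -/
noncomputable def heatMode (κ : ℝ) (b : ℝ≥0 → ℂ) (t : ℝ) : ℂ :=
  Real.exp (-(κ * t)) • expIntegral κ b 0 (min t 1).toNNReal

/-- The real part of a finite Fourier sum of modes with coefficients `a`. -/
noncomputable def modeSum (a : (Fin d → ℤ) → ℂ) (F : Finset (Fin d → ℤ))
    (b : (Fin d → ℤ) → ℝ≥0 → ℂ) (z : ℝ × EuclideanSpace ℝ (Fin d)) : ℝ :=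
  (∑ n ∈ F, a n * Complex.exp (Complex.I * (inner ℝ (waveVector n) z.2 : ℝ)) *
    heatMode (‖waveVector n‖ ^ 2) (b n) z.1).re

lemma heatMode_of_nonpos (κ : ℝ) (b : ℝ≥0 → ℂ) {t : ℝ} (ht : t ≤ 0) : heatMode κ b t = 0 := by
  rw [heatMode, Real.toNNReal_of_nonpos ((min_le_left _ _).trans ht), expIntegral_self, smul_zero]

/-- The modes are determined by their values at times in `[0, 1]`: there is no noise after time
`1`. -/
lemma heatMode_eq_clamp (κ : ℝ) (b : ℝ≥0 → ℂ) (t : ℝ) :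
    heatMode κ b t = Real.exp (-(κ * max 0 (t - 1))) • heatMode κ b (max 0 (min t 1)) := by
  rcases le_total t 0 with h0 | h0
  · rw [heatMode_of_nonpos κ b h0,
      heatMode_of_nonpos κ b (by rw [min_eq_left (by linarith)]; simp [h0]), smul_zero]
  · have h1 : 0 ≤ min t 1 := le_min h0 zero_le_one
    rw [max_eq_right h1]
    simp only [heatMode, smul_smul, ← Real.exp_add]
    rw [min_eq_left (min_le_right t 1)]
    congr 2
    rcases le_total t 1 with h | h
    · rw [max_eq_left (by linarith), min_eq_left h]; ring
    · rw [max_eq_right (by linarith), min_eq_right h]; ring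

lemma continuous_heatMode (κ : ℝ) {b : ℝ≥0 → ℂ} (hb : Continuous b) :
    Continuous (heatMode κ b) := by
  have h1 : Continuous fun t : ℝ => expIntegral κ b 0 (min t 1).toNNReal :=
    (continuous_expIntegral κ hb 0).comp (by fun_prop)
  exact (by fun_prop : Continuous fun t : ℝ => Real.exp (-(κ * t))).smul h1

lemma heatMode_conj (κ : ℝ) (b : ℝ≥0 → ℂ) (t : ℝ) :
    heatMode κ (fun r => starRingEnd ℂ (b r)) t = starRingEnd ℂ (heatMode κ b t) := by
  simp only [heatMode, expIntegral, Complex.real_smul, map_mul, map_sub, Complex.conj_ofReal]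
  congr 2
  rw [intervalIntegral.intervalIntegral_eq_integral_uIoc,
    intervalIntegral.intervalIntegral_eq_integral_uIoc]
  simp only [Complex.real_smul, map_mul, Complex.conj_ofReal, ← integral_conj]

lemma waveVector_neg (n : Fin d → ℤ) : waveVector (-n) = -waveVector n := by
  ext i; simp [waveVector]

lemma norm_waveVector_neg (n : Fin d → ℤ) : ‖waveVector (-n)‖ = ‖waveVector n‖ := by
  rw [waveVector_neg, norm_neg]

lemma one_le_norm_waveVector {n : Fin d → ℤ} (hn : n ≠ 0) : 1 ≤ ‖waveVector n‖ := by
  obtain ⟨i, hi⟩ := Function.ne_iff.1 hn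
  refine le_trans ?_ (PiLp.norm_apply_le (waveVector n) i)
  have h1 : (1 : ℝ) ≤ |(n i : ℝ)| := by exact_mod_cast Int.one_le_abs hi
  have h2 : (3 : ℝ) ≤ Real.pi := Real.pi_gt_three.le
  simp only [waveVector, Real.norm_eq_abs, abs_mul]
  rw [abs_of_nonneg (by norm_num : (0 : ℝ) ≤ 2), abs_of_nonneg Real.pi_pos.le]
  nlinarith

lemma norm_exp_I_mul (r : ℝ) : ‖Complex.exp (Complex.I * r)‖ = 1 := by
  rw [mul_comm]; exact Complex.norm_exp_ofReal_mul_I r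

lemma exp_inner_add_int (n m : Fin d → ℤ) (x : EuclideanSpace ℝ (Fin d)) :
    Complex.exp (Complex.I *
      (inner ℝ (waveVector n) (x + WithLp.toLp 2 fun l => (m l : ℝ)) : ℝ))
      = Complex.exp (Complex.I * (inner ℝ (waveVector n) x : ℝ)) := by
  have h : (inner ℝ (waveVector n) (WithLp.toLp 2 fun l => (m l : ℝ)) : ℝ)
      = 2 * Real.pi * ((∑ l, n l * m l : ℤ) : ℝ) := by
    simp only [PiLp.inner_apply, waveVector, RCLike.inner_apply, conj_trivial]
    push_cast
    rw [Finset.mul_sum]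
    exact Finset.sum_congr rfl fun l _ => by ring
  rw [inner_add_right, h, Complex.ofReal_add, mul_add, Complex.exp_add]
  have : Complex.I * ((2 * Real.pi * ((∑ l, n l * m l : ℤ) : ℝ) : ℝ) : ℂ)
      = ((∑ l, n l * m l : ℤ) : ℂ) * (2 * Real.pi * Complex.I) := by
    push_cast; ring
  rw [this, Complex.exp_int_mul_two_pi_mul_I, mul_one]

/-- Averaging a plane wave over a Gaussian vector of variance `2τ` damps it by `e^{-τ|k|²}`. -/
lemma integral_exp_inner_add_smul (k x : EuclideanSpace ℝ (Fin d)) {τ : ℝ} (hτ : 0 ≤ τ) :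
    ∫ y, Complex.exp (Complex.I * (inner ℝ k (x + √(2 * τ) • y) : ℝ))
        ∂(stdGaussian (EuclideanSpace ℝ (Fin d)))
      = Complex.exp (Complex.I * (inner ℝ k x : ℝ)) * Real.exp (-(‖k‖ ^ 2 * τ)) := by
  have h1 := charFun_stdGaussian (√(2 * τ) • k)
  rw [charFun_apply] at h1
  have h2 : ∀ y : EuclideanSpace ℝ (Fin d),
      Complex.exp (Complex.I * (inner ℝ k (x + √(2 * τ) • y) : ℝ))
      = Complex.exp (Complex.I * (inner ℝ k x : ℝ)) *
        Complex.exp ((inner ℝ y (√(2 * τ) • k) : ℝ) * Complex.I) := fun y => by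
    rw [← Complex.exp_add, inner_add_right, inner_smul_right, inner_smul_right, real_inner_comm y k]
    congr 1
    push_cast
    ring
  simp_rw [h2]
  rw [integral_const_mul, h1, norm_smul, Real.norm_of_nonneg (Real.sqrt_nonneg _)]
  push_cast
  congr 2
  rw [mul_pow, ← Complex.ofReal_pow, Real.sq_sqrt (by positivity)]
  push_cast
  ring

lemma isPeriodicHeatFlow_modeSum (a : (Fin d → ℤ) → ℂ) (F : Finset (Fin d → ℤ))
    {b : (Fin d → ℤ) → ℝ≥0 → ℂ} (hb : ∀ n, Continuous (b n)) :
    IsPeriodicHeatFlow (modeSum a F b) := by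
  have hint : ∀ (n : Fin d → ℤ) (t : ℝ) (x : EuclideanSpace ℝ (Fin d)), Integrable
      (fun y => a n * Complex.exp (Complex.I *
        (inner ℝ (waveVector n) (x + √(2 * max 0 (t - 1)) • y) : ℝ)) *
        heatMode (‖waveVector n‖ ^ 2) (b n) (max 0 (min t 1)))
      (stdGaussian (EuclideanSpace ℝ (Fin d))) := fun n t x => by
    refine Integrable.of_bound (by fun_prop)
      (‖a n‖ * ‖heatMode (‖waveVector n‖ ^ 2) (b n) (max 0 (min t 1))‖) (ae_of_all _ fun y => ?_)
    rw [norm_mul, norm_mul, norm_exp_I_mul, mul_one]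
  have hint' : ∀ (t : ℝ) (x : EuclideanSpace ℝ (Fin d)), Integrable
      (fun y => ∑ n ∈ F, a n * Complex.exp (Complex.I *
        (inner ℝ (waveVector n) (x + √(2 * max 0 (t - 1)) • y) : ℝ)) *
        heatMode (‖waveVector n‖ ^ 2) (b n) (max 0 (min t 1)))
      (stdGaussian (EuclideanSpace ℝ (Fin d))) := fun t x =>
    integrable_finsetSum _ fun n _ => hint n t x
  refine ⟨?_, fun t x m => ?_, fun t x => (hint' t x).re, fun t x => ?_⟩
  · refine Complex.continuous_re.comp (continuous_finsetSum _ fun n _ => ?_)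
    have := continuous_heatMode (‖waveVector n‖ ^ 2) (hb n)
    fun_prop
  · simp only [modeSum, exp_inner_add_int]
  · have h1 := integral_re (hint' t x)
    refine Eq.trans ?_ h1.symm
    rw [integral_finsetSum _ fun n _ => hint n t x, modeSum]
    simp only [RCLike.re_to_complex]
    congr 1
    refine Finset.sum_congr rfl fun n _ => ?_
    rw [integral_mul_const, integral_const_mul, integral_exp_inner_add_smul _ _ (le_max_left _ _)]
    rw [heatMode_eq_clamp _ _ t, Complex.real_smul]
    ring

end Modes

/-! ### Sub-Gaussian increments of the mode sums -/

section Increments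

variable {d : ℕ} {Ω : Type*} [MeasurableSpace Ω] {P : Measure Ω} {β : (Fin d → ℤ) → ℝ≥0 → Ω → ℂ}

/-- The real and the imaginary part have variance `t / 2` each; adding them without using their
independence costs a factor `2`, which leaves the variance of a real standard Brownian motion. -/
lemma IsConjSymmBrownianFamily.hasSubgaussianMGF_riemannSum [IsProbabilityMeasure P]
    (hβ : IsConjSymmBrownianFamily P β) {n : Fin d → ℤ} (hn : n ≠ 0) {κ : ℝ} (hκ : 0 < κ)
    {s t : ℝ≥0} (hst : s ≤ t) {N : ℕ} (hN : N ≠ 0) (A : ℂ) :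
    HasSubgaussianMGF (fun ω => (A *
        riemannSum (fun r => Real.exp (κ * r)) (fun u => β n u ω) s t N).re)
      (‖A‖ ^ 2 * ((Real.exp (2 * κ * t) - Real.exp (2 * κ * s)) / (2 * κ))).toNNReal P := by
  have h2 : (√2 : ℝ) ^ 2 = 2 := Real.sq_sqrt (by norm_num)
  have h2' : (√2 : ℝ) ≠ 0 := by positivity
  set q := (Real.exp (2 * κ * t) - Real.exp (2 * κ * s)) / (2 * κ) with hq
  have hq0 : 0 ≤ q := by
    refine div_nonneg (sub_nonneg.2 (Real.exp_le_exp.2 ?_)) (by positivity)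
    have : (s : ℝ) ≤ t := hst
    gcongr
  have e1 := (hβ.brownian_re n hn).toIsPreBrownianReal.hasSubgaussianMGF_riemannSum_exp hκ hst hN
  have e2 := (hβ.brownian_im n hn).toIsPreBrownianReal.hasSubgaussianMGF_riemannSum_exp hκ hst hN
  have f1 := HasSubgaussianMGF.const_mul_of_le e1 (A.re / √2) (c' := A.re ^ 2 / 2 * q)
    (by rw [div_pow, h2])
  have f2 := HasSubgaussianMGF.const_mul_of_le e2 (-(A.im / √2)) (c' := A.im ^ 2 / 2 * q)
    (by rw [neg_sq, div_pow, h2])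
  have f3 := HasSubgaussianMGF.add_of_le f1 f2 (u := ‖A‖ ^ 2 * q) (by positivity) (by positivity)
    (by rw [← Complex.normSq_eq_norm_sq, Complex.normSq_apply]; apply le_of_eq; ring)
  refine f3.congr (ae_of_all _ fun ω => ?_)
  simp only [riemannSum, smul_eq_mul, Complex.mul_re, Complex.re_sum,
    Complex.real_smul, Complex.sub_re, Complex.sub_im, Complex.mul_im, Complex.ofReal_re,
    Complex.ofReal_im, zero_mul, sub_zero, add_zero, Finset.mul_sum]
  rw [← Finset.sum_add_distrib]
  refine Finset.sum_congr rfl fun i _ => ?_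
  field_simp
  ring

lemma measurable_riemannSum_eval (f : ℝ → ℝ) (s t : ℝ≥0) (N : ℕ) :
    Measurable fun b : ℝ≥0 → ℂ => riemannSum f b s t N := by
  unfold riemannSum
  fun_prop

/-- Sums of Riemann sums over distinct modes: the modes in a half space are independent, and the two
opposite half spaces are combined without using independence. -/
lemma IsConjSymmBrownianFamily.hasSubgaussianMGF_sum_riemannSum [IsProbabilityMeasure P]
    (hβ : IsConjSymmBrownianFamily P β) {F : Finset (Fin d → ℤ)} (hF : 0 ∉ F)
    {s t : ℝ≥0} (hst : s ≤ t) {N : ℕ} (hN : N ≠ 0) (A A' : (Fin d → ℤ) → ℂ)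
    {c : (Fin d → ℤ) → ℝ}
    (hc : ∀ n ∈ F, 2 * (‖A n‖ ^ 2 * ((Real.exp (2 * ‖waveVector n‖ ^ 2 * t)
          - Real.exp (2 * ‖waveVector n‖ ^ 2 * s)) / (2 * ‖waveVector n‖ ^ 2)))
        + 2 * (‖A' n‖ ^ 2 * ((Real.exp (2 * ‖waveVector n‖ ^ 2 * s) - 1)
          / (2 * ‖waveVector n‖ ^ 2))) ≤ c n) :
    HasSubgaussianMGF (fun ω => ∑ n ∈ F,
        ((A n *
          riemannSum (fun r => Real.exp (‖waveVector n‖ ^ 2 * r)) (fun u => β n u ω) s t N).re +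
        (A' n *
          riemannSum (fun r => Real.exp (‖waveVector n‖ ^ 2 * r)) (fun u => β n u ω) 0 s N).re))
      (4 * ∑ n ∈ F, c n).toNNReal P := by
  classical
  set ξ : (Fin d → ℤ) → (ℝ≥0 → ℂ) → ℝ := fun n b =>
    (A n * riemannSum (fun r => Real.exp (‖waveVector n‖ ^ 2 * r)) b s t N).re +
      (A' n * riemannSum (fun r => Real.exp (‖waveVector n‖ ^ 2 * r)) b 0 s N).re with hξ
  have hξm : ∀ n, Measurable (ξ n) := fun n => by
    have h1 := measurable_riemannSum_eval (fun r => Real.exp (‖waveVector n‖ ^ 2 * r)) s t N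
    have h2 := measurable_riemannSum_eval (fun r => Real.exp (‖waveVector n‖ ^ 2 * r)) 0 s N
    simp only [hξ]
    fun_prop
  have hexp : ∀ (κ : ℝ) (u v : ℝ≥0), 0 < κ → u ≤ v →
      0 ≤ (Real.exp (2 * κ * v) - Real.exp (2 * κ * u)) / (2 * κ) := by
    intro κ u v hκ huv
    refine div_nonneg (sub_nonneg.2 (Real.exp_le_exp.2 ?_)) (by positivity)
    have : (u : ℝ) ≤ v := huv
    gcongr
  have hone : ∀ n ∈ F, 0 ≤ c n ∧ HasSubgaussianMGF (fun ω => ξ n fun u => β n u ω)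
      (c n).toNNReal P := by
    intro n hn
    have hn0 : n ≠ 0 := fun h => hF (h ▸ hn)
    have hκ : 0 < ‖waveVector n‖ ^ 2 := by
      have := one_le_norm_waveVector hn0
      positivity
    have e1 := hβ.hasSubgaussianMGF_riemannSum hn0 hκ hst hN (A n)
    have e2 := hβ.hasSubgaussianMGF_riemannSum hn0 hκ (zero_le : 0 ≤ s) hN (A' n)
    have p1 := hexp _ s t hκ hst
    have p2 := hexp _ 0 s hκ zero_le
    have hcn := hc n hn
    simp only [NNReal.coe_zero, mul_zero, Real.exp_zero] at p2 e2
    have q1 := mul_nonneg (sq_nonneg ‖A n‖) p1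
    have q2 := mul_nonneg (sq_nonneg ‖A' n‖) p2
    exact ⟨by linarith, HasSubgaussianMGF.add_of_le e1 e2 q1 q2 hcn⟩
  have hhalf : ∀ (p : (Fin d → ℤ) → Prop) [DecidablePred p],
      (∀ n, p n → p (-n) → n = 0) →
      HasSubgaussianMGF (fun ω => ∑ n ∈ F with p n, ξ n fun u => β n u ω)
        (∑ n ∈ F, c n).toNNReal P := by
    intro p _ hp
    have hind := (hβ.indep {n | p n} hp).comp (fun n => ξ n) (fun n => hξm n)
    have := HasSubgaussianMGF.sum_of_iIndepFun_of_le hind (s := F.subtype p)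
      (c := fun n => c n) (fun n hn => (hone n (Finset.mem_subtype.1 hn)).1)
      (fun n hn => (hone n (Finset.mem_subtype.1 hn)).2) (u := ∑ n ∈ F, c n) (by
        have e := Finset.sum_subtype_eq_sum_filter (s := F) c (p := p)
        refine e.trans_le ?_
        exact Finset.sum_le_sum_of_subset_of_nonneg (Finset.filter_subset _ _)
          fun n hn _ => (hone n hn).1)
    refine this.congr (ae_of_all _ fun ω => ?_)
    exact Finset.sum_subtype_eq_sum_filter (s := F) (fun n => ξ n fun u => β n u ω) (p := p)
  have hsum0 : 0 ≤ ∑ n ∈ F, c n := Finset.sum_nonneg fun n hn => (hone n hn).1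
  -- the lexicographic order provides the half spaces
  have h1 := hhalf (fun n => 0 < toLex n) fun n h h' => by
    rw [toLex_neg, Left.neg_pos_iff] at h'
    exact absurd h h'.not_gt
  have h2 := hhalf (fun n => ¬ 0 < toLex n) fun n h h' => by
    rw [toLex_neg, Left.neg_pos_iff] at h'
    have h0 : toLex n = 0 := le_antisymm (not_lt.1 h) (not_lt.1 h')
    exact h0
  have h3 := HasSubgaussianMGF.add_of_le h1 h2 (u := 4 * ∑ n ∈ F, c n) hsum0 hsum0
    (by linarith)
  refine h3.congr (ae_of_all _ fun ω => ?_)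
  exact Finset.sum_filter_add_sum_filter_not F _ _

lemma min_one_le_rpow {y r : ℝ} (hy : 0 ≤ y) (hr0 : 0 ≤ r) (hr : r ≤ 1) : min 1 y ≤ y ^ r := by
  rcases le_total y 1 with h | h
  · rw [min_eq_right h]
    calc y = y ^ (1 : ℝ) := (Real.rpow_one y).symm
      _ ≤ y ^ r := Real.rpow_le_rpow_of_exponent_ge' hy h hr0 hr
  · rw [min_eq_left h]
    exact Real.one_le_rpow h hr0

/-- The increment of a single mode splits into its evolution from `s` to `t` and the change of
the factor in front of its value at time `s`; the two coefficients are bounded here. -/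
lemma heat_coefficient_bound {k x x' : EuclideanSpace ℝ (Fin d)} (hk : 0 < ‖k‖) {s t δ θ : ℝ}
    (hs : 0 ≤ s) (hst : s ≤ t) (hθ0 : 0 ≤ θ) (hθ : θ ≤ 1)
    (hδ : δ = √(t - s) + ‖x - x'‖) (a : ℂ) :
    2 * (‖a * Complex.exp (Complex.I * (inner ℝ k x : ℝ)) * Real.exp (-(‖k‖ ^ 2 * t))‖ ^ 2 *
        ((Real.exp (2 * ‖k‖ ^ 2 * t) - Real.exp (2 * ‖k‖ ^ 2 * s)) / (2 * ‖k‖ ^ 2)))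
      + 2 * (‖a * (Complex.exp (Complex.I * (inner ℝ k x : ℝ)) * Real.exp (-(‖k‖ ^ 2 * t)) -
          Complex.exp (Complex.I * (inner ℝ k x' : ℝ)) * Real.exp (-(‖k‖ ^ 2 * s)))‖ ^ 2 *
        ((Real.exp (2 * ‖k‖ ^ 2 * s) - 1) / (2 * ‖k‖ ^ 2)))
      ≤ 11 * (‖a‖ ^ 2 * (‖k‖ ^ θ) ^ 2 / ‖k‖ ^ 2) * (δ ^ θ) ^ 2 := by
  set κ := ‖k‖ ^ 2 with hκ
  have hκ0 : 0 < κ := by positivity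
  set τ := t - s with hτ
  have hτ0 : 0 ≤ τ := by linarith
  have hδ0 : 0 ≤ δ := by rw [hδ]; positivity
  set u := (‖k‖ * δ) ^ θ with hu
  have hu0 : 0 ≤ u := by positivity
  have hτδ : √τ ≤ δ := by rw [hδ]; linarith [norm_nonneg (x - x')]
  have hκτ : (κ * τ) = (‖k‖ * √τ) ^ 2 := by rw [mul_pow, Real.sq_sqrt hτ0]
  have hkτ : (‖k‖ * √τ) ^ θ ≤ u :=
    Real.rpow_le_rpow (by positivity) (by gcongr) hθ0
  have hκτθ : (κ * τ) ^ θ ≤ u ^ 2 := by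
    have e : ((‖k‖ * √τ) ^ 2) ^ θ = ((‖k‖ * √τ) ^ θ) ^ 2 := by
      rw [← Real.rpow_natCast, ← Real.rpow_natCast, ← Real.rpow_mul (by positivity),
        ← Real.rpow_mul (by positivity), mul_comm θ]
    rw [hκτ, e]
    gcongr
  have hexpneg : ∀ y : ℝ, 0 ≤ y → 0 ≤ 1 - Real.exp (-y) ∧ 1 - Real.exp (-y) ≤ min 1 y := fun y hy =>
    ⟨by linarith [Real.exp_le_one_iff.2 (neg_nonpos.2 hy)],
      le_min (by linarith [Real.exp_pos (-y)]) (by linarith [Real.add_one_le_exp (-y)])⟩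
  -- the evolution from `s` to `t`
  have h1 : ‖a * Complex.exp (Complex.I * (inner ℝ k x : ℝ)) * Real.exp (-(κ * t))‖ ^ 2 *
      ((Real.exp (2 * κ * t) - Real.exp (2 * κ * s)) / (2 * κ))
      ≤ ‖a‖ ^ 2 * (2 * u ^ 2) / (2 * κ) := by
    rw [norm_mul, norm_mul, norm_exp_I_mul, mul_one, Complex.norm_real,
      Real.norm_of_nonneg (Real.exp_pos _).le]
    have e : (‖a‖ * Real.exp (-(κ * t))) ^ 2 *
          ((Real.exp (2 * κ * t) - Real.exp (2 * κ * s)) / (2 * κ))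
        = ‖a‖ ^ 2 * (1 - Real.exp (-(2 * κ * τ))) / (2 * κ) := by
      have e1 : Real.exp (-(κ * t)) ^ 2 * Real.exp (2 * κ * t) = 1 := by
        rw [← Real.exp_nat_mul, ← Real.exp_add, ← Real.exp_zero]; congr 1; push_cast; ring
      have e2 : Real.exp (-(κ * t)) ^ 2 * Real.exp (2 * κ * s) = Real.exp (-(2 * κ * τ)) := by
        rw [← Real.exp_nat_mul, ← Real.exp_add]; congr 1; push_cast; rw [hτ]; ring
      rw [mul_pow, ← mul_div_assoc, mul_sub, mul_assoc, e1, mul_assoc, e2]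
      ring
    rw [e]
    have h2 : 1 - Real.exp (-(2 * κ * τ)) ≤ 2 * u ^ 2 := by
      refine (hexpneg _ (by positivity)).2.trans
        ((min_one_le_rpow (by positivity) hθ0 hθ).trans ?_)
      rw [mul_assoc, Real.mul_rpow (by norm_num) (by positivity)]
      have : (2 : ℝ) ^ θ ≤ 2 := (Real.rpow_le_rpow_of_exponent_le (by norm_num) hθ).trans_eq
        (Real.rpow_one 2)
      gcongr
    gcongr
  -- the change of the factor in front of the value at time `s`
  have h2 : ‖Complex.exp (Complex.I * (inner ℝ k x : ℝ)) * Real.exp (-(κ * τ)) -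
      Complex.exp (Complex.I * (inner ℝ k x' : ℝ))‖ ≤ 3 * u := by
    have e : Complex.exp (Complex.I * (inner ℝ k x : ℝ)) * Real.exp (-(κ * τ)) -
        Complex.exp (Complex.I * (inner ℝ k x' : ℝ))
        = Complex.exp (Complex.I * (inner ℝ k x : ℝ)) * ((Real.exp (-(κ * τ)) - 1 : ℝ) : ℂ) +
          Complex.exp (Complex.I * (inner ℝ k x' : ℝ)) *
            (Complex.exp (Complex.I * (inner ℝ k (x - x') : ℝ)) - 1) := by
      rw [mul_sub _ (Complex.exp _) 1, ← Complex.exp_add, inner_sub_right]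
      push_cast
      rw [← mul_add, add_sub_cancel]
      ring
    rw [e]
    refine (norm_add_le _ _).trans ?_
    rw [norm_mul, norm_mul, norm_exp_I_mul, norm_exp_I_mul, one_mul, one_mul, Complex.norm_real,
      Real.norm_eq_abs, abs_sub_comm, abs_of_nonneg (hexpneg _ (by positivity)).1]
    have h3 : 1 - Real.exp (-(κ * τ)) ≤ u := by
      refine (hexpneg _ (by positivity)).2.trans
        ((min_one_le_rpow (r := θ / 2) (by positivity) (by linarith) (by linarith)).trans ?_)
      rw [hκτ, ← Real.rpow_natCast, ← Real.rpow_mul (by positivity)]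
      refine le_trans (le_of_eq ?_) hkτ
      congr 1
      push_cast
      ring
    have h4 : ‖Complex.exp (Complex.I * (inner ℝ k (x - x') : ℝ)) - 1‖ ≤ 2 * u := by
      set w := ‖k‖ * ‖x - x'‖ with hw
      have h5 : ‖Complex.exp (Complex.I * (inner ℝ k (x - x') : ℝ)) - 1‖ ≤ 2 * min 1 w := by
        rw [mul_min_of_nonneg _ _ (by norm_num)]
        refine le_min ?_ ?_
        · refine (norm_sub_le _ _).trans ?_
          rw [norm_exp_I_mul, norm_one]; norm_num
        · refine Real.norm_exp_I_mul_ofReal_sub_one_le.trans ((norm_inner_le_norm _ _).trans ?_)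
          have : 0 ≤ w := by positivity
          linarith
      have h6 : w ^ θ ≤ u := Real.rpow_le_rpow (by positivity)
        (by rw [hw, hδ]; gcongr; linarith [Real.sqrt_nonneg τ]) hθ0
      linarith [min_one_le_rpow (by positivity : 0 ≤ w) hθ0 hθ]
    linarith
  have h3 : ‖a * (Complex.exp (Complex.I * (inner ℝ k x : ℝ)) * Real.exp (-(κ * t)) -
      Complex.exp (Complex.I * (inner ℝ k x' : ℝ)) * Real.exp (-(κ * s)))‖ ^ 2 *
        ((Real.exp (2 * κ * s) - 1) / (2 * κ)) ≤ ‖a‖ ^ 2 * (9 * u ^ 2) / (2 * κ) := by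
    have e : Complex.exp (Complex.I * (inner ℝ k x : ℝ)) * Real.exp (-(κ * t)) -
        Complex.exp (Complex.I * (inner ℝ k x' : ℝ)) * Real.exp (-(κ * s))
        = (Complex.exp (Complex.I * (inner ℝ k x : ℝ)) * Real.exp (-(κ * τ)) -
          Complex.exp (Complex.I * (inner ℝ k x' : ℝ))) * Real.exp (-(κ * s)) := by
      have : Real.exp (-(κ * t)) = Real.exp (-(κ * τ)) * Real.exp (-(κ * s)) := by
        rw [← Real.exp_add]; congr 1; rw [hτ]; ring
      rw [this]
      push_cast
      ring
    rw [e, norm_mul, norm_mul, Complex.norm_real, Real.norm_of_nonneg (Real.exp_pos _).le]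
    set D := ‖Complex.exp (Complex.I * (inner ℝ k x : ℝ)) * Real.exp (-(κ * τ)) -
      Complex.exp (Complex.I * (inner ℝ k x' : ℝ))‖
    have e2 : (‖a‖ * (D * Real.exp (-(κ * s)))) ^ 2 * ((Real.exp (2 * κ * s) - 1) / (2 * κ))
        = ‖a‖ ^ 2 * (D ^ 2 * (1 - Real.exp (-(2 * κ * s)))) / (2 * κ) := by
      have e1 : Real.exp (-(κ * s)) ^ 2 * Real.exp (2 * κ * s) = 1 := by
        rw [← Real.exp_nat_mul, ← Real.exp_add, ← Real.exp_zero]; congr 1; push_cast; ring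
      have e3 : Real.exp (-(κ * s)) ^ 2 = Real.exp (-(2 * κ * s)) := by
        rw [← Real.exp_nat_mul]; congr 1; push_cast; ring
      rw [← e3]
      linear_combination (‖a‖ ^ 2 * D ^ 2 / (2 * κ)) * e1
    rw [e2]
    have hD : D ^ 2 ≤ 9 * u ^ 2 := by
      have : D ^ 2 ≤ (3 * u) ^ 2 := pow_le_pow_left₀ (norm_nonneg _) h2 2
      linarith [this, mul_pow 3 u 2]
    have hE := hexpneg (2 * κ * s) (by positivity)
    have hE1 : 1 - Real.exp (-(2 * κ * s)) ≤ 1 := hE.2.trans (min_le_left _ _)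
    have : D ^ 2 * (1 - Real.exp (-(2 * κ * s))) ≤ 9 * u ^ 2 :=
      (mul_le_of_le_one_right (sq_nonneg D) hE1).trans hD
    gcongr
  have hu2 : u = ‖k‖ ^ θ * δ ^ θ := Real.mul_rpow hk.le hδ0
  calc _ ≤ 2 * (‖a‖ ^ 2 * (2 * u ^ 2) / (2 * κ)) + 2 * (‖a‖ ^ 2 * (9 * u ^ 2) / (2 * κ)) := by
        linarith
    _ = _ := by rw [hu2]; field_simp; ring

end Increments

/-! ### Continuous versions of the Brownian family -/

section Version

variable {d : ℕ} {Ω : Type*} [MeasurableSpace Ω] {P : Measure Ω} {β : (Fin d → ℤ) → ℝ≥0 → Ω → ℂ}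

/-- `B` is indistinguishable from the Brownian family `β`, has continuous paths, and satisfies the
symmetry constraint, without exceptional sets in the last two properties. -/
structure IsContinuousVersion (P : Measure Ω) (β : (Fin d → ℤ) → ℝ≥0 → Ω → ℂ)
    (B : Ω → (Fin d → ℤ) → ℝ≥0 → ℂ) : Prop where
  measurable : ∀ n t, Measurable fun ω => B ω n t
  continuous : ∀ ω n, Continuous (B ω n)
  conj_symm : ∀ ω n t, B ω (-n) t = starRingEnd ℂ (B ω n t)
  ae_eq : ∀ᵐ ω ∂P, ∀ n t, B ω n t = β n t ω

lemma IsConjSymmBrownianFamily.exists_isContinuousVersion (hβ : IsConjSymmBrownianFamily P β) :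
    ∃ B, IsContinuousVersion P β B := by
  classical
  have hgood : ∀ᵐ ω ∂P, (∀ n, Continuous fun t => β n t ω) ∧
      ∀ n t, β (-n) t ω = starRingEnd ℂ (β n t ω) := by
    have hconj : ∀ᵐ ω ∂P, ∀ n t, β (-n) t ω = starRingEnd ℂ (β n t ω) :=
      ae_all_iff.2 hβ.conj_symm
    have hcont : ∀ᵐ ω ∂P, ∀ n, n ≠ 0 → Continuous fun t => β n t ω := by
      refine ae_all_iff.2 fun n => ?_
      by_cases hn : n = 0
      · exact ae_of_all _ fun _ h => absurd hn h
      filter_upwards [(hβ.brownian_re n hn).cont, (hβ.brownian_im n hn).cont] with ω h1 h2 _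
      have h2' : (√2 : ℝ) ≠ 0 := by positivity
      have e : (fun t => β n t ω) = fun t => (((√2)⁻¹ * (√2 * (β n t ω).re) : ℝ) : ℂ)
          + (((√2)⁻¹ * (√2 * (β n t ω).im) : ℝ) : ℂ) * Complex.I := by
        ext t
        rw [inv_mul_cancel_left₀ h2', inv_mul_cancel_left₀ h2', Complex.re_add_im]
      rw [e]
      fun_prop
    filter_upwards [hconj, hcont, hβ.brownian_zero.cont] with ω h1 h2 h3
    refine ⟨fun n => ?_, h1⟩
    by_cases hn : n = 0
    · subst hn
      have e : (fun t => β 0 t ω) = fun t => ((β 0 t ω).re : ℂ) := by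
        ext t
        have := h1 0 t
        rw [neg_zero] at this
        exact (Complex.conj_eq_iff_re.1 this.symm).symm
      rw [e]
      fun_prop
    · exact h2 n hn
  obtain ⟨G, hGsub, hGm, hG0⟩ := exists_measurable_superset_of_null (ae_iff.1 hgood)
  have hmem : ∀ ω, ω ∉ G → (∀ n, Continuous fun t => β n t ω) ∧
      ∀ n t, β (-n) t ω = starRingEnd ℂ (β n t ω) := fun ω h => by
    by_contra hcon
    exact h (hGsub hcon)
  refine ⟨fun ω n t => if ω ∈ G then 0 else β n t ω, fun n t => ?_, fun ω n => ?_,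
    fun ω n t => ?_, ?_⟩
  · exact Measurable.ite hGm measurable_const (hβ.measurable n t)
  · by_cases h : ω ∈ G
    · simp only [h, if_true]; exact continuous_const
    · simp only [h, if_false]; exact (hmem ω h).1 n
  · by_cases h : ω ∈ G
    · simp [h]
    · simp only [h, if_false]; exact (hmem ω h).2 n t
  · have : ∀ᵐ ω ∂P, ω ∉ G := measure_eq_zero_iff_ae_notMem.1 hG0
    filter_upwards [this] with ω h n t
    simp [h]

variable {B : Ω → (Fin d → ℤ) → ℝ≥0 → ℂ}

lemma IsContinuousVersion.measurable_heatMode (hB : IsContinuousVersion P β B) (κ t : ℝ)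
    (n : Fin d → ℤ) : Measurable fun ω => heatMode κ (B ω n) t := by
  have h1 : ∀ T : ℝ≥0, Measurable fun ω => expIntegral κ (B ω n) 0 T := fun T => by
    refine measurable_of_tendsto_metrizable (f := fun N ω =>
      riemannSum (fun r => Real.exp (κ * r)) (B ω n) 0 T N) (fun N => ?_) ?_
    · have := hB.measurable n
      unfold riemannSum
      fun_prop
    · rw [tendsto_pi_nhds]
      exact fun ω => tendsto_riemannSum_exp κ (hB.continuous ω n) zero_le
  exact Measurable.const_smul (h1 _) (Real.exp (-(κ * t)))

lemma IsContinuousVersion.measurable_modeSum (hB : IsContinuousVersion P β B)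
    (a : (Fin d → ℤ) → ℂ) (F : Finset (Fin d → ℤ)) (z : ℝ × EuclideanSpace ℝ (Fin d)) :
    Measurable fun ω => modeSum a F (B ω) z := by
  unfold modeSum
  have := fun n => hB.measurable_heatMode (‖waveVector n‖ ^ 2) z.1 n
  fun_prop

lemma IsContinuousVersion.heatFourierTerm_eq (hB : IsContinuousVersion P β B)
    (Khat : (Fin d → ℤ) → ℝ) : ∀ᵐ ω ∂P, ∀ t x n, heatFourierTerm Khat β t x n ω
      = (√(Khat n) : ℂ) * Complex.exp (Complex.I * (inner ℝ (waveVector n) x : ℝ)) *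
        heatMode (‖waveVector n‖ ^ 2) (B ω n) t := by
  filter_upwards [hB.ae_eq] with ω hω t x n
  have : (fun s => β n s ω) = B ω n := funext fun s => (hω n s).symm
  rw [heatFourierTerm, this, pathIntegral_heat _ _ (hB.continuous ω n)]
  rfl

/-- The increments of mode sums without zero mode are sub-Gaussian, with Hölder exponent `θ` in the
parabolic distance. The constant `44` is the factor `11` of `heat_coefficient_bound` times the
factor `4` lost in combining the two half spaces. -/
lemma IsContinuousVersion.hasSubgaussianMGF_modeSum_sub [IsProbabilityMeasure P]
    (hβ : IsConjSymmBrownianFamily P β) (hB : IsContinuousVersion P β B) {a : (Fin d → ℤ) → ℂ}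
    {F : Finset (Fin d → ℤ)} (hF : 0 ∉ F) {θ : ℝ} (hθ0 : 0 ≤ θ) (hθ : θ ≤ 1) {W : ℝ}
    (hW : 44 * ∑ n ∈ F, ‖a n‖ ^ 2 * (‖waveVector n‖ ^ θ) ^ 2 / ‖waveVector n‖ ^ 2 ≤ W)
    (z z' : ℝ × EuclideanSpace ℝ (Fin d)) (hz : z.1 ∈ Set.Icc (0 : ℝ) 1)
    (hz' : z'.1 ∈ Set.Icc (0 : ℝ) 1) :
    HasSubgaussianMGF (fun ω => modeSum a F (B ω) z - modeSum a F (B ω) z')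
      (W * (parabolicDist z z' ^ θ) ^ 2).toNNReal P := by
  wlog hzz : z'.1 ≤ z.1 generalizing z z'
  · have := (this z' z hz' hz (le_of_not_ge hzz)).neg
    rw [parabolicDist_comm] at this
    refine this.congr (ae_of_all _ fun ω => ?_)
    simp
  obtain ⟨t, x⟩ := z
  obtain ⟨s, x'⟩ := z'
  dsimp only at hz hz' hzz
  lift s to ℝ≥0 using hz'.1
  lift t to ℝ≥0 using hz.1
  have hst : s ≤ t := hzz
  set δ := parabolicDist ((t : ℝ), x) ((s : ℝ), x') with hδ
  have hδ' : δ = √((t : ℝ) - s) + ‖x - x'‖ := by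
    rw [hδ, parabolicDist]
    simp only
    rw [abs_of_nonneg (by linarith)]
  set A : (Fin d → ℤ) → ℂ := fun n => a n *
    Complex.exp (Complex.I * (inner ℝ (waveVector n) x : ℝ)) *
      Real.exp (-(‖waveVector n‖ ^ 2 * t)) with hA
  set A' : (Fin d → ℤ) → ℂ := fun n => a n *
    (Complex.exp (Complex.I * (inner ℝ (waveVector n) x : ℝ)) *
      Real.exp (-(‖waveVector n‖ ^ 2 * t)) -
    Complex.exp (Complex.I * (inner ℝ (waveVector n) x' : ℝ)) *
      Real.exp (-(‖waveVector n‖ ^ 2 * s))) with hA'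
  have hsub := fun N : ℕ => hβ.hasSubgaussianMGF_sum_riemannSum hF hst (Nat.succ_ne_zero N) A A'
    (c := fun n => 11 * (‖a n‖ ^ 2 * (‖waveVector n‖ ^ θ) ^ 2 / ‖waveVector n‖ ^ 2) * (δ ^ θ) ^ 2)
    (fun n hn => heat_coefficient_bound
      (zero_lt_one.trans_le (one_le_norm_waveVector fun h => hF (h ▸ hn)))
      s.2 hzz hθ0 hθ hδ' (a n))
  have hle : 4 * ∑ n ∈ F, 11 * (‖a n‖ ^ 2 * (‖waveVector n‖ ^ θ) ^ 2 / ‖waveVector n‖ ^ 2)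
      * (δ ^ θ) ^ 2 ≤ W * (δ ^ θ) ^ 2 := by
    rw [← Finset.sum_mul, ← Finset.mul_sum, ← mul_assoc, ← mul_assoc]
    refine mul_le_mul_of_nonneg_right ?_ (sq_nonneg _)
    linarith
  refine HasSubgaussianMGF.of_tendsto
    (fun N => HasSubgaussianMGF.mono (hsub N) (Real.toNNReal_le_toNNReal hle)) ?_
  filter_upwards [hB.ae_eq] with ω hω
  have hpath : ∀ n, (fun u => β n u ω) = B ω n := fun n => funext fun u => (hω n u).symm
  simp_rw [hpath]
  have hlim : ∀ n, ∀ u v : ℝ≥0, u ≤ v → Tendsto (fun N : ℕ =>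
      riemannSum (fun r => Real.exp (‖waveVector n‖ ^ 2 * r)) (B ω n) u v N.succ) atTop
      (𝓝 (expIntegral (‖waveVector n‖ ^ 2) (B ω n) u v)) := fun n u v huv =>
    (tendsto_riemannSum_exp _ (hB.continuous ω n) huv).comp (tendsto_add_atTop_nat 1)
  have hval : modeSum a F (B ω) ((t : ℝ), x) - modeSum a F (B ω) ((s : ℝ), x')
      = ∑ n ∈ F, ((A n * expIntegral (‖waveVector n‖ ^ 2) (B ω n) s t).re
        + (A' n * expIntegral (‖waveVector n‖ ^ 2) (B ω n) 0 s).re) := by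
    simp only [modeSum, Complex.re_sum]
    rw [← Finset.sum_sub_distrib]
    refine Finset.sum_congr rfl fun n _ => ?_
    rw [← Complex.sub_re, ← Complex.add_re]
    congr 1
    simp only [heatMode, min_eq_left hz.2, min_eq_left hz'.2, Real.toNNReal_coe,
      ← expIntegral_add (‖waveVector n‖ ^ 2) (hB.continuous ω n) 0 s t, Complex.real_smul, hA, hA']
    ring
  rw [hval]
  refine tendsto_finsetSum _ fun n _ => Tendsto.add ?_ ?_
  · exact (Complex.continuous_re.tendsto _).comp ((hlim n s t hst).const_mul (A n))
  · exact (Complex.continuous_re.tendsto _).comp ((hlim n 0 s zero_le).const_mul (A' n))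

end Version

/-! ### Summability over the lattice of wave vectors -/

section Lattice

lemma summable_norm_waveVector_rpow (d : ℕ) {r : ℝ} (hr : r < -d) :
    Summable fun n : Fin d → ℤ => ‖waveVector n‖ ^ r := by
  set b := (EuclideanSpace.basisFun (Fin d) ℝ).toBasis with hb
  set L := Submodule.span ℤ (Set.range b) with hL
  have hrank : Module.finrank ℤ L = d := by
    rw [Module.finrank_eq_card_basis (b.restrictScalars ℤ), Fintype.card_fin]
  have hsum := ZLattice.summable_norm_rpow L r (by rwa [hrank])
  set φ : (Fin d → ℤ) → L := fun n => ⟨∑ i, n i • b i,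
    Submodule.sum_mem _ fun i _ => Submodule.smul_mem _ _ (Submodule.subset_span ⟨i, rfl⟩)⟩ with hφ
  have hφn : ∀ n, ((φ n : L) : EuclideanSpace ℝ (Fin d)) = WithLp.toLp 2 fun i => (n i : ℝ) := by
    intro n
    ext j
    simp [hφ, hb, Finset.sum_apply, Pi.single_apply]
  have hinj : Function.Injective φ := fun n m h => by
    have h1 := congr_arg (fun y : L => (y : EuclideanSpace ℝ (Fin d))) h
    simp only [hφn] at h1
    ext i
    have := congr_fun (congr_arg WithLp.ofLp h1) i
    simpa using this
  have h2 := (hsum.comp_injective hinj).mul_left ((2 * Real.pi) ^ r)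
  refine h2.congr fun n => ?_
  have hw : waveVector n = (2 * Real.pi) • ((φ n : L) : EuclideanSpace ℝ (Fin d)) := by
    rw [hφn]
    ext i
    simp [waveVector]
  rw [hw, norm_smul, Real.norm_of_nonneg (by positivity), Real.mul_rpow (by positivity)
    (norm_nonneg _)]
  rfl

/-- The weight `(1 + |k|²)^{-s/2} |k|^{2θ}` that dominates all increments. -/
noncomputable def latticeWeight (s θ : ℝ) {d : ℕ} (n : Fin d → ℤ) : ℝ :=
  (1 + ‖waveVector n‖ ^ 2) ^ (-s / 2) * (‖waveVector n‖ ^ θ) ^ 2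

lemma latticeWeight_nonneg (s θ : ℝ) {d : ℕ} (n : Fin d → ℤ) : 0 ≤ latticeWeight s θ n := by
  unfold latticeWeight; positivity

lemma summable_latticeWeight {d : ℕ} {s θ : ℝ} (hs : 0 ≤ s) (hsθ : 2 * θ < s - d) :
    Summable (latticeWeight s θ : (Fin d → ℤ) → ℝ) := by
  have h1 := summable_norm_waveVector_rpow d (r := 2 * θ - s) (by linarith)
  have h2 : Summable fun n : Fin d → ℤ => ‖waveVector n‖ ^ (2 * θ - s)
      + if n = 0 then latticeWeight s θ (0 : Fin d → ℤ) else 0 :=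
    h1.add (summable_of_ne_finset_zero (s := {0}) fun n hn => by
      simp only [Finset.mem_singleton] at hn; simp [hn])
  refine Summable.of_nonneg_of_le (latticeWeight_nonneg s θ) (fun n => ?_) h2
  by_cases hn : n = 0
  · subst hn
    simp only [if_true]
    have : 0 ≤ ‖(waveVector 0 : EuclideanSpace ℝ (Fin d))‖ ^ (2 * θ - s) := by positivity
    linarith
  · simp only [hn, if_false, add_zero]
    have hk : 0 < ‖waveVector n‖ := zero_lt_one.trans_le (one_le_norm_waveVector hn)
    have h3 : (1 + ‖waveVector n‖ ^ 2) ^ (-s / 2) ≤ (‖waveVector n‖ ^ 2) ^ (-s / 2) :=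
      Real.rpow_le_rpow_of_nonpos (by positivity) (by linarith) (by linarith)
    have h4 : (‖waveVector n‖ ^ 2) ^ (-s / 2) * (‖waveVector n‖ ^ θ) ^ 2
        = ‖waveVector n‖ ^ (2 * θ - s) := by
      rw [← Real.rpow_natCast, ← Real.rpow_natCast, ← Real.rpow_mul hk.le, ← Real.rpow_mul hk.le,
        ← Real.rpow_add hk]
      congr 1
      push_cast
      ring
    rw [← h4, latticeWeight]
    gcongr

end Lattice

/-! ### Almost sure convergence of the Fourier series -/

section Series

variable {d : ℕ}

/-- An exhaustion `F` of the nonzero lattice points by finite symmetric sets, with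
blocks `F (j + 1) \ F j` whose total weight decays geometrically. -/
structure IsBlockExhaustion (w : (Fin d → ℤ) → ℝ) (F : ℕ → Finset (Fin d → ℤ)) (A : ℝ) : Prop where
  zero : F 0 = ∅
  mono : Monotone F
  zero_notMem : ∀ j, 0 ∉ F j
  neg_mem : ∀ j, ∀ n ∈ F j, -n ∈ F j
  exhaust : ∀ n, n ≠ 0 → ∀ᶠ j in atTop, n ∈ F j
  pos : 0 < A
  sum_le : ∀ j, ∑ n ∈ F (j + 1) \ F j, w n ≤ A * (1 / 4) ^ j

lemma exists_isBlockExhaustion {w : (Fin d → ℤ) → ℝ} (hw0 : ∀ n, 0 ≤ w n) (hw : Summable w) :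
    ∃ F A, IsBlockExhaustion w F A := by
  classical
  set G : ℕ → Finset (Fin d → ℤ) := fun j =>
    (Finset.Icc (fun _ => -(j : ℤ)) fun _ => (j : ℤ)).erase 0
  have hGmem : ∀ j n, n ∈ G j ↔ n ≠ 0 ∧ ∀ i, -(j : ℤ) ≤ n i ∧ n i ≤ j := fun j n => by
    simp only [G, Finset.mem_erase, Finset.mem_Icc, Pi.le_def, forall_and]
  have hGmono : Monotone G := fun i j hij n hn => by
    rw [hGmem] at hn ⊢
    have : (i : ℤ) ≤ j := by exact_mod_cast hij
    exact ⟨hn.1, fun l => ⟨by linarith [(hn.2 l).1], by linarith [(hn.2 l).2]⟩⟩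
  have hGex : ∀ n, n ≠ 0 → ∀ᶠ j in atTop, n ∈ G j := fun n hn => by
    refine eventually_atTop.2 ⟨∑ i, (n i).natAbs, fun j hj => (hGmem j n).2 ⟨hn, fun i => ?_⟩⟩
    have h1 : (n i).natAbs ≤ ∑ i, (n i).natAbs :=
      Finset.single_le_sum (f := fun i => (n i).natAbs) (fun _ _ => Nat.zero_le _)
        (Finset.mem_univ i)
    have h2 := h1.trans hj
    omega
  have hvan := summable_iff_vanishing_norm.1 hw
  choose S hS using fun j : ℕ => hvan ((1 / 4) ^ j) (by positivity)
  -- cubes that grow so fast that all but the weight `4⁻ʲ` is exhausted at step `j`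
  obtain ⟨φ, hφ, hφS⟩ := extraction_forall_of_eventually (P := fun j m => (S j).erase 0 ⊆ G m)
    fun j => by
      have : ∀ᶠ m in atTop, ∀ n ∈ (S j).erase 0, n ∈ G m :=
        (Finset.eventually_all _).2 fun n hn => hGex n (Finset.ne_of_mem_erase hn)
      exact this.mono fun m hm n hn => hm n hn
  set F : ℕ → Finset (Fin d → ℤ) := fun j => j.casesOn ∅ fun i => G (φ i) with hF
  refine ⟨F, ∑' n, w n + 4, rfl, ?_, ?_, ?_, ?_, by
    have : 0 ≤ ∑' n, w n := tsum_nonneg hw0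
    positivity, ?_⟩
  · refine monotone_nat_of_le_succ fun j => ?_
    cases j with
    | zero => exact Finset.empty_subset _
    | succ i => exact hGmono (hφ.monotone (Nat.le_succ i))
  · intro j
    cases j with
    | zero => exact Finset.notMem_empty _
    | succ i => exact fun h => ((hGmem _ _).1 h).1 rfl
  · intro j n hn
    cases j with
    | zero => exact absurd hn (Finset.notMem_empty _)
    | succ i =>
      have := (hGmem _ _).1 hn
      refine (hGmem _ _).2 ⟨neg_ne_zero.2 this.1, fun l => ?_⟩
      have := this.2 l
      rw [Pi.neg_apply]
      omega
  · intro n hn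
    have h1 := hφ.tendsto_atTop.eventually (hGex n hn)
    obtain ⟨N, hN⟩ := eventually_atTop.1 h1
    refine eventually_atTop.2 ⟨N + 1, fun j hj => ?_⟩
    obtain ⟨i, rfl⟩ : ∃ i, j = i + 1 := ⟨j - 1, by omega⟩
    exact hN i (by omega)
  · intro j
    have hpos : 0 ≤ ∑' n, w n := tsum_nonneg hw0
    cases j with
    | zero =>
      have := hw.sum_le_tsum (F (0 + 1) \ F 0) fun n _ => hw0 n
      simp only [pow_zero, mul_one]
      linarith
    | succ i =>
      have h1 := hS i (F (i + 1 + 1) \ F (i + 1)) (by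
        rw [Finset.disjoint_left]
        intro n hn hnS
        rw [Finset.mem_sdiff] at hn
        exact hn.2 (hφS i (Finset.mem_erase.2 ⟨((hGmem _ _).1 hn.1).1, hnS⟩)))
      rw [Real.norm_eq_abs] at h1
      have h2 := (le_abs_self _).trans h1.le
      have h3 : (0 : ℝ) < (1 / 4) ^ i := by positivity
      rw [pow_succ]
      nlinarith

/-- The Fourier series without zero mode, summed over the blocks of an exhaustion. -/
noncomputable def modeSeries (a : (Fin d → ℤ) → ℂ) (F : ℕ → Finset (Fin d → ℤ))
    (b : (Fin d → ℤ) → ℝ≥0 → ℂ) (z : ℝ × EuclideanSpace ℝ (Fin d)) : ℝ :=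
  ∑' j, modeSum a (F (j + 1) \ F j) b z

/-- The blocks of the Fourier series decay geometrically, uniformly in space and locally uniformly
in time. -/
def HasBlockDecay (α : ℝ) (a : (Fin d → ℤ) → ℂ) (F : ℕ → Finset (Fin d → ℤ))
    (b : (Fin d → ℤ) → ℝ≥0 → ℂ) : Prop :=
  ∃ A : ℝ, 0 ≤ A ∧ ∀ j t x, |modeSum a (F (j + 1) \ F j) b (t, x)| ≤ A * √|t| ^ α * √(1 / 2) ^ j

lemma modeSum_of_nonpos (a : (Fin d → ℤ) → ℂ) (F : Finset (Fin d → ℤ))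
    (b : (Fin d → ℤ) → ℝ≥0 → ℂ) {t : ℝ} (ht : t ≤ 0) (x : EuclideanSpace ℝ (Fin d)) :
    modeSum a F b (t, x) = 0 := by
  simp [modeSum, heatMode_of_nonpos _ _ ht]

lemma sqrt_half_lt_one : √(1 / 2 : ℝ) < 1 := by
  rw [Real.sqrt_lt' one_pos]; norm_num

lemma HasBlockDecay.summable_bound (A : ℝ) : Summable fun j : ℕ => A * √(1 / 2 : ℝ) ^ j :=
  (summable_geometric_of_lt_one (Real.sqrt_nonneg _) sqrt_half_lt_one).mul_left A

variable {α : ℝ} {a : (Fin d → ℤ) → ℂ} {F : ℕ → Finset (Fin d → ℤ)} {b : (Fin d → ℤ) → ℝ≥0 → ℂ}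

lemma HasBlockDecay.summable (h : HasBlockDecay α a F b) (z : ℝ × EuclideanSpace ℝ (Fin d)) :
    Summable fun j => modeSum a (F (j + 1) \ F j) b z := by
  obtain ⟨A, _, hA⟩ := h
  exact Summable.of_norm_bounded (HasBlockDecay.summable_bound (A * √|z.1| ^ α))
    fun j => hA j z.1 z.2

lemma modeSum_eq_sum_blocks (hF0 : F 0 = ∅) (hF : Monotone F) (j : ℕ)
    (z : ℝ × EuclideanSpace ℝ (Fin d)) :
    modeSum a (F j) b z = ∑ i ∈ Finset.range j, modeSum a (F (i + 1) \ F i) b z := by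
  induction j with
  | zero => simp [hF0, modeSum]
  | succ j ih =>
    rw [Finset.sum_range_succ, ← ih]
    simp only [modeSum]
    rw [← Complex.add_re]
    refine congrArg Complex.re ?_
    exact (Finset.sum_sdiff (hF (Nat.le_succ j))).symm.trans (add_comm _ _)

lemma HasBlockDecay.tendsto (h : HasBlockDecay α a F b) (hF0 : F 0 = ∅) (hF : Monotone F)
    (z : ℝ × EuclideanSpace ℝ (Fin d)) :
    Tendsto (fun j => modeSum a (F j) b z) atTop (𝓝 (modeSeries a F b z)) := by
  simp_rw [modeSum_eq_sum_blocks hF0 hF]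
  exact (h.summable z).hasSum.tendsto_sum_nat

lemma HasBlockDecay.continuous (h : HasBlockDecay α a F b) (hα : 0 ≤ α)
    (hb : ∀ n, Continuous (b n)) : Continuous (modeSeries a F b) := by
  obtain ⟨A, hA0, hA⟩ := h
  refine continuous_iff_continuousAt.2 fun z => ?_
  set R := |z.1| + 1 with hR
  have hopen : IsOpen {w : ℝ × EuclideanSpace ℝ (Fin d) | |w.1| < R} :=
    isOpen_lt (by fun_prop) continuous_const
  have hon : ContinuousOn (modeSeries a F b) {w | |w.1| < R} := by
    refine continuousOn_tsum (fun j => (isPeriodicHeatFlow_modeSum a _ hb).continuous.continuousOn)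
      (HasBlockDecay.summable_bound (A * √R ^ α)) fun j w hw => (hA j w.1 w.2).trans ?_
    have : √|w.1| ^ α ≤ √R ^ α :=
      Real.rpow_le_rpow (Real.sqrt_nonneg _) (Real.sqrt_le_sqrt (le_of_lt hw)) hα
    gcongr
  exact hon.continuousAt (hopen.mem_nhds (by simp [hR]))

/-- The Fourier coefficients of the field. -/
noncomputable def fieldCoeff (Khat : (Fin d → ℤ) → ℝ) (n : Fin d → ℤ) : ℂ := (√(Khat n) : ℂ)

/-- The Fourier coefficients of the `i`-th partial derivative of the field. -/
noncomputable def gradCoeff (Khat : (Fin d → ℤ) → ℝ) (i : Fin d) (n : Fin d → ℤ) : ℂ :=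
  (√(Khat n) : ℂ) * Complex.I * (waveVector n i : ℂ)

/-- The candidate for the spatial gradient, as a vector of Fourier series. -/
noncomputable def gradSeries (Khat : (Fin d → ℤ) → ℝ) (F : ℕ → Finset (Fin d → ℤ))
    (b : (Fin d → ℤ) → ℝ≥0 → ℂ) (z : ℝ × EuclideanSpace ℝ (Fin d)) : EuclideanSpace ℝ (Fin d) :=
  WithLp.toLp 2 fun i => modeSeries (gradCoeff Khat i) F b z

lemma hasGradientAt_modeSum (Khat : (Fin d → ℤ) → ℝ) (S : Finset (Fin d → ℤ))
    (b : (Fin d → ℤ) → ℝ≥0 → ℂ) (t : ℝ) (x : EuclideanSpace ℝ (Fin d)) :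
    HasGradientAt (fun x => modeSum (fieldCoeff Khat) S b (t, x))
      (WithLp.toLp 2 fun i => modeSum (gradCoeff Khat i) S b (t, x)) x := by
  rw [hasGradientAt_iff_hasFDerivAt]
  have h1 : ∀ n : Fin d → ℤ, HasFDerivAt (fun x : EuclideanSpace ℝ (Fin d) =>
      fieldCoeff Khat n * Complex.exp (Complex.I * (inner ℝ (waveVector n) x : ℝ)) *
        heatMode (‖waveVector n‖ ^ 2) (b n) t)
      ((innerSL ℝ (waveVector n)).smulRight (fieldCoeff Khat n * Complex.I *
        Complex.exp (Complex.I * (inner ℝ (waveVector n) x : ℝ)) *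
        heatMode (‖waveVector n‖ ^ 2) (b n) t)) x := fun n => by
    have e1 : HasFDerivAt (fun x : EuclideanSpace ℝ (Fin d) => (inner ℝ (waveVector n) x : ℝ))
        (innerSL ℝ (waveVector n)) x := (innerSL ℝ (waveVector n)).hasFDerivAt
    have e2 : HasDerivAt (fun r : ℝ => fieldCoeff Khat n * Complex.exp (Complex.I * (r : ℂ)) *
        heatMode (‖waveVector n‖ ^ 2) (b n) t) (fieldCoeff Khat n *
        (Complex.exp (Complex.I * (inner ℝ (waveVector n) x : ℝ)) * (Complex.I * 1)) *
        heatMode (‖waveVector n‖ ^ 2) (b n) t) (inner ℝ (waveVector n) x : ℝ) :=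
      ((((hasDerivAt_id _).ofReal_comp.const_mul Complex.I).cexp).const_mul _).mul_const _
    refine (e2.hasFDerivAt.comp x e1).congr_fderiv ?_
    ext y
    simp only [ContinuousLinearMap.comp_apply, ContinuousLinearMap.smulRight_apply,
      ContinuousLinearMap.toSpanSingleton_apply, Complex.real_smul, mul_one]
    ring
  have h2 := HasFDerivAt.fun_sum (u := S) fun n _ => h1 n
  have h3 := (Complex.reCLM.hasFDerivAt (x := ∑ n ∈ S, fieldCoeff Khat n *
    Complex.exp (Complex.I * (inner ℝ (waveVector n) x : ℝ)) *
        heatMode (‖waveVector n‖ ^ 2) (b n) t)).comp x h2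
  refine h3.congr_fderiv ?_
  ext y
  simp only [ContinuousLinearMap.comp_apply, sum_apply,
    ContinuousLinearMap.smulRight_apply, innerSL_apply_apply, Complex.reCLM_apply,
    InnerProductSpace.toDual_apply_apply, Complex.re_sum, Complex.real_smul, Complex.re_ofReal_mul,
    PiLp.inner_apply, RCLike.inner_apply, conj_trivial, modeSum, Finset.mul_sum, Finset.sum_mul]
  rw [Finset.sum_comm]
  refine Finset.sum_congr rfl fun i _ => Finset.sum_congr rfl fun n _ => ?_
  have e : gradCoeff Khat i n = (waveVector n i : ℂ) * (fieldCoeff Khat n * Complex.I) := by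
    rw [gradCoeff, fieldCoeff]; ring
  rw [e, mul_assoc (y.ofLp i), ← Complex.re_ofReal_mul]
  congr 2
  ring

lemma hasGradientAt_modeSeries {Khat : (Fin d → ℤ) → ℝ}
    (h0 : HasBlockDecay α (fieldCoeff Khat) F b)
    (hgrad : ∀ i, HasBlockDecay α (gradCoeff Khat i) F b) (t : ℝ) (x : EuclideanSpace ℝ (Fin d)) :
    HasGradientAt (fun x => modeSeries (fieldCoeff Khat) F b (t, x))
      (gradSeries Khat F b (t, x)) x := by
  choose A hA0 hA using hgrad
  set A' := ∑ i, A i with hA'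
  have hAi : ∀ i, A i ≤ A' := fun i =>
    Finset.single_le_sum (f := A) (fun i _ => hA0 i) (Finset.mem_univ i)
  have hbound : ∀ j (x : EuclideanSpace ℝ (Fin d)), ‖(WithLp.toLp 2 fun i =>
      modeSum (gradCoeff Khat i) (F (j + 1) \ F j) b (t, x) : EuclideanSpace ℝ (Fin d))‖
      ≤ (d * (A' * √|t| ^ α)) * √(1 / 2) ^ j := fun j x => by
    rw [mul_assoc]
    refine EuclideanSpace.norm_le_of_forall_abs_le fun i => (hA i j t x).trans ?_
    have := hAi i
    gcongr
  have hsum := HasBlockDecay.summable_bound (d * (A' * √|t| ^ α))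
  have hmain := hasFDerivAt_tsum (𝕜 := ℝ) hsum
    (f := fun j x => modeSum (fieldCoeff Khat) (F (j + 1) \ F j) b (t, x))
    (fun j x => (hasGradientAt_iff_hasFDerivAt.1 (hasGradientAt_modeSum Khat _ b t x)))
    (fun j x => by rw [LinearIsometryEquiv.norm_map]; exact hbound j x)
    (x₀ := 0) (h0.summable (t, 0)) x
  rw [hasGradientAt_iff_hasFDerivAt]
  refine hmain.congr_fderiv ?_
  have hs : Summable fun j => (WithLp.toLp 2 fun i =>
      modeSum (gradCoeff Khat i) (F (j + 1) \ F j) b (t, x) : EuclideanSpace ℝ (Fin d)) :=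
    Summable.of_norm_bounded hsum fun j => hbound j x
  have e : gradSeries Khat F b (t, x) = ∑' j, (WithLp.toLp 2 fun i =>
      modeSum (gradCoeff Khat i) (F (j + 1) \ F j) b (t, x) : EuclideanSpace ℝ (Fin d)) := by
    ext i
    have := (EuclideanSpace.proj (𝕜 := ℝ) i).map_tsum hs
    exact this.symm
  rw [e]
  exact ((InnerProductSpace.toDual ℝ
    (EuclideanSpace ℝ (Fin d))).toContinuousLinearEquiv.map_tsum).symm

end Series

/-! ### Geometric decay of the blocks and mean square convergence -/

section Convergence

variable {d : ℕ} {Ω : Type*} [MeasurableSpace Ω] {P : Measure Ω} {β : (Fin d → ℤ) → ℝ≥0 → Ω → ℂ}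
  {B : Ω → (Fin d → ℤ) → ℝ≥0 → ℂ}

/-- The coefficients `a` produce increments that are dominated by the weight `w` at Hölder
exponent `θ`. -/
def IsDominatedBy (θ : ℝ) (w : (Fin d → ℤ) → ℝ) (a : (Fin d → ℤ) → ℂ) : Prop :=
  ∀ n, n ≠ 0 → ‖a n‖ ^ 2 * (‖waveVector n‖ ^ θ) ^ 2 / ‖waveVector n‖ ^ 2 ≤ w n

lemma IsDominatedBy.sum_le {θ : ℝ} {w : (Fin d → ℤ) → ℝ} {a : (Fin d → ℤ) → ℂ}
    (ha : IsDominatedBy θ w a) {F : Finset (Fin d → ℤ)} (hF : 0 ∉ F) :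
    44 * ∑ n ∈ F, ‖a n‖ ^ 2 * (‖waveVector n‖ ^ θ) ^ 2 / ‖waveVector n‖ ^ 2
      ≤ 44 * ∑ n ∈ F, w n := by
  gcongr with n hn
  exact ha n fun h => hF (h ▸ hn)

lemma isDominatedBy_fieldCoeff {Khat : (Fin d → ℤ) → ℝ} {s θ : ℝ} (hK0 : ∀ n, 0 ≤ Khat n)
    (hK : ∀ n, Khat n ≤ (1 + ‖waveVector n‖ ^ 2) ^ (-s / 2)) :
    IsDominatedBy θ (latticeWeight s θ) (fieldCoeff Khat) := by
  intro n hn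
  have hk := one_le_norm_waveVector hn
  rw [fieldCoeff, Complex.norm_real, Real.norm_of_nonneg (Real.sqrt_nonneg _), Real.sq_sqrt (hK0 n)]
  refine (div_le_self (mul_nonneg (hK0 n) (sq_nonneg _)) (one_le_pow₀ hk)).trans ?_
  rw [latticeWeight]
  gcongr
  exact hK n

lemma isDominatedBy_gradCoeff {Khat : (Fin d → ℤ) → ℝ} {s θ : ℝ} (hK0 : ∀ n, 0 ≤ Khat n)
    (hK : ∀ n, Khat n ≤ (1 + ‖waveVector n‖ ^ 2) ^ (-s / 2)) (i : Fin d) :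
    IsDominatedBy θ (latticeWeight s θ) (gradCoeff Khat i) := by
  intro n hn
  have hk := one_le_norm_waveVector hn
  have hk0 : 0 < ‖waveVector n‖ ^ 2 := by positivity
  rw [gradCoeff, norm_mul, norm_mul, Complex.norm_real, Complex.norm_I, mul_one, Complex.norm_real,
    Real.norm_of_nonneg (Real.sqrt_nonneg _), mul_pow, Real.sq_sqrt (hK0 n), div_le_iff₀ hk0,
    latticeWeight]
  have h1 : ‖(waveVector n) i‖ ^ 2 ≤ ‖waveVector n‖ ^ 2 := by
    gcongr
    exact PiLp.norm_apply_le (waveVector n) i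
  calc Khat n * ‖(waveVector n) i‖ ^ 2 * (‖waveVector n‖ ^ θ) ^ 2
      ≤ (1 + ‖waveVector n‖ ^ 2) ^ (-s / 2) * ‖waveVector n‖ ^ 2 * (‖waveVector n‖ ^ θ) ^ 2 := by
        gcongr
        exact hK n
    _ = _ := by ring

variable {s θ α : ℝ} {a : (Fin d → ℤ) → ℂ} {w : (Fin d → ℤ) → ℝ}

/-- The comparison with time `0`, where all modes vanish, bounds the modes themselves. The maximal
variables of the blocks have bounded expectation, so that the geometric decay of the variance
proxies gives almost sure geometric decay of the corresponding random functions. -/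
lemma IsContinuousVersion.ae_hasBlockDecay [IsProbabilityMeasure P]
    (hβ : IsConjSymmBrownianFamily P β) (hB : IsContinuousVersion P β B) (hα : 0 < α) (hαθ : α < θ)
    (hθ : θ ≤ 1) (ha : IsDominatedBy θ w a) {F : ℕ → Finset (Fin d → ℤ)} {A : ℝ}
    (hF : IsBlockExhaustion w F A) : ∀ᵐ ω ∂P, HasBlockDecay α a F (B ω) := by
  obtain ⟨C, hC, K, hK, H⟩ := exists_exp_moment_holder d hα (hαθ.le.trans hθ) hαθ
  have hA := hF.pos
  have hFD : ∀ j, 0 ∉ F (j + 1) \ F j := fun j h => hF.zero_notMem (j + 1) (Finset.mem_sdiff.1 h).1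
  choose M hMm hMint hM using fun j : ℕ => H Ω P (fun ω => modeSum a (F (j + 1) \ F j) (B ω))
    (fun z => hB.measurable_modeSum a _ z)
    (fun ω => isPeriodicHeatFlow_modeSum a _ (hB.continuous ω)) (44 * (A * (1 / 4) ^ j))
    (by positivity)
    (fun z z' hz hz' => hB.hasSubgaussianMGF_modeSum_sub hβ (hFD j) (hα.trans hαθ).le hθ
      ((ha.sum_le (hFD j)).trans (by linarith [hF.sum_le j])) z z' hz hz')
  have hfin : ∫⁻ ω, ∑' j, ENNReal.ofReal ((1 / 2) ^ j) * M j ω ∂P ≠ ∞ := by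
    rw [lintegral_tsum fun j => ((hMm j).const_mul _).aemeasurable]
    have h1 : ∀ j, ∫⁻ ω, ENNReal.ofReal ((1 / 2) ^ j) * M j ω ∂P
        ≤ ENNReal.ofReal ((1 / 2) ^ j) * K := fun j => by
      rw [lintegral_const_mul _ (hMm j)]
      gcongr
      exact hMint j
    refine ne_top_of_le_ne_top ?_ (ENNReal.tsum_le_tsum h1)
    rw [ENNReal.tsum_mul_right, ← ENNReal.ofReal_tsum_of_nonneg (fun _ => by positivity)
      summable_geometric_two]
    exact ENNReal.mul_ne_top ENNReal.ofReal_ne_top hK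
  have hlt := ae_lt_top (Measurable.tsum fun j => (hMm j).const_mul _) hfin
  filter_upwards [hlt] with ω hω
  set T := ∑' j, ENNReal.ofReal ((1 / 2) ^ j) * M j ω with hT
  refine ⟨√(44 * A * C * T.toReal), Real.sqrt_nonneg _, fun j t x => ?_⟩
  have h0 : modeSum a (F (j + 1) \ F j) (B ω) (0, x) = 0 := modeSum_of_nonpos _ _ _ le_rfl x
  rcases eq_or_ne t 0 with rfl | ht
  · rw [h0, abs_zero]; positivity
  have hδ : parabolicDist (t, x) ((0 : ℝ), x) = √|t| := by simp [parabolicDist]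
  have hst : 0 < √|t| ^ α := by
    have := abs_pos.2 ht
    positivity
  have h1 := hM j ω (t, x) (0, x)
  rw [hδ, h0, sub_zero] at h1
  set X := modeSum a (F (j + 1) \ F j) (B ω) (t, x) with hX
  have h2 : ENNReal.ofReal ((1 / 2) ^ j * Real.exp (X ^ 2 /
      (C * (44 * (A * (1 / 4) ^ j)) * (√|t| ^ α) ^ 2))) ≤ T := by
    rw [ENNReal.ofReal_mul (by positivity)]
    refine le_trans ?_ (ENNReal.le_tsum j)
    gcongr
  rw [ENNReal.ofReal_le_iff_le_toReal hω.ne] at h2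
  set y := X ^ 2 / (C * (44 * (A * (1 / 4) ^ j)) * (√|t| ^ α) ^ 2) with hy
  have h3 : (1 / 2 : ℝ) ^ j * y ≤ T.toReal := by
    refine le_trans ?_ h2
    gcongr
    linarith [Real.add_one_le_exp y]
  refine abs_le_of_sq_le_sq ?_ (by positivity)
  rw [mul_pow, mul_pow, Real.sq_sqrt (by positivity), ← pow_mul, mul_comm j 2, pow_mul,
    Real.sq_sqrt (by norm_num)]
  have h4 : X ^ 2 = y * (C * (44 * (A * (1 / 4) ^ j)) * (√|t| ^ α) ^ 2) := by
    rw [hy]; field_simp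
  have h5 : ((1 : ℝ) / 4) ^ j = (1 / 2) ^ j * (1 / 2) ^ j := by rw [← mul_pow]; norm_num
  rw [h4, h5]
  calc y * (C * (44 * (A * ((1 / 2) ^ j * (1 / 2) ^ j))) * (√|t| ^ α) ^ 2)
      = ((1 / 2) ^ j * y) * (44 * A * C * (√|t| ^ α) ^ 2 * (1 / 2) ^ j) := by ring
    _ ≤ T.toReal * (44 * A * C * (√|t| ^ α) ^ 2 * (1 / 2) ^ j) := by gcongr
    _ = _ := by ring

lemma modeSum_eq_clamp (a : (Fin d → ℤ) → ℂ) (F : Finset (Fin d → ℤ))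
    (b : (Fin d → ℤ) → ℝ≥0 → ℂ) (t : ℝ) (x : EuclideanSpace ℝ (Fin d)) :
    modeSum a F b (t, x) = modeSum (fun n => a n *
      Real.exp (-(‖waveVector n‖ ^ 2 * max 0 (t - 1)))) F b (max 0 (min t 1), x) := by
  simp only [modeSum]
  congr 1
  refine Finset.sum_congr rfl fun n _ => ?_
  rw [heatMode_eq_clamp _ _ t, Complex.real_smul]
  ring

/-- Second moments of mode sums, at any time. -/
lemma IsContinuousVersion.lintegral_modeSum_sq_le [IsProbabilityMeasure P]
    (hβ : IsConjSymmBrownianFamily P β) (hB : IsContinuousVersion P β B) (hθ0 : 0 ≤ θ)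
    (hθ : θ ≤ 1) (ha : IsDominatedBy θ w a) {F : Finset (Fin d → ℤ)} (hF : 0 ∉ F) (t : ℝ)
    (x : EuclideanSpace ℝ (Fin d)) :
    ∫⁻ ω, ENNReal.ofReal (modeSum a F (B ω) (t, x) ^ 2) ∂P
      ≤ ENNReal.ofReal (352 * ∑ n ∈ F, w n) := by
  set a' : (Fin d → ℤ) → ℂ := fun n => a n * Real.exp (-(‖waveVector n‖ ^ 2 * max 0 (t - 1)))
    with ha'
  have hdom : IsDominatedBy θ w a' := fun n hn => by
    refine le_trans ?_ (ha n hn)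
    have h1 : ‖a' n‖ ≤ ‖a n‖ := by
      rw [ha']
      simp only
      rw [norm_mul, Complex.norm_real, Real.norm_of_nonneg (Real.exp_pos _).le]
      refine mul_le_of_le_one_right (norm_nonneg _) (Real.exp_le_one_iff.2 (neg_nonpos.2 ?_))
      exact mul_nonneg (sq_nonneg _) (le_max_left _ _)
    gcongr
  have hw0 : 0 ≤ ∑ n ∈ F, w n := Finset.sum_nonneg fun n hn =>
    le_trans (by positivity) (ha n fun h => hF (h ▸ hn))
  have hmem : max 0 (min t 1) ∈ Set.Icc (0 : ℝ) 1 :=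
    ⟨le_max_left _ _, max_le zero_le_one (min_le_right _ _)⟩
  have h1 := hB.hasSubgaussianMGF_modeSum_sub hβ hF hθ0 hθ (hdom.sum_le hF)
    (max 0 (min t 1), x) (0, x) hmem ⟨le_rfl, zero_le_one⟩
  have hδ : parabolicDist (max 0 (min t 1), x) ((0 : ℝ), x) = √(max 0 (min t 1)) := by
    simp [parabolicDist, abs_of_nonneg hmem.1]
  have hδ1 : (√(max 0 (min t 1)) ^ θ) ^ 2 ≤ 1 :=
    pow_le_one₀ (by positivity) (Real.rpow_le_one (Real.sqrt_nonneg _)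
      (Real.sqrt_le_one.2 hmem.2) hθ0)
  have h2 : HasSubgaussianMGF (fun ω => modeSum a F (B ω) (t, x))
      (44 * ∑ n ∈ F, w n).toNNReal P := by
    refine HasSubgaussianMGF.mono (h1.congr (ae_of_all _ fun ω => ?_)) ?_
    · simp only
      rw [modeSum_of_nonpos _ _ _ le_rfl, sub_zero, modeSum_eq_clamp a F (B ω) t x]
    · rw [hδ]
      exact Real.toNNReal_le_toNNReal (mul_le_of_le_one_right (by positivity) hδ1)
  refine (h2.lintegral_sq_le (by positivity)).trans_eq ?_
  congr 1
  ring

/-- The random field as the sum of its zero mode and of the remaining Fourier series. -/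
noncomputable def heatField (Khat : (Fin d → ℤ) → ℝ) (F : ℕ → Finset (Fin d → ℤ))
    (b : (Fin d → ℤ) → ℝ≥0 → ℂ) (z : ℝ × EuclideanSpace ℝ (Fin d)) : ℝ :=
  modeSum (fieldCoeff Khat) {0} b z + modeSeries (fieldCoeff Khat) F b z

/-- The symmetry constraint makes Fourier sums over symmetric sets real. -/
lemma ofReal_modeSum_of_symm {Khat : (Fin d → ℤ) → ℝ} (hKs : ∀ n, Khat (-n) = Khat n)
    {b : (Fin d → ℤ) → ℝ≥0 → ℂ} (hb : ∀ n t, b (-n) t = starRingEnd ℂ (b n t))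
    {F : Finset (Fin d → ℤ)} (hF : ∀ n ∈ F, -n ∈ F) (z : ℝ × EuclideanSpace ℝ (Fin d)) :
    (modeSum (fieldCoeff Khat) F b z : ℂ) = ∑ n ∈ F, fieldCoeff Khat n *
      Complex.exp (Complex.I * (inner ℝ (waveVector n) z.2 : ℝ)) *
        heatMode (‖waveVector n‖ ^ 2) (b n) z.1 := by
  rw [modeSum]
  refine Complex.conj_eq_iff_re.1 ?_
  rw [map_sum]
  refine Finset.sum_nbij' (fun n => -n) (fun n => -n) hF hF (fun _ _ => neg_neg _)
    (fun _ _ => neg_neg _) fun n _ => ?_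
  have hbn : b (-n) = fun t => starRingEnd ℂ (b n t) := funext (hb n)
  rw [map_mul, map_mul, hbn, heatMode_conj, norm_waveVector_neg, waveVector_neg, inner_neg_left,
    ← Complex.exp_conj, map_mul, Complex.conj_I, Complex.conj_ofReal]
  congr 2
  · simp [fieldCoeff, hKs]
  · push_cast
    ring_nf

/-- Mean square convergence of the full Fourier series to the random field, with a rate given by the
tail of the weights. -/
lemma IsContinuousVersion.lintegral_heatField_sub_le [IsProbabilityMeasure P]
    (hβ : IsConjSymmBrownianFamily P β) (hB : IsContinuousVersion P β B) {Khat : (Fin d → ℤ) → ℝ}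
    (hKs : ∀ n, Khat (-n) = Khat n) (hθ0 : 0 ≤ θ) (hθ : θ ≤ 1)
    (ha : IsDominatedBy θ w (fieldCoeff Khat)) (hw0 : ∀ n, 0 ≤ w n) (hw : Summable w)
    {F : ℕ → Finset (Fin d → ℤ)} {A : ℝ} (hF : IsBlockExhaustion w F A)
    (hdecay : ∀ᵐ ω ∂P, HasBlockDecay α (fieldCoeff Khat) F (B ω)) (t : ℝ)
    (x : EuclideanSpace ℝ (Fin d)) {S : Finset (Fin d → ℤ)} (hS : 0 ∈ S) :
    ∫⁻ ω, ENNReal.ofReal (‖(heatField Khat F (B ω) (t, x) : ℂ) - ∑ n ∈ S, fieldCoeff Khat n *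
        Complex.exp (Complex.I * (inner ℝ (waveVector n) x : ℝ)) *
          heatMode (‖waveVector n‖ ^ 2) (B ω n) t‖ ^ 2) ∂P
      ≤ ENNReal.ofReal (704 * (∑' n, w n - ∑ n ∈ S, w n)) := by
  classical
  set c : Ω → (Fin d → ℤ) → ℂ := fun ω n => fieldCoeff Khat n *
    Complex.exp (Complex.I * (inner ℝ (waveVector n) x : ℝ)) *
      heatMode (‖waveVector n‖ ^ 2) (B ω n) t with hc
  -- the squared norm of a partial sum over the modes outside `S`; the factor `-I` turns the
  -- imaginary part into a real part
  set Y : ℕ → Ω → ℝ := fun j ω => modeSum (fieldCoeff Khat) (F j \ S) (B ω) (t, x) ^ 2 +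
    modeSum (fun n => -Complex.I * fieldCoeff Khat n) (F j \ S) (B ω) (t, x) ^ 2 with hY
  have hYnorm : ∀ j ω, Y j ω = ‖∑ n ∈ F j \ S, c ω n‖ ^ 2 := fun j ω => by
    rw [← Complex.normSq_eq_norm_sq, Complex.normSq_apply, hY]
    simp only [modeSum]
    have h1 : (∑ n ∈ F j \ S, -Complex.I * fieldCoeff Khat n *
        Complex.exp (Complex.I * (inner ℝ (waveVector n) x : ℝ)) *
          heatMode (‖waveVector n‖ ^ 2) (B ω n) t) = -Complex.I * ∑ n ∈ F j \ S, c ω n := by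
      rw [Finset.mul_sum]
      exact Finset.sum_congr rfl fun n _ => by simp only [hc]; ring
    rw [h1]
    have h2 : (-Complex.I * ∑ n ∈ F j \ S, c ω n).re = (∑ n ∈ F j \ S, c ω n).im := by simp
    rw [h2]
    simp only [hc]
    ring
  have hdom' : IsDominatedBy θ w fun n => -Complex.I * fieldCoeff Khat n := fun n hn => by
    rw [norm_mul, norm_neg, Complex.norm_I, one_mul]
    exact ha n hn
  have hlim : ∀ᵐ ω ∂P, Tendsto (fun j => ENNReal.ofReal (Y j ω)) atTop
      (𝓝 (ENNReal.ofReal (‖(heatField Khat F (B ω) (t, x) : ℂ) - ∑ n ∈ S, c ω n‖ ^ 2))) := by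
    filter_upwards [hdecay] with ω hω
    refine ENNReal.tendsto_ofReal ?_
    have h1 : Tendsto (fun j => ‖((modeSum (fieldCoeff Khat) {0} (B ω) (t, x) +
        modeSum (fieldCoeff Khat) (F j) (B ω) (t, x) : ℝ) : ℂ) - ∑ n ∈ S, c ω n‖ ^ 2) atTop
        (𝓝 (‖(heatField Khat F (B ω) (t, x) : ℂ) - ∑ n ∈ S, c ω n‖ ^ 2)) := by
      have h2 := (hω.tendsto hF.zero hF.mono (t, x)).const_add
        (modeSum (fieldCoeff Khat) {0} (B ω) (t, x))
      exact ((((Complex.continuous_ofReal.tendsto _).comp h2).sub_const _).norm).pow 2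
    refine h1.congr' ?_
    have hev : ∀ᶠ j in atTop, ∀ n ∈ S.erase 0, n ∈ F j :=
      (Finset.eventually_all _).2 fun n hn => hF.exhaust n (Finset.ne_of_mem_erase hn)
    filter_upwards [hev] with j hj
    rw [hYnorm]
    have h3 : modeSum (fieldCoeff Khat) {0} (B ω) (t, x) +
          modeSum (fieldCoeff Khat) (F j) (B ω) (t, x)
        = modeSum (fieldCoeff Khat) (insert 0 (F j)) (B ω) (t, x) := by
      simp only [modeSum]
      rw [Finset.sum_insert (hF.zero_notMem j), Finset.sum_singleton, Complex.add_re]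
    have hsymm : ∀ n ∈ insert 0 (F j), -n ∈ insert 0 (F j) := fun n hn => by
      rcases Finset.mem_insert.1 hn with rfl | h
      · simp
      · exact Finset.mem_insert_of_mem (hF.neg_mem j n h)
    have hsub : S ⊆ insert 0 (F j) := fun n hn => by
      by_cases h : n = 0
      · exact h ▸ Finset.mem_insert_self _ _
      · exact Finset.mem_insert_of_mem (hj n (Finset.mem_erase.2 ⟨h, hn⟩))
    rw [h3, ofReal_modeSum_of_symm hKs (hB.conj_symm ω) hsymm]
    change ‖∑ n ∈ insert 0 (F j), c ω n - ∑ n ∈ S, c ω n‖ ^ 2 = _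
    rw [← Finset.sum_sdiff hsub, add_sub_cancel_right, Finset.insert_sdiff_of_mem _ hS]
  have hYint : ∀ j, ∫⁻ ω, ENNReal.ofReal (Y j ω) ∂P
      ≤ ENNReal.ofReal (704 * (∑' n, w n - ∑ n ∈ S, w n)) := fun j => by
    have h0 : 0 ∉ F j \ S := fun h => hF.zero_notMem j (Finset.mem_sdiff.1 h).1
    have e1 := hB.lintegral_modeSum_sq_le hβ hθ0 hθ ha h0 t x
    have e2 := hB.lintegral_modeSum_sq_le hβ hθ0 hθ hdom' h0 t x
    have hm := hB.measurable_modeSum (fieldCoeff Khat) (F j \ S) (t, x)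
    simp only [hY]
    simp_rw [ENNReal.ofReal_add (sq_nonneg _) (sq_nonneg _)]
    rw [lintegral_add_left (by fun_prop)]
    have hsum0 : 0 ≤ ∑ n ∈ F j \ S, w n := Finset.sum_nonneg fun n _ => hw0 n
    refine (add_le_add e1 e2).trans ?_
    rw [← ENNReal.ofReal_add (by positivity) (by positivity)]
    refine ENNReal.ofReal_le_ofReal ?_
    have h2 := hw.sum_le_tsum ((F j \ S) ∪ S) fun n _ => hw0 n
    rw [Finset.sum_union Finset.sdiff_disjoint] at h2
    linarith
  have hYm : ∀ j, Measurable fun ω => ENNReal.ofReal (Y j ω) := fun j => by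
    have hm := hB.measurable_modeSum (fieldCoeff Khat) (F j \ S) (t, x)
    have hm' := hB.measurable_modeSum (fun n => -Complex.I * fieldCoeff Khat n) (F j \ S) (t, x)
    simp only [hY]
    fun_prop
  calc _ = ∫⁻ ω, liminf (fun j => ENNReal.ofReal (Y j ω)) atTop ∂P :=
        lintegral_congr_ae (hlim.mono fun ω hω => hω.liminf_eq.symm)
    _ ≤ liminf (fun j => ∫⁻ ω, ENNReal.ofReal (Y j ω) ∂P) atTop := lintegral_liminf_le hYm
    _ ≤ _ := liminf_le_of_le (by isBoundedDefault) fun b hb =>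
        let ⟨N, hN⟩ := hb.exists
        hN.trans (hYint N)

end Convergence

/-! ### Existence and uniqueness of the field -/

section Field

variable {d : ℕ} {Ω : Type*} [MeasurableSpace Ω] {P : Measure Ω} {β : (Fin d → ℤ) → ℝ≥0 → Ω → ℂ}
  {B : Ω → (Fin d → ℤ) → ℝ≥0 → ℂ} {w : (Fin d → ℤ) → ℝ} {θ α : ℝ} {Khat : (Fin d → ℤ) → ℝ}
  {F : ℕ → Finset (Fin d → ℤ)} {A : ℝ}

lemma heatField_of_nonpos (Khat : (Fin d → ℤ) → ℝ) (F : ℕ → Finset (Fin d → ℤ))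
    (b : (Fin d → ℤ) → ℝ≥0 → ℂ) {t : ℝ} (ht : t ≤ 0) (x : EuclideanSpace ℝ (Fin d)) :
    heatField Khat F b (t, x) = 0 := by
  simp [heatField, modeSeries, modeSum_of_nonpos _ _ _ ht]

lemma HasBlockDecay.continuous_heatField {b : (Fin d → ℤ) → ℝ≥0 → ℂ}
    (h : HasBlockDecay α (fieldCoeff Khat) F b) (hα : 0 ≤ α) (hb : ∀ n, Continuous (b n)) :
    Continuous (heatField Khat F b) :=
  (isPeriodicHeatFlow_modeSum _ _ hb).continuous.add (h.continuous hα hb)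

lemma IsContinuousVersion.measurable_modeSeries (hB : IsContinuousVersion P β B)
    (a : (Fin d → ℤ) → ℂ) (F : ℕ → Finset (Fin d → ℤ)) (z : ℝ × EuclideanSpace ℝ (Fin d)) :
    Measurable fun ω => modeSeries a F (B ω) z :=
  Measurable.tsum fun _ => hB.measurable_modeSum a _ z

lemma IsContinuousVersion.measurable_heatField (hB : IsContinuousVersion P β B)
    (z : ℝ × EuclideanSpace ℝ (Fin d)) : Measurable fun ω => heatField Khat F (B ω) z :=
  (hB.measurable_modeSum _ _ z).add (hB.measurable_modeSeries _ F z)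

lemma IsContinuousVersion.aemeasurable_sum_heatFourierTerm (hB : IsContinuousVersion P β B)
    (Khat : (Fin d → ℤ) → ℝ) (t : ℝ) (x : EuclideanSpace ℝ (Fin d)) (S : Finset (Fin d → ℤ)) :
    AEMeasurable (fun ω => ∑ n ∈ S, heatFourierTerm Khat β t x n ω) P := by
  refine AEMeasurable.congr (f := fun ω => ∑ n ∈ S, (√(Khat n) : ℂ) *
    Complex.exp (Complex.I * (inner ℝ (waveVector n) x : ℝ)) *
      heatMode (‖waveVector n‖ ^ 2) (B ω n) t) ?_ ?_
  · refine (Finset.measurable_sum _ fun n _ => ?_).aemeasurable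
    exact (hB.measurable_heatMode (‖waveVector n‖ ^ 2) t n).const_mul _
  · filter_upwards [hB.heatFourierTerm_eq Khat] with ω hω
    simp only [hω]

lemma IsContinuousVersion.tendsto_eLpNorm_heatField_sub [IsProbabilityMeasure P]
    (hβ : IsConjSymmBrownianFamily P β) (hB : IsContinuousVersion P β B)
    (hKs : ∀ n, Khat (-n) = Khat n) (hθ0 : 0 ≤ θ) (hθ : θ ≤ 1)
    (ha : IsDominatedBy θ w (fieldCoeff Khat)) (hw0 : ∀ n, 0 ≤ w n) (hw : Summable w)
    (hF : IsBlockExhaustion w F A)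
    (hdecay : ∀ᵐ ω ∂P, HasBlockDecay α (fieldCoeff Khat) F (B ω)) (t : ℝ)
    (x : EuclideanSpace ℝ (Fin d)) :
    Tendsto (fun S : Finset (Fin d → ℤ) => eLpNorm (fun ω => (heatField Khat F (B ω) (t, x) : ℂ) -
      ∑ n ∈ S, heatFourierTerm Khat β t x n ω) 2 P) atTop (𝓝 0) := by
  have hlim : Tendsto (fun S : Finset (Fin d → ℤ) =>
      ENNReal.ofReal (704 * (∑' n, w n - ∑ n ∈ S, w n)) ^ (1 / 2 : ℝ)) atTop (𝓝 0) := by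
    have h1 : Tendsto (fun S : Finset (Fin d → ℤ) => 704 * (∑' n, w n - ∑ n ∈ S, w n)) atTop
        (𝓝 (704 * (∑' n, w n - ∑' n, w n))) :=
      (Tendsto.const_sub _ hw.hasSum).const_mul _
    rw [sub_self, mul_zero] at h1
    have h2 := (ENNReal.tendsto_ofReal h1).ennrpow_const (1 / 2)
    simpa using h2
  refine tendsto_of_tendsto_of_tendsto_of_le_of_le' tendsto_const_nhds hlim
    (Eventually.of_forall fun _ => zero_le) ?_
  filter_upwards [eventually_ge_atTop {0}] with S hS
  have hS0 : 0 ∈ S := hS (Finset.mem_singleton_self 0)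
  rw [eLpNorm_eq_lintegral_rpow_enorm_toReal (by norm_num) (by norm_num)]
  simp only [ENNReal.toReal_ofNat]
  gcongr
  refine le_trans (le_of_eq ?_)
    (hB.lintegral_heatField_sub_le hβ hKs hθ0 hθ ha hw0 hw hF hdecay t x hS0)
  refine lintegral_congr_ae ?_
  filter_upwards [hB.heatFourierTerm_eq Khat] with ω hω
  simp only [hω]
  rw [← ofReal_norm, ENNReal.ofReal_rpow_of_nonneg (norm_nonneg _) (by norm_num)]
  norm_cast

/-- The Fourier series has a continuous version. -/
lemma IsContinuousVersion.exists_isLinearHeatField [IsProbabilityMeasure P]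
    (hβ : IsConjSymmBrownianFamily P β) (hB : IsContinuousVersion P β B)
    (hKs : ∀ n, Khat (-n) = Khat n) (hθ0 : 0 ≤ θ) (hθ : θ ≤ 1) (hα : 0 ≤ α)
    (ha : IsDominatedBy θ w (fieldCoeff Khat)) (hw0 : ∀ n, 0 ≤ w n) (hw : Summable w)
    (hF : IsBlockExhaustion w F A)
    (hdecay : ∀ᵐ ω ∂P, HasBlockDecay α (fieldCoeff Khat) F (B ω)) :
    IsLinearHeatField P Khat β fun t x ω => heatField Khat F (B ω) (t, x) where
  measurable t x := hB.measurable_heatField (t, x)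
  continuous_paths := by
    filter_upwards [hdecay] with ω hω
    exact hω.continuous_heatField hα (hB.continuous ω)
  zero_of_nonpos := ae_of_all _ fun ω t ht x => heatField_of_nonpos _ _ _ ht x
  fourier_series t _ x :=
    hB.tendsto_eLpNorm_heatField_sub hβ hKs hθ0 hθ ha hw0 hw hF hdecay t x

/-- Two fields with the same Fourier series are indistinguishable. -/
lemma IsLinearHeatField.ae_eq (hB : IsContinuousVersion P β B)
    {v v' : ℝ → EuclideanSpace ℝ (Fin d) → Ω → ℝ} (hv : IsLinearHeatField P Khat β v)
    (hv' : IsLinearHeatField P Khat β v') : ∀ᵐ ω ∂P, ∀ t x, v t x ω = v' t x ω := by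
  have hpt : ∀ z : ℝ × EuclideanSpace ℝ (Fin d), ∀ᵐ ω ∂P, v z.1 z.2 ω = v' z.1 z.2 ω := by
    rintro ⟨t, x⟩
    rcases le_or_gt t 0 with ht | ht
    · filter_upwards [hv.zero_of_nonpos, hv'.zero_of_nonpos] with ω h1 h2
      rw [h1 t ht x, h2 t ht x]
    have hm : ∀ (u : ℝ → EuclideanSpace ℝ (Fin d) → Ω → ℝ), Measurable (u t x) →
        ∀ S : Finset (Fin d → ℤ), AEStronglyMeasurable
          (fun ω => (u t x ω : ℂ) - ∑ n ∈ S, heatFourierTerm Khat β t x n ω) P := fun u hu S =>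
      ((Complex.measurable_ofReal.comp hu).aemeasurable.sub
        (hB.aemeasurable_sum_heatFourierTerm Khat t x S)).aestronglyMeasurable
    have hlim := (hv.fourier_series t ht x).add (hv'.fourier_series t ht x)
    rw [add_zero] at hlim
    have hle : eLpNorm (fun ω => (v t x ω : ℂ) - v' t x ω) 2 P ≤ 0 := by
      refine ge_of_tendsto hlim (Eventually.of_forall fun S => ?_)
      refine le_trans (le_of_eq ?_) (eLpNorm_sub_le (hm v (hv.measurable t x) S)
        (hm v' (hv'.measurable t x) S) (by norm_num))
      congr 1
      ext ω
      simp
    have h0 := (eLpNorm_eq_zero_iff (by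
      have h1 := hv.measurable t x
      have h2 := hv'.measurable t x
      exact (by fun_prop : Measurable fun ω => (v t x ω : ℂ) - v' t x ω).aestronglyMeasurable)
      (by norm_num)).1 (nonpos_iff_eq_zero.1 hle)
    filter_upwards [h0] with ω hω
    have : (v t x ω : ℂ) = v' t x ω := sub_eq_zero.1 hω
    exact_mod_cast this
  have hall := ae_all_iff.2 fun i : ℕ =>
    hpt (TopologicalSpace.denseSeq (ℝ × EuclideanSpace ℝ (Fin d)) i)
  filter_upwards [hall, hv.continuous_paths, hv'.continuous_paths] with ω h1 h2 h3 t x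
  have := (TopologicalSpace.denseRange_denseSeq (ℝ × EuclideanSpace ℝ (Fin d))).equalizer h2 h3
    (funext h1)
  exact congr_fun this (t, x)

/-- The zero mode is constant in space, so that it does not contribute to the gradient. -/
lemma hasGradientAt_heatField {b : (Fin d → ℤ) → ℝ≥0 → ℂ}
    (h0 : HasBlockDecay α (fieldCoeff Khat) F b)
    (hgrad : ∀ i, HasBlockDecay α (gradCoeff Khat i) F b) (t : ℝ) (x : EuclideanSpace ℝ (Fin d)) :
    HasGradientAt (fun x => heatField Khat F b (t, x)) (gradSeries Khat F b (t, x)) x := by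
  have h1 := hasGradientAt_modeSum Khat {0} b t x
  have h2 : (WithLp.toLp 2 fun i => modeSum (gradCoeff Khat i) {0} b (t, x) :
      EuclideanSpace ℝ (Fin d)) = 0 := by
    ext i
    simp [modeSum, gradCoeff, waveVector]
  rw [h2] at h1
  have h3 := HasFDerivAt.fun_add h1.hasFDerivAt (hasGradientAt_modeSeries h0 hgrad t x).hasFDerivAt
  rw [hasGradientAt_iff_hasFDerivAt]
  refine h3.congr_fderiv ?_
  rw [map_zero, zero_add]

/-! ### The Hölder seminorm of the gradient -/

/-- For continuous functions the seminorm is a supremum over countably many pairs of points. -/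
lemma parabolicHolderSeminorm_eq_iSup_denseSeq {α : ℝ}
    {f : ℝ × EuclideanSpace ℝ (Fin d) → EuclideanSpace ℝ (Fin d)} (hf : Continuous f) :
    parabolicHolderSeminorm α f =
      ⨆ (i : ℕ) (j : ℕ) (_ : TopologicalSpace.denseSeq (ℝ × EuclideanSpace ℝ (Fin d)) i ≠
        TopologicalSpace.denseSeq (ℝ × EuclideanSpace ℝ (Fin d)) j),
      ENNReal.ofReal (‖f (TopologicalSpace.denseSeq (ℝ × EuclideanSpace ℝ (Fin d)) i) -
          f (TopologicalSpace.denseSeq (ℝ × EuclideanSpace ℝ (Fin d)) j)‖ /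
        parabolicDist (TopologicalSpace.denseSeq (ℝ × EuclideanSpace ℝ (Fin d)) i)
          (TopologicalSpace.denseSeq (ℝ × EuclideanSpace ℝ (Fin d)) j) ^ α) := by
  set u := TopologicalSpace.denseSeq (ℝ × EuclideanSpace ℝ (Fin d)) with hu
  have hdense : DenseRange u := TopologicalSpace.denseRange_denseSeq _
  refine le_antisymm ?_ ?_
  · refine iSup_le fun z => iSup_le fun z' => iSup_le fun hz => ?_
    by_contra hcon
    rw [not_le] at hcon
    set ρ : (ℝ × EuclideanSpace ℝ (Fin d)) × (ℝ × EuclideanSpace ℝ (Fin d)) → ℝ≥0∞ :=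
      fun p => ENNReal.ofReal (‖f p.1 - f p.2‖ / parabolicDist p.1 p.2 ^ α) with hρ
    have hpos := parabolicDist_pos hz
    have hcont : ContinuousAt ρ (z, z') := by
      have hd : Continuous fun p :
          (ℝ × EuclideanSpace ℝ (Fin d)) × (ℝ × EuclideanSpace ℝ (Fin d)) =>
          parabolicDist p.1 p.2 := by
        unfold parabolicDist; fun_prop
      have hn : Continuous fun p :
          (ℝ × EuclideanSpace ℝ (Fin d)) × (ℝ × EuclideanSpace ℝ (Fin d)) =>
          ‖f p.1 - f p.2‖ := by fun_prop
      exact ENNReal.continuous_ofReal.continuousAt.comp (hn.continuousAt.div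
        (hd.continuousAt.rpow_const (Or.inl hpos.ne')) (Real.rpow_pos_of_pos hpos α).ne')
    have hne : ∀ᶠ p : (ℝ × EuclideanSpace ℝ (Fin d)) × (ℝ × EuclideanSpace ℝ (Fin d)) in
        𝓝 (z, z'), p.1 ≠ p.2 :=
      (isOpen_ne_fun continuous_fst continuous_snd).mem_nhds hz
    have hev := (hcont.eventually (lt_mem_nhds hcon)).and hne
    obtain ⟨p, ⟨⟨i, j⟩, rfl⟩, hp, hij⟩ := (hdense.prodMap hdense).inter_nhds_nonempty hev
    have hij' : u i ≠ u j := hij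
    have hle : ρ (u i, u j) ≤ ⨆ (i : ℕ) (j : ℕ) (_ : u i ≠ u j),
        ENNReal.ofReal (‖f (u i) - f (u j)‖ / parabolicDist (u i) (u j) ^ α) :=
      le_iSup_of_le i (le_iSup_of_le j (le_iSup_of_le hij' le_rfl))
    exact absurd hle (not_le.2 hp)
  · exact iSup_le fun i => iSup_le fun j => iSup_le fun h =>
      le_iSup_of_le (u i) (le_iSup_of_le (u j) (le_iSup_of_le h le_rfl))

/-- A uniform exponential bound on increments is a bound on the exponential of the squared
seminorm. -/
lemma exp_parabolicHolderSeminorm_sq_le {α C : ℝ} (hC : 0 < C) {M : ℝ≥0∞}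
    {f : ℝ × EuclideanSpace ℝ (Fin d) → EuclideanSpace ℝ (Fin d)}
    (h : ∀ z z', ENNReal.ofReal (Real.exp (‖f z - f z'‖ ^ 2 / (C * (parabolicDist z z' ^ α) ^ 2)))
      ≤ M) :
    EReal.exp ((parabolicHolderSeminorm α f ^ 2 / ENNReal.ofReal C : ℝ≥0∞) : EReal) ≤ M := by
  by_cases hM : M = ∞
  · rw [hM]; exact le_top
  have h' : ∀ z z', Real.exp (‖f z - f z'‖ ^ 2 / (C * (parabolicDist z z' ^ α) ^ 2)) ≤ M.toReal :=
    fun z z' => (ENNReal.ofReal_le_iff_le_toReal hM).1 (h z z')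
  set m := M.toReal with hm
  have hm0 : 0 < m := (Real.exp_pos _).trans_le (h' 0 0)
  have hlog : ∀ z z', ‖f z - f z'‖ ^ 2 / (C * (parabolicDist z z' ^ α) ^ 2) ≤ Real.log m :=
    fun z z' => (Real.le_log_iff_exp_le hm0).2 (h' z z')
  have hlog0 : 0 ≤ Real.log m := le_trans (by positivity) (hlog 0 0)
  have hsemi : parabolicHolderSeminorm α f ≤ ENNReal.ofReal √(C * Real.log m) := by
    refine iSup_le fun z => iSup_le fun z' => iSup_le fun hz => ENNReal.ofReal_le_ofReal ?_
    have hpos := Real.rpow_pos_of_pos (parabolicDist_pos hz) α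
    refine Real.le_sqrt_of_sq_le ?_
    have := hlog z z'
    rw [div_le_iff₀ (by positivity)] at this
    rw [div_pow, div_le_iff₀ (by positivity)]
    linarith
  have hle : parabolicHolderSeminorm α f ^ 2 / ENNReal.ofReal C ≤ ENNReal.ofReal (Real.log m) := by
    refine ENNReal.div_le_of_le_mul ?_
    refine (pow_le_pow_left' hsemi 2).trans_eq ?_
    rw [← ENNReal.ofReal_pow (Real.sqrt_nonneg _), Real.sq_sqrt (by positivity), mul_comm,
      ENNReal.ofReal_mul hlog0]
  calc _ ≤ EReal.exp ((ENNReal.ofReal (Real.log m) : ℝ≥0∞) : EReal) :=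
        EReal.exp_monotone (EReal.coe_ennreal_le_coe_ennreal_iff.2 hle)
    _ = ENNReal.ofReal m := by
        rw [EReal.coe_ennreal_ofReal, max_eq_left hlog0, EReal.exp_coe, Real.exp_log hm0]
    _ = M := ENNReal.ofReal_toReal hM

end Field

/-! ### The exponential moment -/

section Moment

variable {d : ℕ}

lemma HasBlockDecay.continuous_gradSeries {α : ℝ} {Khat : (Fin d → ℤ) → ℝ}
    {F : ℕ → Finset (Fin d → ℤ)} {b : (Fin d → ℤ) → ℝ≥0 → ℂ}
    (h : ∀ i, HasBlockDecay α (gradCoeff Khat i) F b) (hα : 0 ≤ α) (hb : ∀ n, Continuous (b n)) :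
    Continuous (gradSeries Khat F b) :=
  (PiLp.continuous_toLp 2 _).comp (continuous_pi fun i => (h i).continuous hα hb)

lemma aemeasurable_parabolicHolderSeminorm {Ω : Type*} [MeasurableSpace Ω] {P : Measure Ω}
    {α : ℝ} {f : Ω → ℝ × EuclideanSpace ℝ (Fin d) → EuclideanSpace ℝ (Fin d)}
    (hf : ∀ z, Measurable fun ω => f ω z) (hc : ∀ᵐ ω ∂P, Continuous (f ω)) :
    AEMeasurable (fun ω => parabolicHolderSeminorm α (f ω)) P := by
  refine AEMeasurable.congr (f := fun ω =>
      ⨆ (i : ℕ) (j : ℕ) (_ : TopologicalSpace.denseSeq (ℝ × EuclideanSpace ℝ (Fin d)) i ≠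
        TopologicalSpace.denseSeq (ℝ × EuclideanSpace ℝ (Fin d)) j),
      ENNReal.ofReal (‖f ω (TopologicalSpace.denseSeq (ℝ × EuclideanSpace ℝ (Fin d)) i) -
          f ω (TopologicalSpace.denseSeq (ℝ × EuclideanSpace ℝ (Fin d)) j)‖ /
        parabolicDist (TopologicalSpace.denseSeq (ℝ × EuclideanSpace ℝ (Fin d)) i)
          (TopologicalSpace.denseSeq (ℝ × EuclideanSpace ℝ (Fin d)) j) ^ α)) ?_ ?_
  · refine Measurable.aemeasurable (.iSup fun i => .iSup fun j => .iSup fun _ => ?_)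
    have h1 := hf (TopologicalSpace.denseSeq (ℝ × EuclideanSpace ℝ (Fin d)) i)
    have h2 := hf (TopologicalSpace.denseSeq (ℝ × EuclideanSpace ℝ (Fin d)) j)
    fun_prop
  · filter_upwards [hc] with ω hω
    rw [parabolicHolderSeminorm_eq_iSup_denseSeq hω]

/-- The assertion in a fixed dimension, with a constant that depends on the dimension. -/
theorem exists_constant_of_dimension (α s : ℝ) (hα : 0 < α) (d : ℕ) (hd : 1 ≤ d)
    (hαs : α < min ((s - d) / 2) 1) :
    ∃ C : ℝ, 0 < C ∧ ∀ (Khat : (Fin d → ℤ) → ℝ)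
        (_ : ∀ n, 0 ≤ Khat n) (_ : ∀ n, Khat (-n) = Khat n)
        (_ : ∀ n, Khat n ≤ (1 + ‖waveVector n‖ ^ 2) ^ (-s / 2))
        (Ω : Type*) [MeasurableSpace Ω] (P : Measure Ω) [IsProbabilityMeasure P]
        (β : (Fin d → ℤ) → ℝ≥0 → Ω → ℂ) (_ : IsConjSymmBrownianFamily P β),
        (∃ v : ℝ → EuclideanSpace ℝ (Fin d) → Ω → ℝ, IsLinearHeatField P Khat β v) ∧
        ∀ v : ℝ → EuclideanSpace ℝ (Fin d) → Ω → ℝ, IsLinearHeatField P Khat β v →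
          (∀ᵐ ω ∂P, ∀ t, Differentiable ℝ fun x => v t x ω) ∧
          AEMeasurable (fun ω => parabolicHolderSeminorm α (spatialGradient v ω)) P ∧
          ∫⁻ ω, EReal.exp
            ((parabolicHolderSeminorm α (spatialGradient v ω) ^ 2 / ENNReal.ofReal C : ℝ≥0∞) :
              EReal) ∂P < ∞ := by
  obtain ⟨θ, hαθ, hθ⟩ := exists_between hαs
  have hθ1 : θ ≤ 1 := (hθ.trans_le (min_le_right _ _)).le
  have hθs : 2 * θ < s - d := by
    have := hθ.trans_le (min_le_left _ _)
    linarith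
  have hθ0 : 0 < θ := hα.trans hαθ
  have hs0 : 0 ≤ s := by linarith [Nat.cast_nonneg (α := ℝ) d]
  have hd0 : (0 : ℝ) < d := by exact_mod_cast hd
  obtain ⟨C, hC, K, hK, H⟩ := exists_exp_moment_holder d hα (hαθ.le.trans hθ1) hαθ
  set w : (Fin d → ℤ) → ℝ := latticeWeight s θ with hw_def
  have hw0 : ∀ n, 0 ≤ w n := latticeWeight_nonneg s θ
  have hw : Summable w := summable_latticeWeight hs0 hθs
  set W : ℝ := 44 * (∑' n, w n + 1) with hW_def
  have hW : 0 < W := by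
    have : 0 ≤ ∑' n, w n := tsum_nonneg hw0
    positivity
  refine ⟨d * (C * W), by positivity, ?_⟩
  intro Khat hK0 hKs hKle Ω _ P _ β hβ
  obtain ⟨F, A, hF⟩ := exists_isBlockExhaustion hw0 hw
  obtain ⟨B, hB⟩ := hβ.exists_isContinuousVersion
  have hdom0 : IsDominatedBy θ w (fieldCoeff Khat) := isDominatedBy_fieldCoeff hK0 hKle
  have hdom : ∀ i, IsDominatedBy θ w (gradCoeff Khat i) := isDominatedBy_gradCoeff hK0 hKle
  have hdecay0 := hB.ae_hasBlockDecay hβ hα hαθ hθ1 hdom0 hF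
  have hdecay : ∀ᵐ ω ∂P, ∀ i, HasBlockDecay α (gradCoeff Khat i) F (B ω) :=
    ae_all_iff.2 fun i => hB.ae_hasBlockDecay hβ hα hαθ hθ1 (hdom i) hF
  have hfield := hB.exists_isLinearHeatField hβ hKs hθ0.le hθ1 hα.le hdom0 hw0 hw hF hdecay0
  refine ⟨⟨_, hfield⟩, fun v hv => ?_⟩
  have hveq := hv.ae_eq hB hfield
  -- every version has the gradient that is given by the Fourier series
  have hgrad : ∀ᵐ ω ∂P, ∀ t x,
      HasGradientAt (fun x => v t x ω) (gradSeries Khat F (B ω) (t, x)) x := by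
    filter_upwards [hveq, hdecay0, hdecay] with ω h1 h2 h3 t x
    have : (fun x => v t x ω) = fun x => heatField Khat F (B ω) (t, x) := funext fun x => h1 t x
    rw [this]
    exact hasGradientAt_heatField h2 h3 t x
  have hspatial : ∀ᵐ ω ∂P, spatialGradient v ω = gradSeries Khat F (B ω) := by
    filter_upwards [hgrad] with ω h
    ext1 ⟨t, x⟩
    exact (h t x).gradient
  refine ⟨?_, ?_, ?_⟩
  · filter_upwards [hgrad] with ω h t x
    exact (h t x).differentiableAt
  · refine (aemeasurable_parabolicHolderSeminorm (P := P) (α := α)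
      (f := fun ω => gradSeries Khat F (B ω))
      (fun z => ?_) ?_).congr ?_
    · exact (WithLp.measurable_toLp 2 _).comp
        (measurable_pi_lambda _ fun i => hB.measurable_modeSeries (gradCoeff Khat i) F z)
    · filter_upwards [hdecay] with ω h
      exact HasBlockDecay.continuous_gradSeries h hα.le (hB.continuous ω)
    · filter_upwards [hspatial] with ω h
      rw [h]
  -- the exponential moment, first for partial sums, then by Fatou's lemma
  have hsum : ∀ (i : Fin d) (j : ℕ), 44 * ∑ n ∈ F j, ‖gradCoeff Khat i n‖ ^ 2 *
      (‖waveVector n‖ ^ θ) ^ 2 / ‖waveVector n‖ ^ 2 ≤ W := fun i j => by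
    have h1 := (hdom i).sum_le (hF.zero_notMem j)
    have h2 := hw.sum_le_tsum (F j) fun n _ => hw0 n
    linarith
  choose M hMm hMint hM using fun (i : Fin d) (j : ℕ) =>
    H Ω P (fun ω => modeSum (gradCoeff Khat i) (F j) (B ω))
    (fun z => hB.measurable_modeSum _ _ z)
    (fun ω => isPeriodicHeatFlow_modeSum _ _ (hB.continuous ω)) W hW
    (fun z z' hz hz' => hB.hasSubgaussianMGF_modeSum_sub hβ (hF.zero_notMem j) hθ0.le hθ1
      (hsum i j) z z' hz hz')
  set N : Ω → ℝ≥0∞ := fun ω => liminf (fun j => ∑ i, M i j ω) atTop with hN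
  have hNint : ∫⁻ ω, N ω ∂P < ∞ := by
    have h1 : ∫⁻ ω, N ω ∂P ≤ liminf (fun j => ∫⁻ ω, ∑ i, M i j ω ∂P) atTop :=
      lintegral_liminf_le fun j => Finset.measurable_sum _ fun i _ => hMm i j
    have h2 : ∀ j, ∫⁻ ω, ∑ i, M i j ω ∂P ≤ d * K := fun j => by
      rw [lintegral_finsetSum _ fun i _ => hMm i j]
      refine (Finset.sum_le_sum fun i _ => hMint i j).trans_eq ?_
      simp
    refine lt_of_le_of_lt (h1.trans (liminf_le_of_le (by isBoundedDefault) fun b hb =>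
      let ⟨j, hj⟩ := hb.exists
      hj.trans (h2 j))) ?_
    exact ENNReal.mul_lt_top (ENNReal.natCast_lt_top d) hK.lt_top
  refine lt_of_le_of_lt (lintegral_mono_ae ?_) hNint
  filter_upwards [hspatial, hdecay] with ω h1 h2
  rw [h1]
  refine exp_parabolicHolderSeminorm_sq_le (by positivity) fun z z' => ?_
  set δ := (parabolicDist z z' ^ α) ^ 2 with hδ
  have hδ0 : 0 ≤ δ := sq_nonneg _
  have hlim : Tendsto (fun j => ENNReal.ofReal (Real.exp ((∑ i, (modeSum (gradCoeff Khat i) (F j)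
      (B ω) z - modeSum (gradCoeff Khat i) (F j) (B ω) z') ^ 2) / (d * (C * W) * δ)))) atTop
      (𝓝 (ENNReal.ofReal (Real.exp (‖gradSeries Khat F (B ω) z - gradSeries Khat F (B ω) z'‖ ^ 2 /
        (d * (C * W) * δ))))) := by
    refine ENNReal.tendsto_ofReal ((Real.continuous_exp.tendsto _).comp (Tendsto.div_const ?_ _))
    rw [EuclideanSpace.norm_sq_eq]
    refine tendsto_finsetSum _ fun i _ => ?_
    rw [Real.norm_eq_abs, sq_abs]
    exact (((h2 i).tendsto hF.zero hF.mono z).sub ((h2 i).tendsto hF.zero hF.mono z')).pow 2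
  rw [← hlim.liminf_eq]
  refine liminf_le_liminf (Eventually.of_forall fun j => ?_)
  -- the largest component dominates the average of the squares
  set X : Fin d → ℝ := fun i => (modeSum (gradCoeff Khat i) (F j) (B ω) z -
    modeSum (gradCoeff Khat i) (F j) (B ω) z') ^ 2 with hX
  have : Nonempty (Fin d) := ⟨⟨0, hd⟩⟩
  obtain ⟨i, -, hi⟩ := Finset.exists_max_image Finset.univ X Finset.univ_nonempty
  have hle : (∑ i, X i) / (d * (C * W) * δ) ≤ X i / (C * W * δ) := by
    have h3 : ∑ i, X i ≤ d * X i := by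
      refine (Finset.sum_le_sum fun l hl => hi l hl).trans_eq ?_
      simp
    have h4 : X i / (C * W * δ) = d * X i / (d * (C * W) * δ) := by
      rw [mul_assoc (d : ℝ), mul_div_mul_left _ _ hd0.ne']
    rw [h4]
    gcongr
  calc ENNReal.ofReal (Real.exp ((∑ i, X i) / (d * (C * W) * δ)))
      ≤ ENNReal.ofReal (Real.exp (X i / (C * W * δ))) := by gcongr
    _ ≤ M i j ω := hM i j ω z z'
    _ ≤ ∑ i, M i j ω := Finset.single_le_sum (f := fun i => M i j ω) (fun _ _ => zero_le)
        (Finset.mem_univ i)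

end Moment

theorem mainTheorem5 (α s : ℝ) (hα : 0 < α) :
    ∃ C : ℝ, 0 < C ∧
      ∀ (d : ℕ) (_ : 1 ≤ d) (_ : α < min ((s - d) / 2) 1)
        (Khat : (Fin d → ℤ) → ℝ)
        (_ : ∀ n, 0 ≤ Khat n) (_ : ∀ n, Khat (-n) = Khat n)
        (_ : ∀ n, Khat n ≤ (1 + ‖waveVector n‖ ^ 2) ^ (-s / 2))
        (Ω : Type*) [MeasurableSpace Ω] (P : Measure Ω) [IsProbabilityMeasure P]
        (β : (Fin d → ℤ) → ℝ≥0 → Ω → ℂ) (_ : IsConjSymmBrownianFamily P β),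
        (∃ v : ℝ → EuclideanSpace ℝ (Fin d) → Ω → ℝ, IsLinearHeatField P Khat β v) ∧
        ∀ v : ℝ → EuclideanSpace ℝ (Fin d) → Ω → ℝ, IsLinearHeatField P Khat β v →
          (∀ᵐ ω ∂P, ∀ t, Differentiable ℝ fun x => v t x ω) ∧
          AEMeasurable (fun ω => parabolicHolderSeminorm α (spatialGradient v ω)) P ∧
          ∫⁻ ω, EReal.exp
            ((parabolicHolderSeminorm α (spatialGradient v ω) ^ 2 / ENNReal.ofReal C : ℝ≥0∞) :
              EReal) ∂P < ∞ := by
  classical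
  have H := fun (d : ℕ) (h : 1 ≤ d ∧ α < min ((s - d) / 2) 1) =>
    exists_constant_of_dimension α s hα d h.1 h.2
  choose c hc hcH using H
  -- only the dimensions below `s` are admissible, so finitely many constants are needed
  set c' : ℕ → ℝ := fun d => if h : 1 ≤ d ∧ α < min ((s - d) / 2) 1 then c d h else 0 with hc'
  have hc'0 : ∀ d, 0 ≤ c' d := fun d => by
    simp only [hc']
    split_ifs with h
    exacts [(hc d h).le, le_rfl]
  refine ⟨∑ d ∈ Finset.range ⌈s⌉₊, c' d + 1, by
    have := Finset.sum_nonneg fun d (_ : d ∈ Finset.range ⌈s⌉₊) => hc'0 d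
    positivity, ?_⟩
  intro d hd hαd Khat hK0 hKs hK Ω _ P _ β hβ
  obtain ⟨hex, hall⟩ := hcH d ⟨hd, hαd⟩ Khat hK0 hKs hK Ω P β hβ
  refine ⟨hex, fun v hv => ?_⟩
  obtain ⟨h1, h2, h3⟩ := hall v hv
  refine ⟨h1, h2, lt_of_le_of_lt (lintegral_mono fun ω => EReal.exp_monotone
    (EReal.coe_ennreal_le_coe_ennreal_iff.2 (ENNReal.div_le_div_left
      (ENNReal.ofReal_le_ofReal ?_) _))) h3⟩
  have hmem : d ∈ Finset.range ⌈s⌉₊ := by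
    rw [Finset.mem_range, Nat.lt_ceil]
    have := hαd.trans_le (min_le_left _ _)
    linarith
  have hle := Finset.single_le_sum (f := c') (fun d _ => hc'0 d) hmem
  have hcd : c' d = c d ⟨hd, hαd⟩ := dif_pos ⟨hd, hαd⟩
  rw [← hcd]
  linarith
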